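/- Call a graph a cograph if it can be built from single vertices by repeatedly taking disjoint unions and complete joins of two graphs. A set $S$ of vertices of a finite simple graph $G$ is an identifying code if $N[v]\cap S\neq\emptyset$ for every vertex $v$ and $N[u]\cap S\neq N[v]\cap S$ for all distinct vertices $u,v$; it is an open locating-dominating set if the same holds with the open neighbourhoods $N(\cdot)$ in place of the closed neighbourhoods $N[\cdot]$. **Theorem.** There are linear-time algorithms that construct a minimum identifying code and a minimum open locating-dominating set of a cograph. Precisely, there are two word-RAM programs, one for identifying codes and one for open locating-dominating sets, and a constant $C$ such that each of them, given the adjacency lists (in arbitrary order) of any cograph $G$ with $n$ vertices and $m$ edges, halts after at most $C\,(n+m)$ unit-cost steps (constants, copying, addition, subtraction, indirect memory access, comparison), using only numbers that are at most $C\,(n+m)$, and outputs an identifying code (respectively, open locating-dominating set) of $G$ of smallest size if $G$ has one, and otherwise reports that $G$ has none. -/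

import Mathlib

/-! ### Cographs -/

/-- The complete join of two vertex-disjoint graphs. -/
def completeJoin {V W : Type} (G : SimpleGraph V) (H : SimpleGraph W) : SimpleGraph (V ⊕ W) :=
  (G ⊕g H) ⊔ completeBipartiteGraph V W

/-- A cograph is a graph that is obtained (up to isomorphism) from single vertices by repeated
disjoint unions and complete joins. -/
inductive IsCograph : {V : Type} → SimpleGraph V → Prop
  | single {V : Type} [Unique V] (G : SimpleGraph V) : IsCograph G
  | union {V W : Type} {G : SimpleGraph V} {H : SimpleGraph W} :
      IsCograph G → IsCograph H → IsCograph (G ⊕g H)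
  | join {V W : Type} {G : SimpleGraph V} {H : SimpleGraph W} :
      IsCograph G → IsCograph H → IsCograph (completeJoin G H)
  | iso {V W : Type} {G : SimpleGraph V} {H : SimpleGraph W} (e : G ≃g H) :
      IsCograph G → IsCograph H

/-! ### Identifying codes and open locating-dominating sets -/

section Codes

variable {V : Type} (G : SimpleGraph V)

/-- `x` dominates `v`: `x` lies in the closed neighbourhood of `v`. -/
def Dominates (x v : V) : Prop := x = v ∨ G.Adj x v

/-- `S` is a dominating set that separates all pairs of distinct vertices. -/
def IsIdentifyingCode (S : Finset V) : Prop :=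
  (∀ v, ∃ x ∈ S, Dominates G x v) ∧
    ∀ u v, u ≠ v → ∃ x ∈ S, ¬ (Dominates G x u ↔ Dominates G x v)

/-- `S` is a total dominating set that totally separates all pairs of distinct vertices
(`x` totally dominates `v` when `x` is in the open neighbourhood of `v`). -/
def IsOpenLocatingDominatingSet (S : Finset V) : Prop :=
  (∀ v, ∃ x ∈ S, G.Adj x v) ∧
    ∀ u v, u ≠ v → ∃ x ∈ S, ¬ (G.Adj x u ↔ G.Adj x v)

end Codes

/-- `S` satisfies `P` and has the smallest size among all vertex sets satisfying `P`. -/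
def IsMinimumSet {V : Type} (P : Finset V → Prop) (S : Finset V) : Prop :=
  P S ∧ ∀ T, P T → S.card ≤ T.card

/-! ### Word RAM programs

The memory consists of registers `0, 1, 2, …` and of arrays `0, 1, 2, …`, all holding natural
numbers. A program mentions only finitely many registers and arrays; these can be interleaved in
one linear memory with constant overhead. -/

namespace WordRAM

structure State where
  reg : ℕ → ℕ
  arr : ℕ → ℕ → ℕ

def State.setReg (s : State) (r v : ℕ) : State :=
  { s with reg := Function.update s.reg r v }

def State.setArr (s : State) (a i v : ℕ) : State :=
  { s with arr := Function.update s.arr a (Function.update (s.arr a) i v) }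

/-- Elementary instructions; `sub` is truncated subtraction. In `load r a i` and `store a i r`
the letter `a` is the name of an array and `i` is a register holding the index. -/
inductive Instr
  | const (r c : ℕ)
  | move (r p : ℕ)
  | add (r p q : ℕ)
  | sub (r p q : ℕ)
  | load (r a i : ℕ)
  | store (a i r : ℕ)

/-- Comparisons of the contents of two registers. -/
inductive Test
  | lt (p q : ℕ)
  | eq (p q : ℕ)

def Test.Holds (s : State) : Test → Prop
  | .lt p q => s.reg p < s.reg q
  | .eq p q => s.reg p = s.reg q

/-- The value that an instruction writes. -/
def Instr.value (s : State) : Instr → ℕ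
  | .const _ c => c
  | .move _ p => s.reg p
  | .add _ p q => s.reg p + s.reg q
  | .sub _ p q => s.reg p - s.reg q
  | .load _ a i => s.arr a (s.reg i)
  | .store _ _ r => s.reg r

/-- The state after an instruction. -/
def Instr.apply (s : State) : Instr → State
  | .const r c => s.setReg r (Instr.value s (.const r c))
  | .move r p => s.setReg r (Instr.value s (.move r p))
  | .add r p q => s.setReg r (Instr.value s (.add r p q))
  | .sub r p q => s.setReg r (Instr.value s (.sub r p q))
  | .load r a i => s.setReg r (Instr.value s (.load r a i))
  | .store a i r => s.setArr a (s.reg i) (Instr.value s (.store a i r))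

inductive Program
  | skip
  | instr (I : Instr)
  | seq (P Q : Program)
  | ite (b : Test) (P Q : Program)
  | while (b : Test) (P : Program)

/-- `Exec w P s t s'`: started in state `s`, the program `P` halts in state `s'` after exactly `t`
unit-cost steps (executed instructions and tests), and never writes a number larger than `w`
(a program that tries to do so gets stuck, so that `Exec` fails). -/
inductive Exec (w : ℕ) : Program → State → ℕ → State → Prop
  | skip (s : State) : Exec w .skip s 0 s
  | instr (I : Instr) (s : State) : I.value s ≤ w → Exec w (.instr I) s 1 (I.apply s)
  | seq {P Q : Program} {s s' s'' : State} {t t' : ℕ} :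
      Exec w P s t s' → Exec w Q s' t' s'' → Exec w (.seq P Q) s (t + t') s''
  | iteTrue {b : Test} {P Q : Program} {s s' : State} {t : ℕ} :
      b.Holds s → Exec w P s t s' → Exec w (.ite b P Q) s (t + 1) s'
  | iteFalse {b : Test} {P Q : Program} {s s' : State} {t : ℕ} :
      ¬ b.Holds s → Exec w Q s t s' → Exec w (.ite b P Q) s (t + 1) s'
  | whileFalse {b : Test} {P : Program} {s : State} :
      ¬ b.Holds s → Exec w (.while b P) s 1 s
  | whileTrue {b : Test} {P : Program} {s s' s'' : State} {t t' : ℕ} :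
      b.Holds s → Exec w P s t s' → Exec w (.while b P) s' t' s'' →
        Exec w (.while b P) s (t + t' + 1) s''

end WordRAM

/-! ### Graph input, set output, linear time -/

/-- `L` lists, in an arbitrary order and without repetition, the neighbours of every vertex. -/
def IsAdjacencyList {n : ℕ} (G : SimpleGraph (Fin n)) (L : Fin n → List (Fin n)) : Prop :=
  ∀ v, (L v).Nodup ∧ ∀ u, u ∈ L v ↔ G.Adj v u

/-- The initial memory for a graph with vertices `0, …, n - 1` and adjacency lists `L`.
Register `0` holds `n`; array `1` holds the concatenation of the lists of `0, …, n - 1`; array `0`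
holds at position `i ≤ n` the position in array `1` where the list of `i` starts (at position `n`,
the total length). Everything else is `0`. -/
def inputState {n : ℕ} (L : Fin n → List (Fin n)) : WordRAM.State where
  reg := fun r => if r = 0 then n else 0
  arr := fun a i =>
    if a = 0 then (if i ≤ n then (((List.ofFn L).take i).flatten).length else 0)
    else if a = 1 then (((List.ofFn L).flatten).map Fin.val).getD i 0
    else 0

/-- Array `2` of `s` holds the characteristic vector of the vertex set `S`. -/
def OutputsSet {n : ℕ} (s : WordRAM.State) (S : Finset (Fin n)) : Prop :=
  ∀ v : Fin n, s.arr 2 v = if v ∈ S then 1 else 0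

/-- `A` is a linear-time algorithm that, given any cograph `G` with `n` vertices and `m` edges by
its adjacency lists, constructs a minimum vertex set with property `P G` if there is a set with
this property (and then puts `1` in register `0`), and otherwise puts `0` in register `0`.
Both the number of steps and the numbers written are at most `C * (n + m)`. -/
def ConstructsMinimumOnCographs
    (P : ∀ {n : ℕ}, SimpleGraph (Fin n) → Finset (Fin n) → Prop) (A : WordRAM.Program) : Prop :=
  ∃ C : ℕ, ∀ (n : ℕ) (G : SimpleGraph (Fin n)) (L : Fin n → List (Fin n)),
    IsCograph G → IsAdjacencyList G L →
    ∃ (t : ℕ) (s : WordRAM.State),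
      WordRAM.Exec (C * (n + G.edgeSet.ncard)) A (inputState L) t s ∧
      t ≤ C * (n + G.edgeSet.ncard) ∧
      ((s.reg 0 = 1 ∧ ∃ S : Finset (Fin n), OutputsSet s S ∧ IsMinimumSet (P G) S) ∨
        (s.reg 0 = 0 ∧ ¬ ∃ S : Finset (Fin n), P G S))

/-!
The algorithm is a dynamic program along a cotree of the graph, and the cotree is built from the
adjacency lists in linear time.

Both kinds of codes are sets `S` that are dominating and separating for a relation `R`, namely for
`Dominates G` or for `G.Adj`. These relations agree with adjacency off the diagonal, so the two
problems differ only in the tables for the leaves of the cotree. For a module `M` of the graph and a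
separating set `S ⊆ M` three bits matter (`status`): whether some vertex of `M` is missed by all of
`S`, whether some vertex of `M` is covered by all of `S`, and whether `S` is empty. In a disjoint
union of `M₁` and `M₂`, two vertices from different parts are not separated by `S₁ ∪ S₂` exactly if
both of them are missed, and the bits of `S₁ ∪ S₂` are functions of the bits of `S₁` and `S₂`;
passing to the complement of `R` exchanges missed and covered vertices and gives the rule for joins
(`feasible_union_iff`). Hence the smallest sizes for the eight statuses can be computed from the
leaves upwards (`IsBest.isValue`, `mergeChild_spec`, `fold_spec`). The children of a node are folded
into it one after the other, in the topological order of the nodes, and for each of them the pairs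
of statuses that attain the minima are recorded; going back through this order yields an optimal set
(`Cotree.Traceback`, `traceback_spec`). A code exists if and only if the root has a value for a
status without a missed vertex.

The cotree is built by inserting the vertices one by one, as in the recognition algorithm of
Corneil, Perl and Stewart (`insertVertex_spec`, `build_spec`). As the input is promised to be a
cograph, and hence has no induced path on four vertices (`IsCograph.pathFree`), no test for being a
cograph is needed. Let `x` be the new vertex, and call a node of the cotree full, void or mixed if
all, none, or some but not all of the leaves below it are neighbours of `x`. The siblings of a mixed
node are full below a join node and void below a union node (`Represents.sibling_of_mixed`), so that
the mixed nodes form a path from the root to a lowest mixed node `u`. All children of `u` are full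
or void, and the cotree is correct after a change at `u` that depends only on which of them are full
(`Attach.insertion`, `Pair.insertion`, `Split.insertion`). The full nodes are found by a sweep from
the neighbours of `x` upwards, which takes time linear in the degree of `x` as every internal node
has at least two children (`Sweep.two_mul_le`). Among the parents of full nodes that are not full
themselves, `u` is the only one that is not the parent or grandparent of another one
(`Marked.eq_or_exists`), and so it is found with flags.

No lists of children are stored: every internal node has the number of its children and the sum of
their names modulo a number larger than all names. If just one child of `u` is not full, its name is
obtained by subtracting the names of the full ones. There are two additional isolated vertices, so
that the root is always a union node with at least two children.
-/

/-! ### Reasoning about word RAM programs -/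

namespace WordRAM

@[simp] theorem State.setReg_reg (s : State) (r v r' : ℕ) :
    (s.setReg r v).reg r' = if r' = r then v else s.reg r' := by
  simp [State.setReg, Function.update_apply]

@[simp] theorem State.setReg_arr (s : State) (r v : ℕ) : (s.setReg r v).arr = s.arr := rfl

@[simp] theorem State.setArr_reg (s : State) (a i v : ℕ) : (s.setArr a i v).reg = s.reg := rfl

@[simp] theorem State.setArr_arr (s : State) (a i v a' : ℕ) :
    (s.setArr a i v).arr a' = if a' = a then Function.update (s.arr a) i v else s.arr a' := by
  simp [State.setArr, Function.update_apply]

/-- Every number in the memory is at most `w`. -/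
def State.Bdd (w : ℕ) (s : State) : Prop := (∀ r, s.reg r ≤ w) ∧ ∀ a i, s.arr a i ≤ w

/-- Started in `s`, the program `P` halts within `c` steps, without writing a number larger than
`w`, in a state that satisfies `Q`. This is claimed only if the numbers in `s` are at most `w`, so
that moves, loads, stores and subtractions never have to be checked for overflow. -/
def HaltsWithin (w : ℕ) (P : Program) (s : State) (c : ℕ) (Q : State → Prop) : Prop :=
  s.Bdd w → ∃ t s', Exec w P s t s' ∧ t ≤ c ∧ s'.Bdd w ∧ Q s'

theorem HaltsWithin.mono {w : ℕ} {P : Program} {s : State} {c c' : ℕ} {Q Q' : State → Prop}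
    (h : HaltsWithin w P s c Q) (hc : c ≤ c') (hQ : ∀ s', Q s' → Q' s') :
    HaltsWithin w P s c' Q' := by
  intro hs
  obtain ⟨t, s', h1, h2, h3, h4⟩ := h hs
  exact ⟨t, s', h1, h2.trans hc, h3, hQ _ h4⟩

theorem HaltsWithin.seq {w : ℕ} {P P' : Program} {s : State} {c c' : ℕ} {Q : State → Prop}
    (h : HaltsWithin w P s c fun s' => HaltsWithin w P' s' c' Q) :
    HaltsWithin w (.seq P P') s (c + c') Q := by
  intro hs
  obtain ⟨t, s', h1, h2, h3, h4⟩ := h hs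
  obtain ⟨t', s'', h5, h6, h7, h8⟩ := h4 h3
  exact ⟨t + t', s'', .seq h1 h5, by omega, h7, h8⟩

theorem HaltsWithin.ite {w : ℕ} {b : Test} {P P' : Program} {s : State} {c c' : ℕ}
    {Q : State → Prop} (h : b.Holds s → HaltsWithin w P s c Q)
    (h' : ¬ b.Holds s → HaltsWithin w P' s c' Q) :
    HaltsWithin w (.ite b P P') s (c + c' + 1) Q := by
  intro hs
  by_cases hb : b.Holds s
  · obtain ⟨t, s', h1, h2, h3, h4⟩ := h hb hs
    exact ⟨t + 1, s', .iteTrue hb h1, by omega, h3, h4⟩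
  · obtain ⟨t, s', h1, h2, h3, h4⟩ := h' hb hs
    exact ⟨t + 1, s', .iteFalse hb h1, by omega, h3, h4⟩

/-- The rule for loops: `I j` is an invariant after `j` iterations, which forces the loop to end
after at most `N` iterations; the `j`-th iteration takes at most `c j` steps. -/
theorem HaltsWithin.while {w : ℕ} {b : Test} {P : Program} {Q : State → Prop}
    (I : ℕ → State → Prop) (c : ℕ → ℕ) (N : ℕ)
    (body : ∀ j s, I j s → b.Holds s → j < N ∧ HaltsWithin w P s (c j) (I (j + 1)))
    (exit : ∀ j s, I j s → ¬ b.Holds s → Q s) {s : State} (h0 : I 0 s) :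
    HaltsWithin w (.while b P) s (∑ j ∈ Finset.range N, (c j + 1) + 1) Q := by
  have key : ∀ m j s, j + m = N → I j s →
      HaltsWithin w (.while b P) s (∑ i ∈ Finset.range m, (c (j + i) + 1) + 1) Q := by
    intro m
    induction m with
    | zero =>
      intro j s hj hI hs
      by_cases hb : b.Holds s
      · have := (body j s hI hb).1
        omega
      · exact ⟨1, s, .whileFalse hb, by omega, hs, exit j s hI hb⟩
    | succ m ih =>
      intro j s hj hI hs
      by_cases hb : b.Holds s
      · obtain ⟨t, s', h1, h2, h3, h4⟩ := (body j s hI hb).2 hs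
        obtain ⟨t', s'', h5, h6, h7, h8⟩ := ih (j + 1) s' (by omega) h4 h3
        refine ⟨t + t' + 1, s'', .whileTrue hb h1 h5, ?_, h7, h8⟩
        rw [Finset.sum_range_succ']
        have : ∀ i, j + 1 + i = j + (i + 1) := fun i => by omega
        simp only [this] at h6
        simp only [add_zero]
        omega
      · exact ⟨1, s, .whileFalse hb, by omega, hs, exit j s hI hb⟩
  simpa using key N 0 s (by omega) h0

/-- The loop rule when all iterations have the same cost bound. -/
theorem HaltsWithin.while_const {w : ℕ} {b : Test} {P : Program} {Q : State → Prop}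
    (I : ℕ → State → Prop) (c : ℕ) (N : ℕ)
    (body : ∀ j s, I j s → b.Holds s → j < N ∧ HaltsWithin w P s c (I (j + 1)))
    (exit : ∀ j s, I j s → ¬ b.Holds s → Q s) {s : State} (h0 : I 0 s) :
    HaltsWithin w (.while b P) s (N * (c + 1) + 1) Q := by
  simpa using HaltsWithin.while I (fun _ => c) N body exit h0

/-- The instruction `I` does not write a number larger than `w`, given that the memory does not
hold one. -/
def Instr.Safe (w : ℕ) (s : State) : Instr → Prop
  | .const _ c => c ≤ w
  | .add _ p q => s.reg p + s.reg q ≤ w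
  | _ => True

/-- Weakest precondition of a loop-free program. -/
def Program.wp (w : ℕ) : Program → (State → Prop) → State → Prop
  | .skip, Q, s => Q s
  | .instr I, Q, s => I.Safe w s ∧ Q (I.apply s)
  | .seq P P', Q, s => P.wp w (P'.wp w Q) s
  | .ite b P P', Q, s => (b.Holds s → P.wp w Q s) ∧ (¬ b.Holds s → P'.wp w Q s)
  | .while _ _, _, _ => False

/-- An upper bound for the number of steps of a loop-free program. -/
def Program.cost : Program → ℕ
  | .skip => 0
  | .instr _ => 1
  | .seq P P' => P.cost + P'.cost
  | .ite _ P P' => P.cost + P'.cost + 1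
  | .while _ _ => 0

theorem Instr.value_le {w : ℕ} {s : State} (hs : s.Bdd w) {I : Instr} (h : I.Safe w s) :
    I.value s ≤ w := by
  cases I with
  | const r c => exact h
  | move r p => exact hs.1 p
  | add r p q => exact h
  | sub r p q => exact (Nat.sub_le _ _).trans (hs.1 p)
  | load r a i => exact hs.2 _ _
  | store a i r => exact hs.1 r

theorem State.Bdd.setReg {w : ℕ} {s : State} (hs : s.Bdd w) {r v : ℕ} (h : v ≤ w) :
    (s.setReg r v).Bdd w := by
  refine ⟨fun r' => ?_, hs.2⟩
  rw [State.setReg_reg]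
  split_ifs
  exacts [h, hs.1 _]

theorem State.Bdd.setArr {w : ℕ} {s : State} (hs : s.Bdd w) {a i v : ℕ} (h : v ≤ w) :
    (s.setArr a i v).Bdd w := by
  refine ⟨hs.1, fun a' i' => ?_⟩
  rw [State.setArr_arr]
  split_ifs
  · rw [Function.update_apply]
    split_ifs
    exacts [h, hs.2 _ _]
  · exact hs.2 _ _

theorem Instr.apply_bdd {w : ℕ} {s : State} (hs : s.Bdd w) {I : Instr} (h : I.Safe w s) :
    (I.apply s).Bdd w := by
  have := Instr.value_le hs h
  cases I <;> first | exact hs.setReg this | exact hs.setArr this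

theorem HaltsWithin.of_wp {w : ℕ} {P : Program} {Q : State → Prop} {s : State}
    (h : P.wp w Q s) : HaltsWithin w P s P.cost Q := by
  induction P generalizing Q s with
  | skip => exact fun hs => ⟨0, s, .skip s, le_rfl, hs, h⟩
  | instr I =>
    exact fun hs => ⟨1, _, .instr I s (Instr.value_le hs h.1), le_rfl, Instr.apply_bdd hs h.1, h.2⟩
  | seq P P' ih ih' => exact HaltsWithin.seq ((ih h).mono le_rfl fun s' hs' => ih' hs')
  | ite b P P' ih ih' => exact HaltsWithin.ite (fun hb => ih (h.1 hb)) (fun hb => ih' (h.2 hb))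
  | _ => exact h.elim

theorem Program.wp_mono {w : ℕ} {P : Program} {Q Q' : State → Prop} {s : State}
    (h : P.wp w Q s) (hQ : ∀ s', Q s' → Q' s') : P.wp w Q' s := by
  induction P generalizing Q Q' s with
  | skip => exact hQ _ h
  | instr I => exact ⟨h.1, hQ _ h.2⟩
  | seq P P' ih ih' => exact ih h fun s' hs' => ih' hs' hQ
  | ite b P P' ih ih' => exact ⟨fun hb => ih (h.1 hb) hQ, fun hb => ih' (h.2 hb) hQ⟩
  | _ => exact h.elim

/-- Sequential composition of a list of programs. -/
def Program.block : List Program → Program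
  | [] => .skip
  | P :: l => .seq P (Program.block l)

end WordRAM

/-! ### Cographs have no induced path on four vertices -/

/-- The relation `E` has no induced path on four vertices. (The four vertices are automatically
distinct when `E` is symmetric.) -/
def PathFree {V : Type*} (E : V → V → Prop) : Prop :=
  ∀ a b c d, E a b → E b c → E c d → ¬ E a c → ¬ E b d → ¬ E a d → False

theorem IsCograph.pathFree {V : Type} {G : SimpleGraph V} (h : IsCograph G) : PathFree G.Adj := by
  induction h with
  | single G =>
    intro a b c d hab
    exact absurd (Subsingleton.elim a b) hab.ne
  | union _ _ ih ih' =>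
    rintro (a | a) (b | b) (c | c) (d | d) <;> simp
    exacts [fun h1 h2 h3 h4 h5 => by_contra (ih a b c d h1 h2 h3 h4 h5),
      fun h1 h2 h3 h4 h5 => by_contra (ih' a b c d h1 h2 h3 h4 h5)]
  | join _ _ ih ih' =>
    rintro (a | a) (b | b) (c | c) (d | d) <;> simp [completeJoin]
    exacts [fun h1 h2 h3 h4 h5 => by_contra (ih a b c d h1 h2 h3 h4 h5),
      fun h1 h2 h3 h4 h5 => by_contra (ih' a b c d h1 h2 h3 h4 h5)]
  | iso e _ ih =>
    intro a b c d
    have := ih (e.symm a) (e.symm b) (e.symm c) (e.symm d)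
    simp only [SimpleGraph.Iso.map_adj_iff] at this
    exact this

theorem IsCograph.nonempty {V : Type} {G : SimpleGraph V} (h : IsCograph G) : Nonempty V := by
  induction h with
  | single G => exact ⟨default⟩
  | union _ _ ih _ => exact ⟨.inl ih.some⟩
  | join _ _ ih _ => exact ⟨.inl ih.some⟩
  | iso e _ ih => exact ⟨e ih.some⟩

/-! ### Cotrees -/

/-- A rooted tree whose nodes are natural numbers: `nodes` is the set of the nodes other than the
root, `par` gives the parents, `ty` the types of the internal nodes (`1` for a join, `0` for a
union), and `desc a` is the set of the leaves below `a`. -/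
structure Cotree where
  nodes : Finset ℕ
  par : ℕ → ℕ
  ty : ℕ → ℕ
  desc : ℕ → Finset ℕ

namespace Cotree

/-- `T` is a tree with root `r`. The leaves are the nodes smaller than `r`, and every internal node
has at least two children (as the sets `desc` increase strictly along parents). -/
structure IsTree (T : Cotree) (r : ℕ) : Prop where
  root_notMem : r ∉ T.nodes
  leaf_iff : ∀ v < r, v ∈ T.nodes ↔ v ∈ T.desc r
  desc_leaf : ∀ v ∈ T.nodes, v < r → T.desc v = {v}
  lt_root : ∀ v ∈ T.desc r, v < r
  par_mem : ∀ a ∈ T.nodes, T.par a ∈ insert r T.nodes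
  le_par : ∀ a ∈ T.nodes, r ≤ T.par a
  desc_ssubset : ∀ a ∈ T.nodes, T.desc a ⊂ T.desc (T.par a)
  desc_nonempty : ∀ a ∈ insert r T.nodes, (T.desc a).Nonempty
  disj : ∀ a ∈ T.nodes, ∀ b ∈ T.nodes, a ≠ b → T.par a = T.par b →
    ∀ v ∈ T.desc a, v ∉ T.desc b
  cover : ∀ p ∈ insert r T.nodes, r ≤ p → ∀ v ∈ T.desc p,
    ∃ c ∈ T.nodes, T.par c = p ∧ v ∈ T.desc c

/-- The tree `T` represents the graph `E` on its leaves: two leaves are adjacent if and only if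
their lowest common ancestor has type `1`. -/
structure Represents (T : Cotree) (r : ℕ) (E : ℕ → ℕ → Prop) : Prop extends T.IsTree r where
  adj : ∀ a ∈ T.nodes, ∀ b ∈ T.nodes, a ≠ b → T.par a = T.par b →
    ∀ u ∈ T.desc a, ∀ v ∈ T.desc b, (E u v ↔ T.ty (T.par a) = 1)

/-- The types of the internal nodes alternate along every path that starts at the root, which is
a union node. -/
structure Alternates (T : Cotree) (r : ℕ) : Prop where
  ty_root : T.ty r = 0
  ty_le : ∀ a ∈ T.nodes, r < a → T.ty a ≤ 1
  ty_ne : ∀ a ∈ T.nodes, r < a → T.ty a ≠ T.ty (T.par a)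

/-- The children of a node. -/
def children (T : Cotree) (p : ℕ) : Finset ℕ := {c ∈ T.nodes | T.par c = p}

@[simp] theorem mem_children {T : Cotree} {p c : ℕ} :
    c ∈ T.children p ↔ c ∈ T.nodes ∧ T.par c = p := by simp [children]

/-- `T.Le a b`: the node `b` is `a` or an ancestor of `a`. -/
def Le (T : Cotree) : ℕ → ℕ → Prop :=
  Relation.ReflTransGen fun c p => c ∈ T.nodes ∧ T.par c = p

section

variable {T : Cotree} {r : ℕ} {E : ℕ → ℕ → Prop} {a b c p q u v x : ℕ}

theorem Le.refl : T.Le a a := Relation.ReflTransGen.refl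

theorem le_par_of_mem (ha : a ∈ T.nodes) : T.Le a (T.par a) :=
  Relation.ReflTransGen.single ⟨ha, rfl⟩

theorem Le.trans (h : T.Le a b) (h' : T.Le b c) : T.Le a c := Relation.ReflTransGen.trans h h'

theorem Le.cases_top (h : T.Le a b) : a = b ∨ ∃ c ∈ T.nodes, T.Le a c ∧ T.par c = b := by
  rcases Relation.ReflTransGen.cases_tail h with h | ⟨c, h1, h2, h3⟩
  · exact .inl h.symm
  · exact .inr ⟨c, h2, h1, h3⟩

theorem Le.cases_bot (h : T.Le a b) : a = b ∨ a ∈ T.nodes ∧ T.Le (T.par a) b := by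
  rcases Relation.ReflTransGen.cases_head h with h | ⟨c, ⟨h2, rfl⟩, h1⟩
  · exact .inl h
  · exact .inr ⟨h2, h1⟩

namespace IsTree

variable (h : T.IsTree r)
include h

theorem desc_subset_of_le (hab : T.Le a b) : T.desc a ⊆ T.desc b := by
  induction hab with
  | refl => exact subset_rfl
  | tail _ h1 ih => exact ih.trans (h1.2 ▸ (h.desc_ssubset _ h1.1).subset)

theorem eq_or_card_lt (hab : T.Le a b) : a = b ∨ (T.desc a).card < (T.desc b).card := by
  rcases hab.cases_bot with h1 | ⟨h1, h2⟩
  · exact .inl h1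
  · exact .inr ((Finset.card_lt_card (h.desc_ssubset _ h1)).trans_le
      (Finset.card_le_card (h.desc_subset_of_le h2)))

theorem le_antisymm (hab : T.Le a b) (hba : T.Le b a) : a = b := by
  rcases h.eq_or_card_lt hab with h1 | h1
  · exact h1
  · have := Finset.card_le_card (h.desc_subset_of_le hba)
    omega

theorem leaf_le (ha : a ∈ insert r T.nodes) (hv : v ∈ T.desc a) : T.Le v a := by
  induction hn : (T.desc a).card using Nat.strong_induction_on generalizing a with
  | _ n ih =>
    by_cases har : r ≤ a
    · obtain ⟨c, hc, rfl, hvc⟩ := h.cover a ha har v hv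
      exact (ih _ (hn ▸ Finset.card_lt_card (h.desc_ssubset c hc))
        (Finset.mem_insert_of_mem hc) hvc rfl).trans (le_par_of_mem hc)
    · have hN : a ∈ T.nodes := by
        rcases Finset.mem_insert.1 ha with rfl | h1
        · exact absurd le_rfl har
        · exact h1
      rw [h.desc_leaf a hN (by omega), Finset.mem_singleton] at hv
      exact hv ▸ Le.refl

theorem le_total (ha : a ∈ insert r T.nodes) (hb : b ∈ insert r T.nodes) (hva : v ∈ T.desc a)
    (hvb : v ∈ T.desc b) : T.Le a b ∨ T.Le b a := by
  refine Relation.ReflTransGen.total_of_right_unique ?_ (h.leaf_le ha hva) (h.leaf_le hb hvb)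
  rintro a b c ⟨_, rfl⟩ ⟨_, h⟩
  exact h

theorem le_of_subset (ha : a ∈ insert r T.nodes)
    (hb : b ∈ insert r T.nodes) (hab : T.desc a ⊆ T.desc b) : T.Le a b := by
  obtain ⟨v, hv⟩ := h.desc_nonempty _ ha
  rcases h.le_total ha hb hv (hab hv) with h1 | h1
  · exact h1
  · rcases h.eq_or_card_lt h1 with rfl | h2
    · exact Le.refl
    · have := Finset.card_le_card hab
      omega

theorem le_root (ha : a ∈ insert r T.nodes) : T.Le a r := by
  -- the number of leaves increases along parents and is bounded, so the root is reached
  induction hn : (T.nodes.sup fun c => (T.desc (T.par c)).card) - (T.desc a).card using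
    Nat.strong_induction_on generalizing a with
  | _ n ih =>
    rcases Finset.mem_insert.1 ha with rfl | ha
    · exact Le.refl
    · have h1 := Finset.card_lt_card (h.desc_ssubset a ha)
      have h2 : (T.desc (T.par a)).card ≤ T.nodes.sup fun c => (T.desc (T.par c)).card :=
        Finset.le_sup (f := fun c => (T.desc (T.par c)).card) ha
      exact (le_par_of_mem ha).trans (ih _ (by omega) (h.par_mem a ha) rfl)

theorem desc_subset_root (ha : a ∈ insert r T.nodes) : T.desc a ⊆ T.desc r :=
  h.desc_subset_of_le (h.le_root ha)

/-- Every child of an internal node has a sibling. -/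
theorem exists_sibling (hc : c ∈ T.nodes) : ∃ d ∈ T.nodes, d ≠ c ∧ T.par d = T.par c := by
  obtain ⟨v, hv, hv'⟩ := Finset.exists_of_ssubset (h.desc_ssubset c hc)
  obtain ⟨d, hd, hdc, hvd⟩ := h.cover _ (h.par_mem c hc) (h.le_par c hc) v hv
  exact ⟨d, hd, fun hdc' => hv' (hdc' ▸ hvd), hdc⟩

theorem par_ne_self (hc : c ∈ T.nodes) : T.par c ≠ c := fun hcc =>
  (h.desc_ssubset c hc).ne (by rw [hcc])

theorem not_par_le (hc : c ∈ T.nodes) : ¬ T.Le (T.par c) c := fun hcc =>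
  h.par_ne_self hc (h.le_antisymm hcc (le_par_of_mem hc))

/-- Two nodes with the same parent are equal if they have a common lower bound. -/
theorem eq_of_le_of_par_eq (hu : u ∈ insert r T.nodes)
    (ha : a ∈ T.nodes) (hb : b ∈ T.nodes)
    (hua : T.Le u a) (hub : T.Le u b) (hab : T.par a = T.par b) : a = b := by
  by_contra hne
  obtain ⟨v, hv⟩ := h.desc_nonempty _ hu
  exact h.disj a ha b hb hne hab v (h.desc_subset_of_le hua hv) (h.desc_subset_of_le hub hv)

end IsTree

/-! ### Full, empty and mixed nodes -/

/-- All leaves below `a` satisfy `P`. -/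
def Full (T : Cotree) (P : ℕ → Prop) (a : ℕ) : Prop := ∀ v ∈ T.desc a, P v

/-- No leaf below `a` satisfies `P`. -/
def Void (T : Cotree) (P : ℕ → Prop) (a : ℕ) : Prop := ∀ v ∈ T.desc a, ¬ P v

/-- Some but not all leaves below `a` satisfy `P`. -/
def Mixed (T : Cotree) (P : ℕ → Prop) (a : ℕ) : Prop := ¬ T.Full P a ∧ ¬ T.Void P a

variable {P : ℕ → Prop}

theorem IsTree.mixed_of_le (h : T.IsTree r) (hab : T.Le a b) (ha : T.Mixed P a) :
    T.Mixed P b :=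
  ⟨fun hf => ha.1 fun v hv => hf v (h.desc_subset_of_le hab hv),
    fun hf => ha.2 fun v hv => hf v (h.desc_subset_of_le hab hv)⟩

theorem IsTree.root_lt_of_mixed (h : T.IsTree r) (ha : a ∈ T.nodes)
    (hm : T.Mixed P a) : r < a := by
  by_contra har
  have : a ≠ r := fun h1 => h.root_notMem (h1 ▸ ha)
  have hd := h.desc_leaf a ha (by omega)
  have h1 := hm.1
  have h2 := hm.2
  simp only [Full, Void, hd, Finset.mem_singleton, forall_eq, not_not] at h1 h2
  exact h1 h2

/-- A mixed node has two leaves of different status whose lowest common ancestor it is. -/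
theorem Represents.exists_pair_of_mixed (h : T.Represents r E) (hb : b ∈ insert r T.nodes)
    (hrb : r ≤ b) (hm : T.Mixed P b) :
    ∃ y ∈ T.desc b, ∃ z ∈ T.desc b, P y ∧ ¬ P z ∧ (E y z ↔ T.ty b = 1) := by
  obtain ⟨h1, h2⟩ := hm
  simp only [Full, Void, not_forall, not_not] at h1 h2
  obtain ⟨z, hz, hPz⟩ := h1
  obtain ⟨y, hy, hPy⟩ := h2
  obtain ⟨c, hc, rfl, hyc⟩ := h.cover b hb hrb y hy
  obtain ⟨d, hd, hdc, hzd⟩ := h.cover _ hb hrb z hz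
  by_cases hcd : c = d
  · subst hcd
    obtain ⟨e, he, hec, hpe⟩ := h.exists_sibling hc
    obtain ⟨w, hw⟩ := h.desc_nonempty e (Finset.mem_insert_of_mem he)
    have hwb : w ∈ T.desc (T.par c) := hpe ▸ (h.desc_ssubset e he).subset hw
    by_cases hPw : P w
    · exact ⟨w, hwb, z, hz, hPw, hPz, hpe ▸ h.adj e he c hc hec hpe w hw z hzd⟩
    · exact ⟨y, hy, w, hwb, hPy, hPw, h.adj c hc e he hec.symm hpe.symm y hyc w hw⟩
  · exact ⟨y, hy, z, hz, hPy, hPz, h.adj c hc d hd hcd hdc.symm y hyc z hzd⟩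

/-- The siblings of a mixed node are full below a join node, and they are void below a union node:
otherwise `x` would lie on an induced path on four vertices. -/
theorem Represents.sibling_of_mixed (h : T.Represents r E) (hT : T.Alternates r)
    (hE : PathFree E) (hsymm : ∀ u v, E u v → E v u) (hb : b ∈ T.nodes) (hc : c ∈ T.nodes)
    (hbc : b ≠ c) (hpar : T.par b = T.par c) (hm : T.Mixed (E x) b) :
    (T.ty (T.par b) = 1 → T.Full (E x) c) ∧ (T.ty (T.par b) ≠ 1 → T.Void (E x) c) := by
  have hrb := h.root_lt_of_mixed hb hm
  have hty := hT.ty_ne b hb hrb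
  have hty' := hT.ty_le b hb hrb
  have hpty : T.ty (T.par b) ≤ 1 := by
    rcases Finset.mem_insert.1 (h.par_mem b hb) with h1 | h1
    · rw [h1, hT.ty_root]
      omega
    · exact hT.ty_le _ h1 (lt_of_le_of_ne (h.le_par b hb) fun h2 => h.root_notMem (h2 ▸ h1))
  obtain ⟨p, hp, q, hq, hxp, hxq, hpq⟩ :=
    h.exists_pair_of_mixed (Finset.mem_insert_of_mem hb) hrb.le hm
  constructor
  · intro h1 y hy
    by_contra hxy
    have hyp := (h.adj b hb c hc hbc hpar p hp y hy).2 h1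
    have hyq := (h.adj b hb c hc hbc hpar q hq y hy).2 h1
    exact hE x p y q hxp hyp (hsymm _ _ hyq) hxy (fun h2 => by have := hpq.1 h2; omega) hxq
  · intro h1 y hy hxy
    have hyp := mt (h.adj b hb c hc hbc hpar p hp y hy).1 h1
    have hyq := mt (h.adj b hb c hc hbc hpar q hq y hy).1 h1
    exact hE y x p q (hsymm _ _ hxy) hxp (hpq.2 (by omega)) (fun h2 => hyp (hsymm _ _ h2)) hxq
      (fun h2 => hyq (hsymm _ _ h2))

/-- `u` is the lowest mixed node: the mixed nodes are its ancestors. -/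
structure IsLowestMixed (T : Cotree) (r : ℕ) (P : ℕ → Prop) (u : ℕ) : Prop where
  mem : u ∈ insert r T.nodes
  mixed : T.Mixed P u
  le : ∀ a ∈ insert r T.nodes, T.Mixed P a → T.Le u a

theorem Represents.exists_isLowestMixed (h : T.Represents r E) (hT : T.Alternates r)
    (hE : PathFree E) (hsymm : ∀ u v, E u v → E v u) (hr : T.Mixed (E x) r) :
    ∃ u, T.IsLowestMixed r (E x) u := by
  classical
  obtain ⟨u, hu, hmin⟩ := Finset.exists_min_image
    ((insert r T.nodes).filter (T.Mixed (E x))) (fun a => (T.desc a).card) ⟨r, by simp [hr]⟩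
  rw [Finset.mem_filter] at hu
  refine ⟨u, hu.1, hu.2, fun a ha hma => ?_⟩
  induction hn : (T.desc r).card - (T.desc a).card using Nat.strong_induction_on
    generalizing a with
  | _ n ih =>
    rcases Finset.mem_insert.1 ha with rfl | haN
    · exact h.le_root hu.1
    · have hs := Finset.card_lt_card (h.desc_ssubset a haN)
      have hs' := Finset.card_le_card (h.desc_subset_root (h.par_mem a haN))
      have hmp := h.mixed_of_le (le_par_of_mem haN) hma
      have h1 := ih _ (by omega) (T.par a) (h.par_mem a haN) hmp rfl
      rcases h1.cases_top with h2 | ⟨c, hc, huc, hca⟩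
      · have := hmin a (Finset.mem_filter.2 ⟨ha, hma⟩)
        rw [h2] at this
        omega
      · have hmc := h.mixed_of_le huc hu.2
        by_cases hac : a = c
        · exact hac ▸ huc
        · have := h.sibling_of_mixed hT hE hsymm hc haN (Ne.symm hac) hca hmc
          by_cases h3 : T.ty (T.par c) = 1
          · exact absurd (this.1 h3) hma.1
          · exact absurd (this.2 h3) hma.2

end

end Cotree

/-! ### Surgery on cotrees -/

namespace Cotree

variable {T T' : Cotree} {r : ℕ} {E : ℕ → ℕ → Prop} {a b c p q u v x y t : ℕ}

theorem IsTree.root_le_of_le (h : T.IsTree r) (hq : r ≤ q) (hqc : T.Le q c) : r ≤ c := by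
  rcases hqc.cases_top with rfl | ⟨d, hd, _, rfl⟩
  exacts [hq, h.le_par d hd]

theorem IsTree.ne_root (h : T.IsTree r) (hc : c ∈ T.nodes) : c ≠ r :=
  fun h1 => h.root_notMem (h1 ▸ hc)

/-- `T'` arises from `T` by adding a leaf `x` as a child of the internal node `q`. -/
structure Attach (T T' : Cotree) (r x q : ℕ) : Prop where
  lt_root : x < r
  notMem : x ∉ T.nodes
  mem : q ∈ insert r T.nodes
  root_le : r ≤ q
  nodes : ∀ c, c ∈ T'.nodes ↔ c = x ∨ c ∈ T.nodes
  par_leaf : T'.par x = q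
  par : ∀ c ∈ T.nodes, T'.par c = T.par c
  desc_leaf : T'.desc x = {x}
  desc : ∀ c ∈ insert r T.nodes, ∀ v, v ∈ T'.desc c ↔ v ∈ T.desc c ∨ v = x ∧ T.Le q c

theorem Attach.desc_root (A : T.Attach T' r x q) (h : T.IsTree r) :
    T'.desc r = insert x (T.desc r) := by
  ext v
  rw [A.desc r (Finset.mem_insert_self _ _), Finset.mem_insert]
  have := h.le_root A.mem
  tauto

theorem Attach.notMem_desc (A : T.Attach T' r x q) (h : T.IsTree r)
    (hc : c ∈ insert r T.nodes) : x ∉ T.desc c := fun h1 =>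
  A.notMem ((h.leaf_iff x A.lt_root).2 (h.desc_subset_root hc h1))

theorem Attach.isTree (A : T.Attach T' r x q) (h : T.IsTree r) : T'.IsTree r := by
  have hxN := A.notMem
  have hxD : ∀ c ∈ insert r T.nodes, x ∉ T.desc c := fun c => A.notMem_desc h
  have hxr := A.lt_root
  have hq := A.mem
  have hrq := A.root_le
  have hmem := A.desc
  have hx' := A.desc_leaf
  have hpar := A.par
  have hparx := A.par_leaf
  have hN := A.nodes
  have hins : ∀ c ∈ T.nodes, c ∈ insert r T.nodes := fun c hc => Finset.mem_insert_of_mem hc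
  have hNx : ∀ c ∈ T.nodes, c ≠ x := fun c hc h1 => hxN (h1 ▸ hc)
  have hqsub : ∀ c ∈ T.nodes, T.par c = q → ¬ T.Le q c := fun c hc h1 => h1 ▸ h.not_par_le hc
  refine ⟨?_, ?_, ?_, ?_, ?_, ?_, ?_, ?_, ?_, ?_⟩
  · rw [hN]
    exact fun h1 => h1.elim hxr.ne' h.root_notMem
  · intro v hv
    rw [hN, A.desc_root h, Finset.mem_insert, h.leaf_iff v hv]
  · intro v hv hvr
    rcases (hN v).1 hv with rfl | hv
    · exact hx'
    · ext w
      rw [hmem v (hins v hv), h.desc_leaf v hv hvr]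
      refine ⟨fun h1 => h1.elim id fun h2 => ?_, .inl⟩
      have := h.root_le_of_le hrq h2.2
      omega
  · intro v hv
    rw [A.desc_root h, Finset.mem_insert] at hv
    rcases hv with rfl | hv
    exacts [hxr, h.lt_root v hv]
  · intro c hc
    rcases (hN c).1 hc with rfl | hc'
    · rw [hparx, Finset.mem_insert, hN]
      rw [Finset.mem_insert] at hq
      tauto
    · rw [hpar c hc', Finset.mem_insert, hN]
      have := h.par_mem c hc'
      rw [Finset.mem_insert] at this
      tauto
  · intro c hc
    rcases (hN c).1 hc with rfl | hc'
    · rwa [hparx]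
    · rw [hpar c hc']
      exact h.le_par c hc'
  · intro c hc
    rw [Finset.ssubset_iff_exists_subset_erase]
    rcases (hN c).1 hc with rfl | hc'
    · obtain ⟨v, hv⟩ := h.desc_nonempty _ hq
      refine ⟨v, ?_, ?_⟩
      · rw [hparx, hmem q hq]
        exact .inl hv
      · intro w hw
        rw [hx', Finset.mem_singleton] at hw
        subst hw
        rw [Finset.mem_erase, hparx, hmem q hq]
        exact ⟨fun h1 => hxD q hq (h1 ▸ hv), .inr ⟨rfl, Le.refl⟩⟩
    · obtain ⟨v, hv, hv'⟩ := Finset.exists_of_ssubset (h.desc_ssubset c hc')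
      have hvx : v ≠ x := fun h1 => hxD _ (h.par_mem c hc') (h1 ▸ hv)
      have hpm := h.par_mem c hc'
      rw [hpar c hc']
      refine ⟨v, (hmem _ hpm v).2 (.inl hv), fun w hw => ?_⟩
      rw [Finset.mem_erase, hmem _ hpm]
      rw [hmem _ (hins c hc')] at hw
      rcases hw with hw | ⟨rfl, hw⟩
      · exact ⟨fun h1 => hv' (h1 ▸ hw), .inl ((h.desc_ssubset c hc').subset hw)⟩
      · exact ⟨hvx.symm, .inr ⟨rfl, hw.trans (le_par_of_mem hc')⟩⟩
  · intro c hc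
    rw [Finset.mem_insert, hN] at hc
    by_cases hcx : c = x
    · rw [hcx, hx']
      exact Finset.singleton_nonempty _
    · have hc' : c ∈ insert r T.nodes := by
        rw [Finset.mem_insert]
        tauto
      obtain ⟨v, hv⟩ := h.desc_nonempty c hc'
      exact ⟨v, (hmem c hc' v).2 (.inl hv)⟩
  · intro c hc d hd hcd hpcd w hwc hwd
    rcases (hN c).1 hc with rfl | hc' <;> rcases (hN d).1 hd with rfl | hd'
    · exact hcd rfl
    · rw [hx', Finset.mem_singleton] at hwc
      subst hwc
      rw [hparx, hpar d hd'] at hpcd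
      rcases (hmem d (hins d hd') _).1 hwd with h1 | h1
      exacts [hxD d (hins d hd') h1, hqsub d hd' hpcd.symm h1.2]
    · rw [hx', Finset.mem_singleton] at hwd
      subst hwd
      rw [hparx, hpar c hc'] at hpcd
      rcases (hmem c (hins c hc') _).1 hwc with h1 | h1
      exacts [hxD c (hins c hc') h1, hqsub c hc' hpcd h1.2]
    · rw [hpar c hc', hpar d hd'] at hpcd
      rcases (hmem c (hins c hc') _).1 hwc with h1 | h1 <;>
        rcases (hmem d (hins d hd') _).1 hwd with h2 | h2
      · exact h.disj c hc' d hd' hcd hpcd w h1 h2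
      · exact hxD c (hins c hc') (h2.1 ▸ h1)
      · exact hxD d (hins d hd') (h1.1 ▸ h2)
      · exact hcd (h.eq_of_le_of_par_eq hq hc' hd' h1.2 h2.2 hpcd)
  · intro p hp hrp w hw
    have hp' : p ∈ insert r T.nodes := by
      rw [Finset.mem_insert, hN] at hp
      rw [Finset.mem_insert]
      rcases hp with h1 | h1 | h1
      · exact .inl h1
      · omega
      · exact .inr h1
    rcases (hmem p hp' w).1 hw with h1 | ⟨rfl, h1⟩
    · obtain ⟨c, hc, hcp, hwc⟩ := h.cover p hp' hrp w h1
      exact ⟨c, (hN c).2 (.inr hc), (hpar c hc).trans hcp, (hmem c (hins c hc) w).2 (.inl hwc)⟩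
    · rcases h1.cases_top with rfl | ⟨c, hc, hqc, rfl⟩
      · exact ⟨w, (hN w).2 (.inl rfl), hparx, by simp [hx']⟩
      · exact ⟨c, (hN c).2 (.inr hc), hpar c hc, (hmem c (hins c hc) w).2 (.inr ⟨rfl, hqc⟩)⟩

/-- Attaching `x` to `q` preserves the represented graph if `x` is joined to all leaves that hang
off the path from `q` to the root below a join node, and to no other leaves. -/
theorem Attach.represents (A : T.Attach T' r x q) (h : T.Represents r E)
    (hsymm : ∀ u v, E u v → E v u) (hty : ∀ c ∈ T'.nodes, T'.ty (T'.par c) = T.ty (T'.par c))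
    (hfit : ∀ c ∈ T.nodes, T.Le q (T.par c) → ¬ T.Le q c →
      ∀ v ∈ T.desc c, (E x v ↔ T.ty (T.par c) = 1)) : T'.Represents r E := by
  refine ⟨A.isTree h.toIsTree, fun c hc d hd hcd hpcd w hwc z hzd => ?_⟩
  have hins : ∀ c ∈ T.nodes, c ∈ insert r T.nodes := fun c hc => Finset.mem_insert_of_mem hc
  have hqsub : ∀ c ∈ T.nodes, T.par c = q → ¬ T.Le q c := fun c hc h1 => h1 ▸ h.not_par_le hc
  have hup : ∀ c ∈ T.nodes, T.Le q c → T.Le q (T.par c) := fun c hc h1 =>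
    h1.trans (le_par_of_mem hc)
  have hx' := A.desc_leaf
  have hmem := A.desc
  have hN := A.nodes
  rw [hty c hc]
  rcases (hN c).1 hc with rfl | hc' <;> rcases (hN d).1 hd with rfl | hd'
  · exact absurd rfl hcd
  · rw [hx', Finset.mem_singleton] at hwc
    subst hwc
    rw [A.par_leaf, A.par d hd'] at hpcd
    rw [A.par_leaf]
    have h2 := hqsub d hd' hpcd.symm
    rcases (hmem d (hins d hd') _).1 hzd with h1 | h1
    · rw [hfit d hd' (by rw [← hpcd]; exact Le.refl) h2 z h1, hpcd]
    · exact absurd h1.2 h2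
  · rw [hx', Finset.mem_singleton] at hzd
    subst hzd
    rw [A.par_leaf, A.par c hc'] at hpcd
    rw [A.par c hc']
    have h2 := hqsub c hc' hpcd
    rcases (hmem c (hins c hc') _).1 hwc with h1 | h1
    · rw [← hfit c hc' (by rw [hpcd]; exact Le.refl) h2 w h1]
      exact ⟨hsymm _ _, hsymm _ _⟩
    · exact absurd h1.2 h2
  · rw [A.par c hc', A.par d hd'] at hpcd
    rw [A.par c hc']
    have hne : ¬ (T.Le q c ∧ T.Le q d) := fun h1 =>
      hcd (h.eq_of_le_of_par_eq A.mem hc' hd' h1.1 h1.2 hpcd)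
    rcases (hmem c (hins c hc') _).1 hwc with h1 | h1 <;>
      rcases (hmem d (hins d hd') _).1 hzd with h2 | h2
    · exact h.adj c hc' d hd' hcd hpcd w h1 z h2
    · rw [h2.1, ← hfit c hc' (hpcd ▸ hup d hd' h2.2) (fun h3 => hne ⟨h3, h2.2⟩) w h1]
      exact ⟨hsymm _ _, hsymm _ _⟩
    · rw [h1.1, hpcd]
      exact hfit d hd' (hpcd ▸ hup c hc' h1.2) (fun h3 => hne ⟨h1.2, h3⟩) z h2
    · exact absurd ⟨h1.2, h2.2⟩ hne

/-- `T'` arises from `T` by splitting the internal node `u` into two nodes `top` and `bot`, one of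
which is `u` and the other one is new: `bot` becomes a child of `top` and takes over the set `B` of
children of `u`, the other children of `u` become children of `top`. -/
structure Split (T T' : Cotree) (r u y top bot : ℕ) (B : Finset ℕ) : Prop where
  ids : top = u ∧ bot = y ∨ u ∈ T.nodes ∧ top = y ∧ bot = u
  mem : u ∈ insert r T.nodes
  root_le : r ≤ u
  notMem : y ∉ T.nodes
  root_lt : r < y
  nodes : ∀ c, c ∈ T'.nodes ↔ c = y ∨ c ∈ T.nodes
  par_top : u ∈ T.nodes → T'.par top = T.par u
  par_bot : T'.par bot = top
  par_of_mem : ∀ c ∈ B, T'.par c = bot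
  par_of_notMem : ∀ c ∈ T.nodes, T.par c = u → c ∉ B → T'.par c = top
  par : ∀ c ∈ T.nodes, c ≠ u → T.par c ≠ u → T'.par c = T.par c
  desc_top : T'.desc top = T.desc u
  desc_bot : ∀ v, v ∈ T'.desc bot ↔ ∃ c ∈ B, v ∈ T.desc c
  desc : ∀ c ∈ insert r T.nodes, c ≠ u → T'.desc c = T.desc c
  subset : ∀ c ∈ B, c ∈ T.nodes ∧ T.par c = u
  two : ∀ c ∈ B, ∃ d ∈ B, d ≠ c
  nonempty : B.Nonempty
  rest : ∃ c ∈ T.nodes, T.par c = u ∧ c ∉ B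

namespace Split

variable {top bot : ℕ} {B : Finset ℕ}

theorem ne_root (A : T.Split T' r u y top bot B) (h : T.IsTree r) (hu : u ∈ T.nodes) :
    top ≠ r := by
  rcases A.ids with ⟨rfl, rfl⟩ | ⟨h1, rfl, rfl⟩
  · exact h.ne_root hu
  · exact A.root_lt.ne'

theorem top_ne_bot (A : T.Split T' r u y top bot B) : top ≠ bot := by
  have huy : u ≠ y := fun h1 => by
    have := A.mem
    rw [h1, Finset.mem_insert] at this
    exact this.elim A.root_lt.ne' A.notMem
  rcases A.ids with ⟨rfl, rfl⟩ | ⟨h1, rfl, rfl⟩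
  exacts [huy, huy.symm]

theorem ne_new (A : T.Split T' r u y top bot B) (hc : c ∈ insert r T.nodes) : c ≠ y := by
  rintro rfl
  rw [Finset.mem_insert] at hc
  exact hc.elim A.root_lt.ne' A.notMem

/-- The four kinds of nodes after a split: children of `bot`, the node `bot`, the other children of
`top`, and the nodes that keep their place (where `top` takes the place of `u`). -/
theorem cases (A : T.Split T' r u y top bot B) (h : T.IsTree r) (hc : c ∈ T'.nodes) :
    (T'.par c = bot ∧ c ∈ B ∧ c ∈ T.nodes ∧ T.par c = u ∧ T'.desc c = T.desc c) ∨
    (T'.par c = top ∧ c = bot) ∨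
    (T'.par c = top ∧ c ∈ T.nodes ∧ T.par c = u ∧ c ∉ B ∧ T'.desc c = T.desc c) ∨
    ∃ d ∈ T.nodes, T'.par c = T.par d ∧ T.par d ≠ top ∧ T.par d ≠ bot ∧ T.par d ≠ u ∧
      (c = d ∧ c ≠ u ∨ c = top ∧ d = u) ∧ T'.desc c = T.desc d := by
  have key : ∀ d ∈ T.nodes, T.par d ≠ u → T.par d ≠ top ∧ T.par d ≠ bot := by
    intro d hd hdu
    have := A.ne_new (h.par_mem d hd)
    rcases A.ids with ⟨rfl, rfl⟩ | ⟨_, rfl, rfl⟩ <;> tauto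
  by_cases hcb : c = bot
  · exact .inr (.inl ⟨hcb ▸ A.par_bot, hcb⟩)
  by_cases hct : c = top
  · have hu : u ∈ T.nodes := by
      rcases A.ids with ⟨h1, h2⟩ | h1
      · rcases (A.nodes c).1 hc with h3 | h3
        · exact absurd (h3.trans h2.symm) hcb
        · rwa [← h1, ← hct]
      · exact h1.1
    have h1 := h.par_ne_self hu
    exact .inr (.inr (.inr ⟨u, hu, hct ▸ A.par_top hu, (key u hu h1).1, (key u hu h1).2, h1,
      .inr ⟨hct, rfl⟩, hct ▸ A.desc_top⟩))
  have hcu : c ≠ u ∧ c ∈ T.nodes := by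
    rcases A.ids with ⟨rfl, rfl⟩ | ⟨_, rfl, rfl⟩ <;> rcases (A.nodes c).1 hc with h3 | h3 <;> tauto
  have hd := A.desc c (Finset.mem_insert_of_mem hcu.2) hcu.1
  by_cases hcp : T.par c = u
  · by_cases hcB : c ∈ B
    · exact .inl ⟨A.par_of_mem c hcB, hcB, hcu.2, hcp, hd⟩
    · exact .inr (.inr (.inl ⟨A.par_of_notMem c hcu.2 hcp hcB, hcu.2, hcp, hcB, hd⟩))
  · exact .inr (.inr (.inr ⟨c, hcu.2, A.par c hcu.2 hcu.1 hcp, (key c hcu.2 hcp).1,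
      (key c hcu.2 hcp).2, hcp, .inl ⟨rfl, hcu.1⟩, hd⟩))

theorem desc_root (A : T.Split T' r u y top bot B) (h : T.IsTree r) : T'.desc r = T.desc r := by
  by_cases hur : u = r
  · rcases A.ids with ⟨h1, -⟩ | ⟨h1, -⟩
    · rw [← hur]
      exact h1 ▸ A.desc_top
    · exact absurd (hur ▸ h1) h.root_notMem
  · exact A.desc r (Finset.mem_insert_self _ _) (Ne.symm hur)

theorem top_mem (A : T.Split T' r u y top bot B) : top ∈ insert r T'.nodes ∧ r ≤ top := by
  have := A.mem
  have h1 := A.root_le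
  have h2 := A.root_lt
  rw [Finset.mem_insert] at this ⊢
  rw [A.nodes]
  rcases A.ids with ⟨rfl, rfl⟩ | ⟨_, rfl, rfl⟩
  · tauto
  · exact ⟨.inr (.inl rfl), h2.le⟩

theorem bot_mem (A : T.Split T' r u y top bot B) : bot ∈ T'.nodes ∧ r ≤ bot := by
  have h1 := A.root_le
  have h2 := A.root_lt
  rw [A.nodes]
  rcases A.ids with ⟨rfl, rfl⟩ | ⟨_, rfl, rfl⟩
  · exact ⟨.inl rfl, h2.le⟩
  · tauto

theorem mem_of_mem (A : T.Split T' r u y top bot B) (hc : c ∈ insert r T.nodes) :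
    c ∈ insert r T'.nodes := by
  rw [Finset.mem_insert, A.nodes]
  rw [Finset.mem_insert] at hc
  tauto

theorem isTree (A : T.Split T' r u y top bot B) (h : T.IsTree r) : T'.IsTree r := by
  have hins : ∀ c ∈ T.nodes, c ∈ insert r T.nodes := fun c hc => Finset.mem_insert_of_mem hc
  have hbotu : T'.desc bot ⊂ T.desc u := by
    rw [Finset.ssubset_iff_of_subset]
    · obtain ⟨c, hc, hcu, hcB⟩ := A.rest
      obtain ⟨v, hv⟩ := h.desc_nonempty c (hins c hc)
      refine ⟨v, hcu ▸ (h.desc_ssubset c hc).subset hv, fun h1 => ?_⟩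
      obtain ⟨d, hd, hvd⟩ := (A.desc_bot v).1 h1
      obtain ⟨hdN, hdu⟩ := A.subset d hd
      exact h.disj c hc d hdN (fun h2 => hcB (h2 ▸ hd)) (hcu.trans hdu.symm) v hv hvd
    · intro v hv
      obtain ⟨d, hd, hvd⟩ := (A.desc_bot v).1 hv
      obtain ⟨hdN, hdu⟩ := A.subset d hd
      exact hdu ▸ (h.desc_ssubset d hdN).subset hvd
  have hpar : ∀ d ∈ T.nodes, T.par d ≠ u → T'.desc (T.par d) = T.desc (T.par d) :=
    fun d hd hdu => A.desc _ (h.par_mem d hd) hdu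
  refine ⟨?_, ?_, ?_, ?_, ?_, ?_, ?_, ?_, ?_, ?_⟩
  · rw [A.nodes]
    exact fun h1 => h1.elim A.root_lt.ne h.root_notMem
  · intro v hv
    rw [A.nodes, A.desc_root h, ← h.leaf_iff v hv]
    have := A.root_lt
    exact ⟨fun h1 => h1.resolve_left (by omega), .inr⟩
  · intro v hv hvr
    have h1 := A.root_lt
    have h2 := A.root_le
    have h3 := ((A.nodes v).1 hv).resolve_left (by omega)
    rw [A.desc v (hins v h3) (by omega), h.desc_leaf v h3 hvr]
  · rw [A.desc_root h]
    exact h.lt_root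
  · intro c hc
    rcases A.cases h hc with h1 | h1 | h1 | ⟨d, hd, h1, _⟩
    · exact h1.1 ▸ Finset.mem_insert_of_mem A.bot_mem.1
    · exact h1.1 ▸ A.top_mem.1
    · exact h1.1 ▸ A.top_mem.1
    · exact h1 ▸ A.mem_of_mem (h.par_mem d hd)
  · intro c hc
    rcases A.cases h hc with h1 | h1 | h1 | ⟨d, hd, h1, _⟩
    · exact h1.1 ▸ A.bot_mem.2
    · exact h1.1 ▸ A.top_mem.2
    · exact h1.1 ▸ A.top_mem.2
    · exact h1 ▸ h.le_par d hd
  · intro c hc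
    rcases A.cases h hc with h1 | h1 | h1 | ⟨d, hd, h1, _, _, h2, _, h3⟩
    · rw [h1.1, h1.2.2.2.2, Finset.ssubset_iff_of_subset]
      · obtain ⟨d, hd, hdc⟩ := A.two c h1.2.1
        obtain ⟨hdN, hdu⟩ := A.subset d hd
        obtain ⟨v, hv⟩ := h.desc_nonempty d (hins d hdN)
        exact ⟨v, (A.desc_bot v).2 ⟨d, hd, hv⟩,
          h.disj d hdN c h1.2.2.1 hdc (hdu.trans h1.2.2.2.1.symm) v hv⟩
      · exact fun v hv => (A.desc_bot v).2 ⟨c, h1.2.1, hv⟩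
    · rwa [h1.1, h1.2, A.desc_top]
    · rw [h1.1, h1.2.2.2.2, A.desc_top, ← h1.2.2.1]
      exact h.desc_ssubset c h1.2.1
    · rw [h1, h3, hpar d hd h2]
      exact h.desc_ssubset d hd
  · intro c hc
    rcases Finset.mem_insert.1 hc with rfl | hc
    · rw [A.desc_root h]
      exact h.desc_nonempty _ (Finset.mem_insert_self _ _)
    · rcases A.cases h hc with h1 | h1 | h1 | ⟨d, hd, h1, _, _, h2, _, h3⟩
      · rw [h1.2.2.2.2]
        exact h.desc_nonempty c (hins c h1.2.2.1)
      · obtain ⟨d, hd⟩ := A.nonempty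
        obtain ⟨v, hv⟩ := h.desc_nonempty d (hins d (A.subset d hd).1)
        exact ⟨v, h1.2 ▸ (A.desc_bot v).2 ⟨d, hd, hv⟩⟩
      · rw [h1.2.2.2.2]
        exact h.desc_nonempty c (hins c h1.2.1)
      · rw [h3]
        exact h.desc_nonempty d (hins d hd)
  · have hnb := A.top_ne_bot
    have hside : ∀ c ∈ T.nodes, T.par c = u → c ∉ B → ∀ v ∈ T'.desc bot, v ∉ T.desc c := by
      intro c hc hcu hcB v hv hvc
      obtain ⟨d, hd, hvd⟩ := (A.desc_bot v).1 hv
      obtain ⟨hdN, hdu⟩ := A.subset d hd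
      exact h.disj c hc d hdN (fun h2 => hcB (h2 ▸ hd)) (hcu.trans hdu.symm) v hvc hvd
    intro c hc d hd hcd hpcd v hvc hvd
    rcases A.cases h hc with ⟨h1, h2, h3, h4, h5⟩ | ⟨h1, h2⟩ | ⟨h1, h2, h3, h4, h5⟩ |
      ⟨c', hc', h1, h2, h3, h4, h5, h6⟩ <;>
    rcases A.cases h hd with ⟨k1, k2, k3, k4, k5⟩ | ⟨k1, k2⟩ | ⟨k1, k2, k3, k4, k5⟩ |
      ⟨d', hd', k1, k2, k3, k4, k5, k6⟩ <;> rw [h1, k1] at hpcd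
    · exact h.disj c h3 d k3 hcd (h4.trans k4.symm) v (h5 ▸ hvc) (k5 ▸ hvd)
    · exact hnb hpcd.symm
    · exact hnb hpcd.symm
    · exact k3 hpcd.symm
    · exact hnb hpcd
    · exact hcd (h2.trans k2.symm)
    · exact hside d k2 k3 k4 v (h2 ▸ hvc) (k5 ▸ hvd)
    · exact k2 hpcd.symm
    · exact hnb hpcd
    · exact hside c h2 h3 h4 v (k2 ▸ hvd) (h5 ▸ hvc)
    · exact h.disj c h2 d k2 hcd (h3.trans k3.symm) v (h5 ▸ hvc) (k5 ▸ hvd)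
    · exact k2 hpcd.symm
    · exact h3 hpcd
    · exact h2 hpcd
    · exact h2 hpcd
    · refine h.disj c' hc' d' hd' (fun h7 => hcd ?_) hpcd v (h6 ▸ hvc) (k6 ▸ hvd)
      rcases h5 with ⟨rfl, h5⟩ | ⟨rfl, h5⟩ <;> rcases k5 with ⟨rfl, k5⟩ | ⟨rfl, k5⟩ <;> omega
  · intro p hp hrp v hv
    by_cases hpb : p = bot
    · obtain ⟨c, hc, hvc⟩ := (A.desc_bot v).1 (hpb ▸ hv)
      have hcN := (A.subset c hc).1
      refine ⟨c, (A.nodes c).2 (.inr hcN), hpb ▸ A.par_of_mem c hc, ?_⟩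
      rwa [A.desc c (hins c hcN)]
      rintro rfl
      exact h.par_ne_self hcN (A.subset _ hc).2
    by_cases hpt : p = top
    · rw [hpt, A.desc_top] at hv
      obtain ⟨c, hc, hcu, hvc⟩ := h.cover u A.mem A.root_le v hv
      by_cases hcB : c ∈ B
      · exact ⟨bot, A.bot_mem.1, hpt ▸ A.par_bot, (A.desc_bot v).2 ⟨c, hcB, hvc⟩⟩
      · refine ⟨c, (A.nodes c).2 (.inr hc), hpt ▸ A.par_of_notMem c hc hcu hcB, ?_⟩
        rwa [A.desc c (hins c hc)]
        rintro rfl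
        exact h.par_ne_self hc hcu
    have hpu : p ≠ u ∧ p ∈ insert r T.nodes := by
      rw [Finset.mem_insert, A.nodes] at hp
      rw [Finset.mem_insert]
      rcases A.ids with ⟨rfl, rfl⟩ | ⟨_, rfl, rfl⟩ <;> tauto
    rw [A.desc p hpu.2 hpu.1] at hv
    obtain ⟨c, hc, hcp, hvc⟩ := h.cover p hpu.2 hrp v hv
    by_cases hcu : c = u
    · subst hcu
      refine ⟨top, ?_, (A.par_top hc).trans hcp, A.desc_top ▸ hvc⟩
      have := A.top_mem.1
      rw [Finset.mem_insert] at this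
      exact this.resolve_left (A.ne_root h hc)
    · exact ⟨c, (A.nodes c).2 (.inr hc), (A.par c hc hcu (hcp ▸ hpu.1)).trans hcp,
        (A.desc c (hins c hc) hcu).symm ▸ hvc⟩

/-- Splitting a node into two nodes of the same type preserves the represented graph. -/
theorem represents (A : T.Split T' r u y top bot B) (h : T.Represents r E)
    (hty : ∀ c ∈ insert r T.nodes, T'.ty c = T.ty c) (hy : T'.ty y = T.ty u) :
    T'.Represents r E := by
  refine ⟨A.isTree h.toIsTree, fun c hc d hd hcd hpcd v hvc w hwd => ?_⟩
  have htop : T'.ty top = T.ty u := by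
    rcases A.ids with ⟨rfl, rfl⟩ | ⟨_, rfl, rfl⟩
    exacts [hty _ A.mem, hy]
  have hbot : T'.ty bot = T.ty u := by
    rcases A.ids with ⟨rfl, rfl⟩ | ⟨_, rfl, rfl⟩
    exacts [hy, hty _ A.mem]
  have hnb := A.top_ne_bot
  rcases A.cases h.toIsTree hc with ⟨h1, h2, h3, h4, h5⟩ | ⟨h1, h2⟩ | ⟨h1, h2, h3, h4, h5⟩ |
      ⟨c', hc', h1, h2, h3, h4, h5, h6⟩ <;>
    rcases A.cases h.toIsTree hd with ⟨k1, k2, k3, k4, k5⟩ | ⟨k1, k2⟩ | ⟨k1, k2, k3, k4, k5⟩ |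
      ⟨d', hd', k1, k2, k3, k4, k5, k6⟩ <;> rw [h1, k1] at hpcd <;> rw [h1]
  · rw [hbot, ← h4]
    exact h.adj c h3 d k3 hcd (h4.trans k4.symm) v (h5 ▸ hvc) w (k5 ▸ hwd)
  · exact absurd hpcd.symm hnb
  · exact absurd hpcd.symm hnb
  · exact absurd hpcd.symm k3
  · exact absurd hpcd hnb
  · exact absurd (h2.trans k2.symm) hcd
  · obtain ⟨e, he, hve⟩ := (A.desc_bot v).1 (h2 ▸ hvc)
    obtain ⟨heN, heu⟩ := A.subset e he
    rw [htop, ← heu]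
    exact h.adj e heN d k2 (fun h7 => k4 (h7 ▸ he)) (heu.trans k3.symm) v hve w (k5 ▸ hwd)
  · exact absurd hpcd.symm k2
  · exact absurd hpcd hnb
  · obtain ⟨e, he, hwe⟩ := (A.desc_bot w).1 (k2 ▸ hwd)
    obtain ⟨heN, heu⟩ := A.subset e he
    rw [htop, ← h3]
    exact h.adj c h2 e heN (fun h7 => h4 (h7 ▸ he)) (h3.trans heu.symm) v (h5 ▸ hvc) w hwe
  · rw [htop, ← h3]
    exact h.adj c h2 d k2 hcd (h3.trans k3.symm) v (h5 ▸ hvc) w (k5 ▸ hwd)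
  · exact absurd hpcd.symm k2
  · exact absurd hpcd h3
  · exact absurd hpcd h2
  · exact absurd hpcd h2
  · rw [hty _ (h.par_mem c' hc')]
    refine h.adj c' hc' d' hd' (fun h7 => hcd ?_) hpcd v (h6 ▸ hvc) w (k6 ▸ hwd)
    rcases h5 with ⟨rfl, h5⟩ | ⟨rfl, h5⟩ <;> rcases k5 with ⟨rfl, k5⟩ | ⟨rfl, k5⟩ <;> omega

end Split

/-- `T'` arises from `T` by replacing the node `q` by a new internal node `a` whose children are `q`
and a new leaf `x`. -/
structure Pair (T T' : Cotree) (r x q a : ℕ) : Prop where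
  lt_root : x < r
  leaf_notMem : x ∉ T.nodes
  mem : q ∈ T.nodes
  notMem : a ∉ T.nodes
  root_lt : r < a
  nodes : ∀ c, c ∈ T'.nodes ↔ c = a ∨ c = x ∨ c ∈ T.nodes
  par_leaf : T'.par x = a
  par_old : T'.par q = a
  par_new : T'.par a = T.par q
  par : ∀ c ∈ T.nodes, c ≠ q → T'.par c = T.par c
  desc_leaf : T'.desc x = {x}
  desc_new : T'.desc a = insert x (T.desc q)
  desc : ∀ c ∈ insert r T.nodes, ∀ v, v ∈ T'.desc c ↔ v ∈ T.desc c ∨ v = x ∧ T.Le (T.par q) c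

namespace Pair

variable (A : T.Pair T' r x q a)
include A

/-- Pairing amounts to attaching `x` to the parent of `q` and then splitting that parent. -/
theorem exists_attach_split (h : T.IsTree r) :
    ∃ T₁ : Cotree, T.Attach T₁ r x (T.par q) ∧
      T₁.Split T' r (T.par q) a (T.par q) a {q, x} := by
  classical
  have hqx : q ≠ x := fun h1 => A.leaf_notMem (h1 ▸ A.mem)
  have hins : ∀ c ∈ T.nodes, c ∈ insert r T.nodes := fun c hc => Finset.mem_insert_of_mem hc
  have hNx : ∀ c ∈ insert r T.nodes, c ≠ x := by
    rintro c hc rfl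
    exact (Finset.mem_insert.1 hc).elim A.lt_root.ne A.leaf_notMem
  have hpx : T.par q ≠ x := hNx _ (h.par_mem q A.mem)
  have hqq : ¬ T.Le (T.par q) q := h.not_par_le A.mem
  let T₁ : Cotree :=
    { nodes := insert x T.nodes
      par := Function.update T.par x (T.par q)
      ty := T.ty
      desc := fun c => if c = x then {x} else
        {v ∈ insert x (T.desc c) | v ∈ T.desc c ∨ v = x ∧ T.Le (T.par q) c} }
  have hA : T.Attach T₁ r x (T.par q) :=
    { lt_root := A.lt_root
      notMem := A.leaf_notMem
      mem := h.par_mem q A.mem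
      root_le := h.le_par q A.mem
      nodes := by simp [T₁]
      par_leaf := by simp [T₁]
      par := fun c hc => by simp [T₁, hNx c (hins c hc)]
      desc_leaf := by simp [T₁]
      desc := fun c hc v => by
        simp only [T₁, if_neg (hNx c hc), Finset.mem_filter, Finset.mem_insert]
        tauto }
  have hd : ∀ c ∈ insert r T.nodes, T'.desc c = T₁.desc c := by
    intro c hc
    ext v
    rw [hA.desc c hc, A.desc c hc]
  have hax : a ≠ x := by
    have := A.root_lt
    have := A.lt_root
    omega
  refine ⟨T₁, hA, ?_⟩
  exact
    { ids := .inl ⟨rfl, rfl⟩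
      mem := by
        have := h.par_mem q A.mem
        rw [Finset.mem_insert] at this
        rw [Finset.mem_insert, hA.nodes]
        tauto
      root_le := h.le_par q A.mem
      notMem := by
        rw [hA.nodes]
        exact fun h1 => h1.elim hax A.notMem
      root_lt := A.root_lt
      nodes := fun c => by rw [A.nodes, hA.nodes]
      par_top := fun hu => by
        have hu' := ((hA.nodes _).1 hu).resolve_left hpx
        rw [hA.par _ hu', A.par _ hu' (h.par_ne_self A.mem)]
      par_bot := A.par_new
      par_of_mem := by
        simp only [Finset.mem_insert, Finset.mem_singleton]
        rintro c (rfl | rfl)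
        exacts [A.par_old, A.par_leaf]
      par_of_notMem := by
        intro c hc hcp hcB
        simp only [Finset.mem_insert, Finset.mem_singleton, not_or] at hcB
        have hc' := ((hA.nodes c).1 hc).resolve_left hcB.2
        rw [A.par c hc' hcB.1, ← hcp, hA.par c hc']
      par := by
        intro c hc hcu hcp
        have hcx : c ≠ x := by
          rintro rfl
          exact hcp hA.par_leaf
        have hc' := ((hA.nodes c).1 hc).resolve_left hcx
        rw [hA.par c hc'] at hcp ⊢
        refine A.par c hc' ?_
        rintro rfl
        exact hcp rfl
      desc_top := hd _ (h.par_mem q A.mem)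
      desc_bot := by
        intro v
        simp only [Finset.mem_insert, Finset.mem_singleton, exists_eq_or_imp, exists_eq_left]
        rw [A.desc_new, hA.desc q (hins q A.mem), hA.desc_leaf, Finset.mem_insert,
          Finset.mem_singleton]
        tauto
      desc := by
        intro c hc hcu
        by_cases hcx : c = x
        · rw [hcx, A.desc_leaf, hA.desc_leaf]
        · refine hd c ?_
          rw [Finset.mem_insert, hA.nodes] at hc
          rw [Finset.mem_insert]
          tauto
      subset := by
        simp only [Finset.mem_insert, Finset.mem_singleton]
        rintro c (rfl | rfl)
        · exact ⟨(hA.nodes _).2 (.inr A.mem), hA.par _ A.mem⟩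
        · exact ⟨(hA.nodes _).2 (.inl rfl), hA.par_leaf⟩
      two := by
        simp only [Finset.mem_insert, Finset.mem_singleton]
        rintro c (rfl | rfl)
        · exact ⟨x, .inr rfl, hqx.symm⟩
        · exact ⟨q, .inl rfl, hqx⟩
      nonempty := ⟨q, by simp⟩
      rest := by
        obtain ⟨d, hd, hdq, hdp⟩ := h.exists_sibling A.mem
        refine ⟨d, (hA.nodes d).2 (.inr hd), (hA.par d hd).trans hdp, ?_⟩
        simp [hdq, hNx d (hins d hd)] }

theorem isTree (h : T.IsTree r) : T'.IsTree r := by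
  obtain ⟨T₁, h1, h2⟩ := A.exists_attach_split h
  exact h2.isTree (h1.isTree h)

theorem desc_root (h : T.IsTree r) : T'.desc r = insert x (T.desc r) := by
  obtain ⟨T₁, h1, h2⟩ := A.exists_attach_split h
  rw [h2.desc_root (h1.isTree h), h1.desc_root h]

theorem represents (h : T.Represents r E)
    (hsymm : ∀ u v, E u v → E v u) (hty : ∀ c ∈ insert r T.nodes, T'.ty c = T.ty c)
    (hq : ∀ v ∈ T.desc q, (E x v ↔ T'.ty a = 1))
    (hfit : ∀ c ∈ T.nodes, c ≠ q → T.Le (T.par q) (T.par c) → ¬ T.Le (T.par q) c →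
      ∀ v ∈ T.desc c, (E x v ↔ T.ty (T.par c) = 1)) : T'.Represents r E := by
  refine ⟨A.isTree h.toIsTree, fun c hc d hd hcd hpcd w hwc z hzd => ?_⟩
  have hins : ∀ c ∈ T.nodes, c ∈ insert r T.nodes := fun c hc => Finset.mem_insert_of_mem hc
  have hup : ∀ c ∈ T.nodes, T.Le (T.par q) c → T.Le (T.par q) (T.par c) := fun c hc h1 =>
    h1.trans (le_par_of_mem hc)
  have hpa : ∀ c ∈ T.nodes, T.par c ≠ a := fun c hc h1 => by
    have := h.par_mem c hc
    rw [h1, Finset.mem_insert] at this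
    exact this.elim A.root_lt.ne' A.notMem
  have hmem := A.desc
  -- every node is `x` or `q` (the children of `a`), or it keeps its parent, where `a` replaces `q`
  have hcases : ∀ c ∈ T'.nodes,
      (T'.par c = a ∧ (c = x ∨ c = q)) ∨ T'.par c = T.par q ∧ c = a ∨
        c ∈ T.nodes ∧ c ≠ q ∧ T'.par c = T.par c := by
    intro c hc
    rcases (A.nodes c).1 hc with rfl | rfl | hc'
    · exact .inr (.inl ⟨A.par_new, rfl⟩)
    · exact .inl ⟨A.par_leaf, .inl rfl⟩
    · by_cases hcq : c = q
      · exact .inl ⟨hcq ▸ A.par_old, .inr hcq⟩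
      · exact .inr (.inr ⟨hc', hcq, A.par c hc' hcq⟩)
  have hqd : ∀ v ∈ T'.desc q, v ∈ T.desc q := fun v hv =>
    ((hmem q (hins q A.mem) v).1 hv).resolve_right fun h1 => h.not_par_le A.mem h1.2
  have hx : ∀ v ∈ T'.desc x, v = x := fun v hv => by
    rwa [A.desc_leaf, Finset.mem_singleton] at hv
  -- the leaves below `a` against those below another child of the parent of `q`
  have hside : ∀ d ∈ T.nodes, d ≠ q → T.par q = T.par d → ∀ w ∈ T'.desc a, ∀ z ∈ T'.desc d,
      (E w z ↔ T.ty (T.par d) = 1) := by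
    intro d hd hdq hpd w hw z hz
    have h1 : ¬ T.Le (T.par q) d := hpd ▸ h.not_par_le hd
    have hz' := ((hmem d (hins d hd) z).1 hz).resolve_right fun h2 => h1 h2.2
    rw [A.desc_new, Finset.mem_insert] at hw
    rcases hw with rfl | hw
    · exact hfit d hd hdq (by rw [hpd]; exact Le.refl) h1 z hz'
    · rw [← hpd]
      exact h.adj q A.mem d hd hdq.symm hpd w hw z hz'
  have hcomm : ∀ u v, E u v ↔ E v u := fun u v => ⟨hsymm _ _, hsymm _ _⟩
  rcases hcases c hc with ⟨h1, h2⟩ | ⟨h1, h2⟩ | ⟨h1, h2, h3⟩ <;>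
    rcases hcases d hd with ⟨k1, k2⟩ | ⟨k1, k2⟩ | ⟨k1, k2, k3⟩
  · rw [h1]
    rcases h2 with rfl | rfl <;> rcases k2 with rfl | rfl
    · exact absurd rfl hcd
    · rw [hx w hwc]
      exact hq z (hqd z hzd)
    · rw [hx z hzd, hcomm]
      exact hq w (hqd w hwc)
    · exact absurd rfl hcd
  · exact absurd (k1.symm.trans (hpcd.symm.trans h1)) (hpa q A.mem)
  · exact absurd (k3.symm.trans (hpcd.symm.trans h1)) (hpa d k1)
  · exact absurd (h1.symm.trans (hpcd.trans k1)) (hpa q A.mem)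
  · exact absurd (h2.trans k2.symm) hcd
  · rw [hpcd, k3, hty _ (h.par_mem d k1)]
    exact hside d k1 k2 (h1.symm.trans (hpcd.trans k3)) w (h2 ▸ hwc) z hzd
  · exact absurd (h3.symm.trans (hpcd.trans k1)) (hpa c h1)
  · rw [h3, hty _ (h.par_mem c h1), hcomm]
    exact hside c h1 h2 (k1.symm.trans (hpcd.symm.trans h3)) z (k2 ▸ hzd) w hwc
  · rw [h3, k3] at hpcd
    rw [h3, hty _ (h.par_mem c h1)]
    have hne : ¬ (T.Le (T.par q) c ∧ T.Le (T.par q) d) := fun h5 =>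
      hcd (h.eq_of_le_of_par_eq (h.par_mem q A.mem) h1 k1 h5.1 h5.2 hpcd)
    rcases (hmem c (hins c h1) _).1 hwc with h5 | h5 <;>
      rcases (hmem d (hins d k1) _).1 hzd with h6 | h6
    · exact h.adj c h1 d k1 hcd hpcd w h5 z h6
    · rw [h6.1, ← hfit c h1 h2 (hpcd ▸ hup d k1 h6.2) (fun h3 => hne ⟨h3, h6.2⟩) w h5]
      exact hcomm _ _
    · rw [h5.1, hpcd]
      exact hfit d k1 k2 (hpcd ▸ hup c h1 h5.2) (fun h3 => hne ⟨h5.2, h3⟩) z h6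
    · exact absurd ⟨h5.2, h6.2⟩ hne

end Pair

end Cotree

/-! ### Inserting a vertex into a cotree -/

namespace Cotree

variable {T T₁ T' : Cotree} {r : ℕ} {E : ℕ → ℕ → Prop} {P : ℕ → Prop}
  {a b c p q u v x y t top bot : ℕ} {B : Finset ℕ}

theorem Alternates.ty_le_one (hT : T.Alternates r) (h : T.IsTree r) (ha : a ∈ insert r T.nodes)
    (hra : r ≤ a) : T.ty a ≤ 1 := by
  rcases Finset.mem_insert.1 ha with rfl | ha'
  · rw [hT.ty_root]
    omega
  · exact hT.ty_le a ha' (lt_of_le_of_ne hra (h.ne_root ha').symm)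

theorem IsTree.not_full_and_void (h : T.IsTree r) (hc : c ∈ T.nodes) (hf : T.Full P c)
    (hv : T.Void P c) : False := by
  obtain ⟨v, hvc⟩ := h.desc_nonempty c (Finset.mem_insert_of_mem hc)
  exact hv v hvc (hf v hvc)

namespace IsLowestMixed

theorem root_le (hu : T.IsLowestMixed r P u) (h : T.IsTree r) : r ≤ u := by
  rcases Finset.mem_insert.1 hu.mem with rfl | h1
  exacts [le_rfl, (h.root_lt_of_mixed h1 hu.mixed).le]

/-- The children of the lowest mixed node are not mixed. -/
theorem full_or_void (hu : T.IsLowestMixed r P u) (h : T.IsTree r) (hc : c ∈ T.nodes)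
    (hcu : T.par c = u) : T.Full P c ∨ T.Void P c := by
  by_contra h1
  rw [not_or] at h1
  have h2 := hu.le c (Finset.mem_insert_of_mem hc) h1
  exact h.not_par_le hc (hcu ▸ h2)

theorem exists_full (hu : T.IsLowestMixed r P u) (h : T.IsTree r) :
    ∃ c ∈ T.nodes, T.par c = u ∧ T.Full P c := by
  have h1 := hu.mixed.2
  simp only [Void, not_forall, not_not] at h1
  obtain ⟨v, hv, hPv⟩ := h1
  obtain ⟨c, hc, hcu, hvc⟩ := h.cover u hu.mem (hu.root_le h) v hv
  exact ⟨c, hc, hcu, (hu.full_or_void h hc hcu).resolve_right fun h2 => h2 v hvc hPv⟩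

theorem exists_void (hu : T.IsLowestMixed r P u) (h : T.IsTree r) :
    ∃ c ∈ T.nodes, T.par c = u ∧ T.Void P c := by
  have h1 := hu.mixed.1
  simp only [Full, not_forall] at h1
  obtain ⟨v, hv, hPv⟩ := h1
  obtain ⟨c, hc, hcu, hvc⟩ := h.cover u hu.mem (hu.root_le h) v hv
  exact ⟨c, hc, hcu, (hu.full_or_void h hc hcu).resolve_left fun h2 => hPv (h2 v hvc)⟩

/-- The vertex `x` is joined to a leaf that hangs off the path from `u` to the root, above `u`, if
and only if it hangs off at a join node. -/
theorem fits (hu : T.IsLowestMixed r (E x) u) (h : T.Represents r E) (hT : T.Alternates r)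
    (hE : PathFree E) (hsymm : ∀ u v, E u v → E v u) :
    ∀ c ∈ T.nodes, T.Le u (T.par c) → T.par c ≠ u → ¬ T.Le u c →
      ∀ v ∈ T.desc c, (E x v ↔ T.ty (T.par c) = 1) := by
  intro c hc hup hpu huc v hv
  rcases hup.cases_top with h1 | ⟨d, hd, hud, hdc⟩
  · exact absurd h1.symm hpu
  · have hdne : d ≠ c := fun h2 => huc (h2 ▸ hud)
    have := h.sibling_of_mixed hT hE hsymm hd hc hdne hdc (h.mixed_of_le hud hu.mixed)
    rw [hdc] at this
    by_cases hty : T.ty (T.par c) = 1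
    · exact iff_of_true (this.1 hty v hv) hty
    · exact iff_of_false (this.2 hty v hv) hty

end IsLowestMixed

/-- `p` is an internal node that is not full but has a full child. -/
def Marked (T : Cotree) (r : ℕ) (P : ℕ → Prop) (p : ℕ) : Prop :=
  p ∈ insert r T.nodes ∧ ¬ T.Full P p ∧ ∃ c ∈ T.nodes, T.par c = p ∧ T.Full P c

theorem Marked.mixed (hp : T.Marked r P p) (h : T.IsTree r) : T.Mixed P p := by
  obtain ⟨_, h1, c, hc, rfl, hf⟩ := hp
  refine ⟨h1, fun h2 => h.not_full_and_void hc hf fun v hv => h2 v ?_⟩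
  exact (h.desc_ssubset c hc).subset hv

theorem IsLowestMixed.marked (hu : T.IsLowestMixed r P u) (h : T.IsTree r) : T.Marked r P u :=
  ⟨hu.mem, hu.mixed.1, hu.exists_full h⟩

/-- Among the marked nodes, all but the lowest mixed node are parents or grandparents of marked
nodes. -/
theorem Marked.eq_or_exists (hp : T.Marked r (E x) p) (hu : T.IsLowestMixed r (E x) u)
    (h : T.Represents r E) (hT : T.Alternates r) (hE : PathFree E)
    (hsymm : ∀ u v, E u v → E v u) :
    p = u ∨ ∃ p' ∈ T.nodes, T.Marked r (E x) p' ∧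
      (T.par p' = p ∨ T.par p' ∈ T.nodes ∧ T.par (T.par p') = p) := by
  have hum := hu.marked h.toIsTree
  rcases (hu.le p hp.1 (hp.mixed h.toIsTree)).cases_top with h1 | ⟨c, hc, huc, hcp⟩
  · exact .inl h1.symm
  have hcm := h.mixed_of_le huc hu.mixed
  -- `p` has a full child besides its mixed child `c`, so it is a join node
  have htp : T.ty p = 1 := by
    obtain ⟨d, hd, hdp, hdf⟩ := hp.2.2
    have hcd : c ≠ d := fun h1 => hcm.1 (h1 ▸ hdf)
    by_contra htp
    have := h.sibling_of_mixed hT hE hsymm hc hd hcd (hcp.trans hdp.symm) hcm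
    exact h.not_full_and_void hd hdf (this.2 (hcp ▸ htp))
  have hrc := h.root_lt_of_mixed hc hcm
  have htc := hT.ty_ne c hc hrc
  rw [hcp, htp] at htc
  rcases huc.cases_top with h1 | ⟨d, hd, hud, hdc⟩
  · exact .inr ⟨u, h1 ▸ hc, hum, .inl (h1 ▸ hcp)⟩
  refine .inr ⟨d, hd, ?_, .inr ⟨hdc ▸ hc, by rw [hdc, hcp]⟩⟩
  rcases hud.cases_top with h1 | ⟨e, he, hue, hed⟩
  · exact h1 ▸ hum
  · have hdm := h.mixed_of_le hud hu.mixed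
    have hrd := h.root_lt_of_mixed hd hdm
    have htd := hT.ty_ne d hd hrd
    have htd' := hT.ty_le d hd hrd
    have htc' := hT.ty_le c hc hrc
    rw [hdc] at htd
    obtain ⟨f, hf, hfe, hfd⟩ := h.exists_sibling he
    have := h.sibling_of_mixed hT hE hsymm he hf hfe.symm hfd.symm (h.mixed_of_le hue hu.mixed)
    rw [hed] at this
    exact ⟨Finset.mem_insert_of_mem hd, hdm.1, f, hf, hfd.trans hed, this.1 (by omega)⟩

theorem Marked.par_ne (hp : T.Marked r P p) (hu : T.IsLowestMixed r P u) (h : T.IsTree r)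
    (hpN : p ∈ T.nodes) : T.par p ≠ u ∧ (T.par p ∈ T.nodes → T.par (T.par p) ≠ u) := by
  have hup := hu.le p hp.1 (hp.mixed h)
  refine ⟨fun h1 => h.not_par_le hpN (h1 ▸ hup), fun h2 h1 => ?_⟩
  exact h.not_par_le h2 ((h1 ▸ hup).trans (le_par_of_mem hpN))

theorem Attach.alternates (A : T.Attach T' r x q) (hT : T.Alternates r) (hty : T'.ty = T.ty) :
    T'.Alternates r := by
  have hx := A.lt_root
  refine ⟨hty ▸ hT.ty_root, fun c hc hrc => ?_, fun c hc hrc => ?_⟩ <;>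
    have hc' := ((A.nodes c).1 hc).resolve_left (by omega)
  · exact hty ▸ hT.ty_le c hc' hrc
  · rw [hty, A.par c hc']
    exact hT.ty_ne c hc' hrc

theorem Pair.alternates (A : T.Pair T' r x q a) (h : T.IsTree r) (hroot : T.ty r = 0)
    (hle : ∀ c ∈ T.nodes, r < c → T.ty c ≤ 1)
    (hne : ∀ c ∈ T.nodes, r < c → c ≠ q → T.ty c ≠ T.ty (T.par c))
    (hty : ∀ c ∈ insert r T.nodes, T'.ty c = T.ty c) (hle' : T'.ty a ≤ 1)
    (hq : r < q → T'.ty a ≠ T.ty q) (hpq : T'.ty a ≠ T.ty (T.par q)) : T'.Alternates r := by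
  have hx := A.lt_root
  have hins : ∀ c ∈ T.nodes, c ∈ insert r T.nodes := fun c hc => Finset.mem_insert_of_mem hc
  refine ⟨(hty r (Finset.mem_insert_self _ _)).trans hroot, fun c hc hrc => ?_, fun c hc hrc => ?_⟩
  · rcases (A.nodes c).1 hc with rfl | rfl | hc'
    · exact hle'
    · omega
    · exact hty c (hins c hc') ▸ hle c hc' hrc
  · rcases (A.nodes c).1 hc with rfl | rfl | hc'
    · rwa [A.par_new, hty _ (h.par_mem q A.mem)]
    · omega
    · by_cases hcq : c = q
      · subst hcq
        rw [A.par_old, hty c (hins c hc')]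
        exact (hq hrc).symm
      · rw [A.par c hc' hcq, hty c (hins c hc'), hty _ (h.par_mem c hc')]
        exact hne c hc' hrc hcq

section

variable (hu : T.IsLowestMixed r (E x) u) (h : T.Represents r E) (hT : T.Alternates r)
  (hE : PathFree E) (hsymm : ∀ u v, E u v → E v u)
include hu h hT hE hsymm

/-- The lowest mixed node `u` has exactly one child `q` of the wrong status, and `q` is an internal
node: `x` becomes a child of `q`. -/
theorem Attach.insertion (A : T.Attach T' r x q) (hty : T'.ty = T.ty)
    (hq : q ∈ T.nodes) (hqu : T.par q = u) (hrq : r < q)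
    (hbad : ∀ v ∈ T.desc q, (E x v ↔ T.ty u ≠ 1))
    (hgood : ∀ c ∈ T.nodes, T.par c = u → c ≠ q → ∀ v ∈ T.desc c, (E x v ↔ T.ty u = 1)) :
    T'.Represents r E ∧ T'.Alternates r := by
  refine ⟨A.represents h hsymm (by simp [hty]) fun c hc hqc hqc' v hv => ?_,
    A.alternates hT hty⟩
  rcases hqc.cases_bot with h1 | ⟨-, h1⟩
  · rw [hbad v (h1 ▸ (h.desc_ssubset c hc).subset hv), ← h1]
    have h2 := hT.ty_le q hq hrq
    have h3 := hT.ty_ne q hq hrq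
    have h4 := hT.ty_le_one h.toIsTree hu.mem (hu.root_le h.toIsTree)
    rw [hqu] at h3
    omega
  · rw [hqu] at h1
    by_cases hcu : T.par c = u
    · rw [hcu]
      exact hgood c hc hcu (fun h2 => hqc' (h2 ▸ Le.refl)) v hv
    · refine hu.fits h hT hE hsymm c hc h1 hcu (fun h2 => hqc' ?_) v hv
      exact (hqu ▸ le_par_of_mem hq : T.Le q u).trans h2

/-- The lowest mixed node `u` has exactly one child `q` of the wrong status, and `q` is a leaf: `q`
is replaced by a new node with the children `q` and `x`. -/
theorem Pair.insertion (A : T.Pair T' r x q a) (hty : ∀ c ∈ insert r T.nodes, T'.ty c = T.ty c)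
    (hty' : T'.ty a = 1 - T.ty u) (hqu : T.par q = u) (hqr : q < r)
    (hbad : ∀ v ∈ T.desc q, (E x v ↔ T.ty u ≠ 1))
    (hgood : ∀ c ∈ T.nodes, T.par c = u → c ≠ q → ∀ v ∈ T.desc c, (E x v ↔ T.ty u = 1)) :
    T'.Represents r E ∧ T'.Alternates r := by
  have htu := hT.ty_le_one h.toIsTree hu.mem (hu.root_le h.toIsTree)
  constructor
  · refine A.represents h hsymm hty (fun v hv => ?_) fun c hc hcq hup huc v hv => ?_
    · rw [hbad v hv, hty']
      omega
    · rw [hqu] at hup huc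
      by_cases hcu : T.par c = u
      · exact hcu ▸ hgood c hc hcu hcq v hv
      · exact hu.fits h hT hE hsymm c hc hup hcu huc v hv
  · exact A.alternates h.toIsTree hT.ty_root hT.ty_le (fun c hc hrc _ => hT.ty_ne c hc hrc) hty
      (by omega) (fun h1 => by omega) (by rw [hqu]; omega)

/-- The lowest mixed node `u` has a set `B` of at least two children of the wrong status: `B` is
split off, and the new lower node is replaced by a node that has it and `x` as children. -/
theorem Split.insertion (S : T.Split T₁ r u y top bot B) (A : T₁.Pair T' r x bot a)
    (hty₁ : ∀ c ∈ insert r T.nodes, T₁.ty c = T.ty c) (hy : T₁.ty y = T.ty u)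
    (hty : ∀ c ∈ insert r T₁.nodes, T'.ty c = T₁.ty c) (hty' : T'.ty a = 1 - T.ty u)
    (hbad : ∀ c ∈ B, ∀ v ∈ T.desc c, (E x v ↔ T.ty u ≠ 1))
    (hgood : ∀ c ∈ T.nodes, T.par c = u → c ∉ B → ∀ v ∈ T.desc c, (E x v ↔ T.ty u = 1)) :
    T'.Represents r E ∧ T'.Alternates r := by
  have h₁ := S.represents h hty₁ hy
  have htu := hT.ty_le_one h.toIsTree hu.mem (hu.root_le h.toIsTree)
  have htop : T₁.ty top = T.ty u := by
    rcases S.ids with ⟨rfl, rfl⟩ | ⟨_, rfl, rfl⟩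
    exacts [hty₁ _ S.mem, hy]
  have hbot : T₁.ty bot = T.ty u := by
    rcases S.ids with ⟨rfl, rfl⟩ | ⟨_, rfl, rfl⟩
    exacts [hy, hty₁ _ S.mem]
  constructor
  · refine A.represents h₁ hsymm hty (fun v hv => ?_) fun c hc hcq hup huc v hv => ?_
    · obtain ⟨c, hc, hvc⟩ := (S.desc_bot v).1 hv
      rw [hbad c hc v hvc, hty']
      omega
    · rw [S.par_bot] at hup huc
      rcases S.cases h.toIsTree hc with ⟨h1, h2, h3, h4, h5⟩ | ⟨h1, h2⟩ | ⟨h1, h2, h3, h4, h5⟩ |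
        ⟨d, hd, h1, h2, h3, h4, h5, h6⟩
      · rw [h1] at hup
        exact absurd (h₁.le_antisymm hup (S.par_bot ▸ le_par_of_mem S.bot_mem.1)) S.top_ne_bot
      · exact absurd h2 hcq
      · rw [h1, htop]
        exact hgood c h2 h3 h4 v (h5 ▸ hv)
      · rw [h1] at hup
        rw [h1, hty₁ _ (h.par_mem d hd)]
        have h7 := h₁.desc_subset_of_le hup
        rw [S.desc_top, S.desc _ (h.par_mem d hd) h4] at h7
        refine hu.fits h hT hE hsymm d hd (h.le_of_subset S.mem (h.par_mem d hd) h7) h4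
          (fun h8 => huc ?_) v (h6 ▸ hv)
        refine h₁.le_of_subset S.top_mem.1 (Finset.mem_insert_of_mem hc) ?_
        rw [S.desc_top, h6]
        exact h.desc_subset_of_le h8
  · have hry := S.root_lt
    refine A.alternates h₁.toIsTree ?_ (fun c hc hrc => ?_) (fun c hc hrc hcq => ?_) hty (by omega)
      (fun h1 => by omega) (by rw [S.par_bot]; omega)
    · rw [hty₁ r (Finset.mem_insert_self _ _), hT.ty_root]
    · rcases (S.nodes c).1 hc with rfl | hc
      · omega
      · rw [hty₁ c (Finset.mem_insert_of_mem hc)]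
        exact hT.ty_le c hc hrc
    · rcases S.cases h.toIsTree hc with ⟨h1, h2, h3, h4, h5⟩ | ⟨h1, h2⟩ | ⟨h1, h2, h3, h4, h5⟩ |
        ⟨d, hd, h1, h2, h3, h4, h5, h6⟩
      · rw [h1, hbot, hty₁ c (Finset.mem_insert_of_mem h3), ← h4]
        exact hT.ty_ne c h3 hrc
      · exact absurd h2 hcq
      · rw [h1, htop, hty₁ c (Finset.mem_insert_of_mem h2), ← h3]
        exact hT.ty_ne c h2 hrc
      · rw [h1, hty₁ _ (h.par_mem d hd)]
        rcases h5 with ⟨rfl, h5⟩ | ⟨rfl, rfl⟩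
        · rw [hty₁ c (Finset.mem_insert_of_mem hd)]
          exact hT.ty_ne c hd hrc
        · rw [htop]
          exact hT.ty_ne d hd (lt_of_le_of_ne S.root_le (h.ne_root hd).symm)

end

/-- A vertex without neighbours becomes a child of the root. -/
theorem Attach.insertion_root (A : T.Attach T' r x r) (hty : T'.ty = T.ty) (h : T.Represents r E)
    (hT : T.Alternates r) (hsymm : ∀ u v, E u v → E v u) (hx : ∀ v ∈ T.desc r, ¬ E x v) :
    T'.Represents r E ∧ T'.Alternates r := by
  refine ⟨A.represents h hsymm (by simp [hty]) fun c hc hrc _ v hv => ?_, A.alternates hT hty⟩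
  rw [h.le_antisymm (h.le_root (h.par_mem c hc)) hrc, hT.ty_root]
  exact iff_of_false (hx v (h.desc_subset_root (Finset.mem_insert_of_mem hc) hv)) (by omega)

end Cotree

/-! ### Sweeping up the full nodes of a cotree -/

namespace Cotree

variable {T : Cotree} {r : ℕ} {P : ℕ → Prop} {L : ℕ} {Q : ℕ → ℕ} {i len p c : ℕ}

/-- The invariant of the sweep that collects the full nodes in a queue `Q`, of which the first `len`
entries are in use and the first `i` entries have been processed. The first `L` entries are the
leaves that satisfy `P`; an internal node enters the queue when its last child is processed. -/
structure Sweep (T : Cotree) (r : ℕ) (P : ℕ → Prop) (L : ℕ) (Q : ℕ → ℕ) (i len : ℕ) : Prop where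
  inj : ∀ j < len, ∀ k < len, Q j = Q k → j = k
  le : i ≤ len
  start_le : L ≤ len
  leaf : ∀ j < L, Q j ∈ T.nodes ∧ Q j < r ∧ P (Q j)
  internal : ∀ j, L ≤ j → j < len → Q j ∈ insert r T.nodes ∧ r ≤ Q j ∧
    ∀ c ∈ T.children (Q j), ∃ k < i, k < j ∧ Q k = c
  exists_leaf : ∀ v ∈ T.nodes, v < r → P v → ∃ j < L, Q j = v
  closed : ∀ p ∈ insert r T.nodes, r ≤ p → (∀ c ∈ T.children p, ∃ k < i, Q k = c) →
    ∃ j < len, Q j = p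

/-- The number of children of `p` among the first `i` entries of `Q`. -/
def count (T : Cotree) (Q : ℕ → ℕ) (i p : ℕ) : ℕ := {k ∈ Finset.range i | T.par (Q k) = p}.card

@[simp] theorem count_zero : T.count Q 0 p = 0 := rfl

theorem count_succ : T.count Q (i + 1) p = T.count Q i p + if T.par (Q i) = p then 1 else 0 := by
  rw [count, Finset.range_add_one, Finset.filter_insert]
  split_ifs with h
  · rw [Finset.card_insert_of_notMem (by simp)]
    rfl
  · rfl

theorem count_congr {Q' : ℕ → ℕ} (h : ∀ k < i, Q' k = Q k) : T.count Q' i p = T.count Q i p := by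
  unfold count
  congr 1
  refine Finset.filter_congr fun k hk => ?_
  rw [h k (Finset.mem_range.1 hk)]

/-- A tree whose root has a parent outside the tree, which serves as a sentinel. -/
theorem IsTree.children_par_root (h : T.IsTree r) (hr : T.par r ∉ insert r T.nodes) :
    T.children (T.par r) = ∅ := by
  refine Finset.eq_empty_of_forall_notMem fun c hc => ?_
  rw [mem_children] at hc
  exact hr (hc.2 ▸ h.par_mem c hc.1)

theorem IsTree.two_le_card_children (h : T.IsTree r) (hp : p ∈ insert r T.nodes) (hrp : r ≤ p) :
    2 ≤ (T.children p).card := by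
  obtain ⟨v, hv⟩ := h.desc_nonempty p hp
  obtain ⟨c, hc, hcp, -⟩ := h.cover p hp hrp v hv
  obtain ⟨d, hd, hdc, hdp⟩ := h.exists_sibling hc
  have : ({c, d} : Finset ℕ) ⊆ T.children p := by
    intro e he
    simp only [Finset.mem_insert, Finset.mem_singleton] at he
    rw [mem_children]
    rcases he with rfl | rfl
    exacts [⟨hc, hcp⟩, ⟨hd, hdp.trans hcp⟩]
  rw [← Finset.card_pair hdc.symm]
  exact Finset.card_le_card this

namespace Sweep

theorem mem (S : T.Sweep r P L Q i len) {j : ℕ} (hj : j < len) : Q j ∈ insert r T.nodes := by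
  by_cases hjL : j < L
  · exact Finset.mem_insert_of_mem (S.leaf j hjL).1
  · exact (S.internal j (by omega) hj).1

/-- The entries counted by `count` form a set of children. -/
theorem image_subset (S : T.Sweep r P L Q i len) (hr : T.par r ∉ insert r T.nodes) {m : ℕ}
    (hm : m ≤ len) (hp : p ∈ insert r T.nodes) :
    {k ∈ Finset.range m | T.par (Q k) = p}.image Q ⊆ T.children p ∧
      ({k ∈ Finset.range m | T.par (Q k) = p}.image Q).card = T.count Q m p := by
  constructor
  · intro c hc
    simp only [Finset.mem_image, Finset.mem_filter, Finset.mem_range] at hc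
    obtain ⟨k, ⟨hk, hkp⟩, rfl⟩ := hc
    refine mem_children.2 ⟨(Finset.mem_insert.1 (S.mem (by omega : k < len))).resolve_left ?_, hkp⟩
    intro h1
    rw [h1] at hkp
    rw [hkp] at hr
    exact hr hp
  · refine Finset.card_image_of_injOn fun j hj k hk hjk => ?_
    simp only [Finset.coe_filter, Finset.mem_range, Set.mem_ofPred_eq] at hj hk
    exact S.inj j (by omega) k (by omega) hjk

theorem count_eq_iff (S : T.Sweep r P L Q i len) (hr : T.par r ∉ insert r T.nodes) {m : ℕ}
    (hm : m ≤ len) (hp : p ∈ insert r T.nodes) :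
    T.count Q m p = (T.children p).card ↔ ∀ c ∈ T.children p, ∃ k < m, Q k = c := by
  obtain ⟨h1, h2⟩ := S.image_subset hr hm hp
  rw [← h2]
  constructor
  · intro h3 c hc
    rw [← Finset.eq_of_subset_of_card_le h1 h3.ge] at hc
    simp only [Finset.mem_image, Finset.mem_filter, Finset.mem_range] at hc
    obtain ⟨k, ⟨hk, -⟩, hkc⟩ := hc
    exact ⟨k, hk, hkc⟩
  · intro h3
    congr 1
    refine h1.antisymm fun c hc => ?_
    obtain ⟨k, hk, rfl⟩ := h3 c hc
    simp only [Finset.mem_image, Finset.mem_filter, Finset.mem_range]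
    exact ⟨k, ⟨hk, (mem_children.1 hc).2⟩, rfl⟩

/-- Every internal node in the queue accounts for at least two processed entries. -/
theorem two_mul_le (S : T.Sweep r P L Q i len) (h : T.IsTree r)
    (hr : T.par r ∉ insert r T.nodes) : 2 * (len - L) ≤ i := by
  have h1 : ∀ j ∈ Finset.Ico L len, 2 ≤ {k ∈ Finset.range i | T.par (Q k) = Q j}.card := by
    intro j hj
    rw [Finset.mem_Ico] at hj
    obtain ⟨h2, h3, h4⟩ := S.internal j hj.1 hj.2
    have h5 := (S.count_eq_iff hr S.le h2).2 fun c hc => by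
      obtain ⟨k, hk, -, hkc⟩ := h4 c hc
      exact ⟨k, hk, hkc⟩
    rw [count] at h5
    exact h5 ▸ h.two_le_card_children h2 h3
  have h2 := Finset.sum_le_sum h1
  rw [Finset.sum_const, Nat.card_Ico, smul_eq_mul, ← Finset.card_biUnion] at h2
  · have h3 := Finset.card_le_card (Finset.biUnion_subset.2 fun j (_ : j ∈ Finset.Ico L len) =>
      Finset.filter_subset (fun k => T.par (Q k) = Q j) (Finset.range i))
    rw [Finset.card_range] at h3
    omega
  · intro j hj k hk hjk
    rw [Finset.mem_coe, Finset.mem_Ico] at hj hk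
    rw [Function.onFun, Finset.disjoint_left]
    intro e he he'
    rw [Finset.mem_filter] at he he'
    exact hjk (S.inj j hj.2 k hk.2 (he.2.symm.trans he'.2))

theorem len_le (S : T.Sweep r P L Q i len) (h : T.IsTree r)
    (hr : T.par r ∉ insert r T.nodes) : len ≤ 2 * L := by
  have := S.two_mul_le h hr
  have := S.le
  omega

theorem skip (S : T.Sweep r P L Q i len) (hr : T.par r ∉ insert r T.nodes) (hi : i < len)
    (hp : T.count Q (i + 1) (T.par (Q i)) ≠ (T.children (T.par (Q i))).card) :
    T.Sweep r P L Q (i + 1) len := by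
  refine ⟨S.inj, hi, S.start_le, S.leaf, fun j hj hj' => ?_, S.exists_leaf, fun p hpm hrp hc => ?_⟩
  · obtain ⟨h1, h2, h3⟩ := S.internal j hj hj'
    refine ⟨h1, h2, fun c hc => ?_⟩
    obtain ⟨k, hk, hk'⟩ := h3 c hc
    exact ⟨k, by omega, hk'⟩
  · refine S.closed p hpm hrp fun c hcp => ?_
    obtain ⟨k, hk, hkc⟩ := hc c hcp
    refine ⟨k, ?_, hkc⟩
    by_contra h1
    obtain rfl : k = i := by omega
    have h2 := (mem_children.1 hcp).2
    rw [← hkc] at h2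
    rw [h2] at hp
    exact hp ((S.count_eq_iff hr hi hpm).2 hc)

theorem push (S : T.Sweep r P L Q i len) (h : T.IsTree r) (hr : T.par r ∉ insert r T.nodes)
    (hi : i < len)
    (hp : T.count Q (i + 1) (T.par (Q i)) = (T.children (T.par (Q i))).card) :
    T.Sweep r P L (Function.update Q len (T.par (Q i))) (i + 1) (len + 1) := by
  set p := T.par (Q i) with hpdef
  have hQi : Q i ≠ r := by
    intro h1
    rw [h1] at hpdef
    rw [hpdef, h.children_par_root hr, count_succ, ← hpdef, h1, ← hpdef] at hp
    simp at hp
  have hQiN : Q i ∈ T.nodes := (Finset.mem_insert.1 (S.mem hi)).resolve_left hQi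
  have hpm : p ∈ insert r T.nodes := h.par_mem _ hQiN
  have hrp : r ≤ p := h.le_par _ hQiN
  have hall := (S.count_eq_iff hr hi hpm).1 hp
  have hold : ∀ k, k < len → Function.update Q len p k = Q k := fun k hk => by
    rw [Function.update_of_ne hk.ne]
  -- `p` is not yet in the queue, as its child `Q i` has not been processed
  have hnew : ∀ k < len, Q k ≠ p := by
    intro k hk hkp
    have hkL : L ≤ k := by
      by_contra h1
      have := (S.leaf k (by omega)).2.1
      omega
    obtain ⟨l, hl, -, hl'⟩ := (S.internal k hkL hk).2.2 (Q i)
      (mem_children.2 ⟨hQiN, by rw [hkp]⟩)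
    have := S.inj l (by omega) i hi hl'
    omega
  refine ⟨fun j hj k hk hjk => ?_, by omega, S.start_le.trans (by omega), fun j hj => ?_,
    fun j hj hj' => ?_, fun v hv hvr hPv => ?_, fun p' hpm' hrp' hc => ?_⟩
  · by_cases h1 : j = len <;> by_cases h2 : k = len
    · omega
    · rw [h1, Function.update_self, hold k (by omega)] at hjk
      exact absurd hjk.symm (hnew k (by omega))
    · rw [h2, Function.update_self, hold j (by omega)] at hjk
      exact absurd hjk (hnew j (by omega))
    · rw [hold j (by omega), hold k (by omega)] at hjk
      exact S.inj j (by omega) k (by omega) hjk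
  · rw [hold j (hj.trans_le S.start_le)]
    exact S.leaf j hj
  · by_cases h1 : j = len
    · rw [h1, Function.update_self]
      refine ⟨hpm, hrp, fun c hc => ?_⟩
      obtain ⟨k, hk, hkc⟩ := hall c hc
      exact ⟨k, hk, by omega, by rw [hold k (by omega), hkc]⟩
    · rw [hold j (by omega)]
      obtain ⟨h2, h3, h4⟩ := S.internal j hj (by omega)
      refine ⟨h2, h3, fun c hc => ?_⟩
      obtain ⟨k, hk, hkj, hkc⟩ := h4 c hc
      exact ⟨k, by omega, hkj, by rw [hold k (by omega), hkc]⟩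
  · obtain ⟨j, hj, hjv⟩ := S.exists_leaf v hv hvr hPv
    exact ⟨j, hj, by rw [hold j (hj.trans_le S.start_le), hjv]⟩
  · by_cases h1 : p' = p
    · exact ⟨len, by omega, by rw [Function.update_self, h1]⟩
    · obtain ⟨j, hj, hjp⟩ := S.closed p' hpm' hrp' fun c hcp => by
        obtain ⟨k, hk, hkc⟩ := hc c hcp
        rw [hold k (by omega)] at hkc
        refine ⟨k, ?_, hkc⟩
        by_contra h2
        obtain rfl : k = i := by omega
        exact h1 ((mem_children.1 hcp).2.symm.trans (by rw [← hkc]))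
      exact ⟨j, by omega, by rw [hold j hj, hjp]⟩

/-- When the whole queue has been processed, it holds exactly the full nodes. -/
theorem mem_iff (S : T.Sweep r P L Q len len) (h : T.IsTree r) :
    (∃ j < len, Q j = c) ↔ c ∈ insert r T.nodes ∧ T.Full P c := by
  constructor
  · rintro ⟨j, hj, rfl⟩
    refine ⟨S.mem hj, ?_⟩
    induction j using Nat.strong_induction_on with
    | _ j ih =>
      intro v hv
      by_cases hjL : j < L
      · obtain ⟨h1, h2, h3⟩ := S.leaf j hjL
        rw [h.desc_leaf _ h1 h2, Finset.mem_singleton] at hv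
        exact hv ▸ h3
      · obtain ⟨h1, h2, h3⟩ := S.internal j (by omega) hj
        obtain ⟨c, hc, hcp, hvc⟩ := h.cover _ h1 h2 v hv
        obtain ⟨k, hk, hkj, hkc⟩ := h3 c (mem_children.2 ⟨hc, hcp⟩)
        exact ih k hkj (by omega) v (hkc ▸ hvc)
  · rintro ⟨hc, hf⟩
    induction hn : (T.desc c).card using Nat.strong_induction_on generalizing c with
    | _ m ih =>
      by_cases hrc : r ≤ c
      · refine S.closed c hc hrc fun d hd => ?_
        obtain ⟨hdN, rfl⟩ := mem_children.1 hd
        have hss := h.desc_ssubset d hdN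
        exact ih _ (hn ▸ Finset.card_lt_card hss) (Finset.mem_insert_of_mem hdN)
          (fun v hv => hf v (hss.subset hv)) rfl
      · have hcN := (Finset.mem_insert.1 hc).resolve_left (by omega)
        have hd := h.desc_leaf c hcN (by omega)
        obtain ⟨j, hj, hjc⟩ := S.exists_leaf c hcN (by omega) (hf c (by simp [hd]))
        exact ⟨j, hj.trans_le S.start_le, hjc⟩

end Sweep

end Cotree

/-! ### The memory layout -/

-- Registers: the number of vertices; the constant one; the modulus for the sums of children; the
-- root; the first unused name of a node; the vertex to be inserted; the length of the queue; the
-- lowest mixed node, the number and the sum of its full children; the node that arises by splitting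
-- it; the node at which the new vertex is placed; the stamp that is used as a flag; the type of the
-- new node; the constant zero. The registers from `20` on are temporary.
local notation "rNum" => (0 : ℕ)
local notation "rOne" => (1 : ℕ)
local notation "rMod" => (2 : ℕ)
local notation "rRoot" => (3 : ℕ)
local notation "rNext" => (4 : ℕ)
local notation "rVertex" => (5 : ℕ)
local notation "rLen" => (6 : ℕ)
local notation "rLow" => (7 : ℕ)
local notation "rFull" => (8 : ℕ)
local notation "rSum" => (9 : ℕ)
local notation "rSplit" => (10 : ℕ)
local notation "rNode" => (11 : ℕ)
local notation "rStamp" => (12 : ℕ)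
local notation "rType" => (13 : ℕ)
local notation "rZero" => (14 : ℕ)
local notation "rI" => (20 : ℕ)
local notation "rC" => (21 : ℕ)
local notation "rP" => (22 : ℕ)
local notation "rX" => (23 : ℕ)
local notation "rY" => (24 : ℕ)
local notation "rZ" => (25 : ℕ)
-- Arrays: the input (starts of the lists, and the lists); the output; the parents and the types of
-- the nodes of the cotree, the numbers and the sums of their children; counters for the children
-- that are in the queue; the queue; the flags; the codes of the statuses in the traceback.
local notation "aStart" => (0 : ℕ)
local notation "aList" => (1 : ℕ)
local notation "aOut" => (2 : ℕ)
local notation "aPar" => (3 : ℕ)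
local notation "aType" => (4 : ℕ)
local notation "aDeg" => (5 : ℕ)
local notation "aSum" => (6 : ℕ)
local notation "aCount" => (7 : ℕ)
local notation "aQueue" => (8 : ℕ)
local notation "aFlag" => (9 : ℕ)
local notation "aCur" => (40 : ℕ)

namespace WordRAM

attribute [simp] Program.wp Instr.Safe Instr.apply Instr.value Program.block Test.Holds

/-! ### Programs for basic tasks -/

/-- Put the number `c` into the register `r`. -/
abbrev const (r c : ℕ) : Program := .instr (.const r c)

/-- Copy the register `p` to `r`. -/
abbrev move (r p : ℕ) : Program := .instr (.move r p)

/-- Put the sum of the registers `p` and `q` into `r`. -/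
abbrev add (r p q : ℕ) : Program := .instr (.add r p q)

/-- Put the truncated difference of the registers `p` and `q` into `r`. -/
abbrev sub (r p q : ℕ) : Program := .instr (.sub r p q)

/-- Read the entry of the array `a` at the position held by the register `i`. -/
abbrev load (r a i : ℕ) : Program := .instr (.load r a i)

/-- Write the entry of the array `a` at the position held by the register `i`. -/
abbrev store (a i r : ℕ) : Program := .instr (.store a i r)

/-- The states `s` and `s'` agree, except possibly on the registers in `R`, the arrays in `A`, and
the registers from `20` on, which are used for temporary values. -/
def Agree (R A : List ℕ) (s s' : State) : Prop :=
  (∀ r < 20, r ∉ R → s'.reg r = s.reg r) ∧ ∀ a, a ∉ A → s'.arr a = s.arr a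

theorem Agree.refl {R A : List ℕ} {s : State} : Agree R A s s := ⟨fun _ _ _ => rfl, fun _ _ => rfl⟩

theorem Agree.trans {R A : List ℕ} {s s' s'' : State} (h : Agree R A s s') (h' : Agree R A s' s'') :
    Agree R A s s'' :=
  ⟨fun r hr hrR => (h'.1 r hr hrR).trans (h.1 r hr hrR), fun a ha => (h'.2 a ha).trans (h.2 a ha)⟩

theorem Agree.mono {R A R' A' : List ℕ} {s s' : State} (h : Agree R A s s')
    (hR : R ⊆ R') (hA : A ⊆ A') : Agree R' A' s s' :=
  ⟨fun r hr hrR => h.1 r hr fun h1 => hrR (hR h1), fun a ha => h.2 a fun h1 => ha (hA h1)⟩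

theorem Agree.setReg {R A : List ℕ} {s s' : State} {r v : ℕ} (hr : 20 ≤ r ∨ r ∈ R)
    (h : Agree R A s s') : Agree R A s (s'.setReg r v) := by
  refine ⟨fun q hq hqR => ?_, h.2⟩
  have : q ≠ r := by
    rintro rfl
    exact hr.elim (by omega) hqR
  rw [State.setReg_reg, if_neg this]
  exact h.1 q hq hqR

theorem Agree.setArr {R A : List ℕ} {s s' : State} {a i v : ℕ} (ha : a ∈ A)
    (h : Agree R A s s') : Agree R A s (s'.setArr a i v) := by
  refine ⟨h.1, fun b hb => ?_⟩
  have : b ≠ a := by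
    rintro rfl
    exact hb ha
  rw [State.setArr_arr, if_neg this]
  exact h.2 b hb

/-- The body of the sweep: process the next entry `c` of the queue; if it is the last child of its
parent to be processed, then append the parent to the queue. -/
def sweepBody : Program := .block [
  load rC aQueue rI, load rP aPar rC, load rX aCount rP, add rX rX rOne, store aCount rP rX,
  load rY aDeg rP, .ite (.eq rX rY) (.seq (store aQueue rLen rP) (add rLen rLen rOne)) .skip,
  add rI rI rOne]

/-- Close the set of leaves in the queue under adding nodes all of whose children are present. -/
def sweep : Program := .seq (const rI 0) (.while (.lt rI rLen) sweepBody)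

open Cotree in
theorem sweep_spec {w r L : ℕ} {T : Cotree} {P : ℕ → Prop} {s : State} (h : T.IsTree r)
    (hr : T.par r ∉ insert r T.nodes) (hpar : s.arr aPar = T.par)
    (hd : ∀ p ∈ insert r T.nodes, r ≤ p → s.arr aDeg p = (T.children p).card)
    (hd0 : s.arr aDeg (T.par r) = 0) (hcount : ∀ p, s.arr aCount p = 0) (hone : s.reg rOne = 1)
    (hlen : s.reg rLen = L) (S : T.Sweep r P L (s.arr aQueue) 0 L) (hw : 2 * L + 1 ≤ w) :
    HaltsWithin w sweep s (1 + (2 * L * (sweepBody.cost + 1) + 1)) fun s' => ∃ len,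
      s'.reg rLen = len ∧ T.Sweep r P L (s'.arr aQueue) len len ∧
      (∀ p, s'.arr aCount p = T.count (s'.arr aQueue) len p) ∧
      Agree [rLen] [aCount, aQueue] s s' := by
  refine HaltsWithin.seq ((HaltsWithin.of_wp ?_).mono le_rfl fun s' hs' => HaltsWithin.while_const
    (fun i s' => ∃ len, s'.reg rI = i ∧ s'.reg rLen = len ∧ T.Sweep r P L (s'.arr aQueue) i len ∧
      (∀ p, s'.arr aCount p = T.count (s'.arr aQueue) i p) ∧ Agree [rLen] [aCount, aQueue] s s')
    sweepBody.cost (2 * L) ?_ ?_ hs')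
  · exact ⟨by simp, L, by simp, by simp [hlen], by simpa using S, by simp [hcount],
      Agree.refl.setReg (by simp)⟩
  · rintro i s' ⟨len, hi, hlen', S', hcount', hA⟩ hlt
    simp only [Test.Holds, hi, hlen'] at hlt
    have hlen2 := S'.len_le h hr
    refine ⟨by omega, HaltsWithin.of_wp ?_⟩
    have h1 : s'.reg rOne = 1 := (hA.1 1 (by omega) (by simp)).trans hone
    have h2 : s'.arr aPar = T.par := (hA.2 3 (by simp)).trans hpar
    have h3 : s'.arr aDeg = s.arr aDeg := hA.2 5 (by simp)
    have hcl : T.count (s'.arr aQueue) i (T.par (s'.arr aQueue i)) ≤ 2 * L := by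
      refine (Finset.card_le_card (Finset.filter_subset _ _)).trans ?_
      rw [Finset.card_range]
      omega
    have hdeg : s.arr aDeg (T.par (s'.arr aQueue i)) =
        (T.children (T.par (s'.arr aQueue i))).card := by
      by_cases hir : s'.arr aQueue i = r
      · rw [hir, hd0, h.children_par_root hr, Finset.card_empty]
      · have hm := (Finset.mem_insert.1 (S'.mem hlt)).resolve_left hir
        exact hd _ (h.par_mem _ hm) (h.le_par _ hm)
    have hcount1 : ∀ p, Function.update (s'.arr aCount) (T.par (s'.arr aQueue i))
        (T.count (s'.arr aQueue) i (T.par (s'.arr aQueue i)) + 1) p =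
          T.count (s'.arr aQueue) (i + 1) p := by
      intro p
      rw [count_succ, Function.update_apply]
      split_ifs with h4 h5 h5
      · rw [h4]
      · exact absurd h4.symm h5
      · exact absurd h5.symm h4
      · exact hcount' p
    simp [sweepBody, hi, hlen', h1, h2, h3, hcount', hdeg]
    refine ⟨by omega, fun h4 => ⟨by omega, by omega, S'.push h hr hlt ?_, fun p => ?_, ?_⟩,
      fun h4 => ⟨by omega, S'.skip hr hlt ?_, hcount1, ?_⟩⟩
    · rw [count_succ, if_pos rfl, h4]
    · rw [hcount1, count_congr fun k hk => ?_]
      rw [Function.update_of_ne (by omega)]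
    · repeat first | exact hA | refine Agree.setReg (by simp) ?_ | refine Agree.setArr (by simp) ?_
    · rwa [count_succ, if_pos rfl]
    · repeat first | exact hA | refine Agree.setReg (by simp) ?_ | refine Agree.setArr (by simp) ?_
  · rintro i s' ⟨len, hi, hlen', S', hcount', hA⟩ hlt
    simp only [Test.Holds, hi, hlen'] at hlt
    obtain rfl : i = len := by
      have := S'.le
      omega
    exact ⟨i, hlen', S', hcount', hA⟩

/-- Perform `body` for every index `rI` below `rLen`. -/
def forQueue (body : Program) : Program :=
  .seq (const rI 0) (.while (.lt rI rLen) (.seq body (add rI rI rOne)))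

/-- The rule for `forQueue`: `I i` holds before the body is performed for the index `i`. -/
theorem forQueue_spec {w len : ℕ} {body : Program} {s : State} (I : ℕ → State → Prop)
    (hlen : s.reg rLen = len) (hone : s.reg rOne = 1) (hw : len ≤ w) (h0 : I 0 (s.setReg rI 0))
    (hbody : ∀ i < len, ∀ s', I i s' → s'.reg rI = i → s'.reg rLen = len → s'.reg rOne = 1 →
      body.wp w (fun t => t.reg rI = i ∧ t.reg rLen = len ∧ t.reg rOne = 1 ∧
        I (i + 1) (t.setReg rI (i + 1))) s') :
    HaltsWithin w (forQueue body) s (len * (body.cost + 2) + 2) (I len) := by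
  have key := HaltsWithin.while_const (w := w) (b := .lt rI rLen)
    (P := .seq body (add rI rI rOne)) (Q := I len)
    (fun i s' => i ≤ len ∧ I i s' ∧ s'.reg rI = i ∧ s'.reg rLen = len ∧ s'.reg rOne = 1)
    (body.cost + 1) len (fun i s' ⟨_, h1, h2, h3, h4⟩ hlt => ?_)
    (fun i s' ⟨h0, h1, h2, h3, h4⟩ hlt => ?_) (s := s.setReg rI 0)
    ⟨by omega, h0, by simp, by simp [hlen], by simp [hone]⟩
  · refine (HaltsWithin.seq (((HaltsWithin.of_wp (P := const rI 0) (Q := fun s' =>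
      s' = s.setReg rI 0) ?_).mono le_rfl ?_))).mono (c := 1 + (len * (body.cost + 1 + 1) + 1)) ?_
      fun _ => id
    · simp
    · rintro s' rfl
      exact key
    · have : len * (body.cost + 1 + 1) = len * (body.cost + 2) := rfl
      omega
  · simp only [Test.Holds, h2, h3] at hlt
    refine ⟨hlt, HaltsWithin.of_wp (P := .seq body (add rI rI rOne)) ?_⟩
    refine Program.wp_mono (P := body) (hbody i hlt s' h1 h2 h3 h4) fun t ⟨k1, k2, k3, k4⟩ => ?_
    simp only [Program.wp, Instr.Safe, Instr.apply, Instr.value, k1, k3]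
    exact ⟨by omega, by omega, k4, by simp, by simp [k2], by simp [k3]⟩
  · simp only [Test.Holds, h2, h3] at hlt
    obtain rfl : i = len := by omega
    exact h1

/-- Append the entry `rI` of the adjacency lists to the queue, if it is smaller than `rVertex`. -/
def collectBody : Program := .block [
  load rC aList rI, .ite (.lt rC rVertex) (.seq (store aQueue rLen rC) (add rLen rLen rOne)) .skip,
  add rI rI rOne]

/-- Put the neighbours of the vertex `rVertex` that are smaller than it into the queue. -/
def collect : Program := .seq
  (.block [const rLen 0, load rI aStart rVertex, add rX rVertex rOne, load rX aStart rX])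
  (.while (.lt rI rX) collectBody)

theorem collect_spec {w x b m : ℕ} {s : State} (hx : s.reg rVertex = x) (hone : s.reg rOne = 1)
    (hb : s.arr aStart x = b) (hm : s.arr aStart (x + 1) = b + m) (hw : b + m ≤ w)
    (hxw : x + 1 ≤ w)
    (hinj : ∀ j < m, ∀ k < m, s.arr aList (b + j) = s.arr aList (b + k) → j = k) :
    HaltsWithin w collect s (4 + (m * (collectBody.cost + 1) + 1)) fun s' => ∃ len ≤ m,
      s'.reg rLen = len ∧
      (∀ j < len, ∀ k < len, s'.arr aQueue j = s'.arr aQueue k → j = k) ∧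
      (∀ y, (∃ j < len, s'.arr aQueue j = y) ↔ (∃ j < m, s.arr aList (b + j) = y) ∧ y < x) ∧
      Agree [rLen] [aQueue] s s' := by
  let I : ℕ → State → Prop := fun i s' => ∃ len ≤ i, s'.reg rI = b + i ∧ s'.reg rX = b + m ∧
      i ≤ m ∧ s'.reg rLen = len ∧
      (∀ j < len, ∀ k < len, s'.arr aQueue j = s'.arr aQueue k → j = k) ∧
      (∀ y, (∃ j < len, s'.arr aQueue j = y) ↔ (∃ j < i, s.arr aList (b + j) = y) ∧ y < x) ∧
      Agree [rLen] [aQueue] s s'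
  have key : ∀ s', I 0 s' → HaltsWithin w (.while (.lt rI rX) collectBody) s'
      (m * (collectBody.cost + 1) + 1) fun s' => ∃ len ≤ m,
      s'.reg rLen = len ∧
      (∀ j < len, ∀ k < len, s'.arr aQueue j = s'.arr aQueue k → j = k) ∧
      (∀ y, (∃ j < len, s'.arr aQueue j = y) ↔ (∃ j < m, s.arr aList (b + j) = y) ∧ y < x) ∧
      Agree [rLen] [aQueue] s s' := by
    refine fun s' hs' => HaltsWithin.while_const I _ m ?_ ?_ hs'
    · rintro i s' ⟨len, hle, hI, hX, him, hlen, hinj', hmem, hA⟩ hlt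
      simp only [Test.Holds, hI, hX] at hlt
      refine ⟨by omega, HaltsWithin.of_wp ?_⟩
      have h1 : s'.reg rOne = 1 := (hA.1 1 (by omega) (by simp)).trans hone
      have h2 : s'.reg rVertex = x := (hA.1 5 (by omega) (by simp)).trans hx
      have h3 : s'.arr aList = s.arr aList := hA.2 1 (by simp)
      simp [collectBody, hI, h1, h2, h3, hlen]
      constructor
      · intro h4
        refine ⟨by omega, by omega, len + 1, by omega, by simp; omega, by simp [hX], by omega,
          by simp, ?_, ?_, ?_⟩
        · have hnew : ∀ j < len, s'.arr aQueue j ≠ s.arr aList (b + i) := by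
            intro j hj hji
            obtain ⟨k, hk, hki⟩ := ((hmem _).1 ⟨j, hj, hji⟩).1
            have := hinj k (by omega) i (by omega) hki
            omega
          intro j hj k hk hjk
          simp [Function.update_apply] at hjk
          split_ifs at hjk with h5 h6 h6
          · omega
          · exact absurd hjk.symm (hnew k (by omega))
          · exact absurd hjk (hnew j (by omega))
          · exact hinj' j (by omega) k (by omega) hjk
        · intro y
          simp only [State.setReg_arr, State.setArr_arr, if_true]
          constructor
          · rintro ⟨j, hj, rfl⟩
            by_cases h5 : j = len
            · rw [h5, Function.update_self]
              exact ⟨⟨i, by omega, rfl⟩, h4⟩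
            · rw [Function.update_of_ne h5]
              obtain ⟨⟨k, hk, hk'⟩, h6⟩ := (hmem _).1 ⟨j, by omega, rfl⟩
              exact ⟨⟨k, by omega, hk'⟩, h6⟩
          · rintro ⟨⟨j, hj, rfl⟩, h6⟩
            by_cases h5 : j = i
            · exact ⟨len, by omega, by rw [h5, Function.update_self]⟩
            · obtain ⟨k, hk, hk'⟩ := (hmem _).2 ⟨⟨j, by omega, rfl⟩, h6⟩
              exact ⟨k, by omega, by rw [Function.update_of_ne (by omega), hk']⟩
        · repeat first | exact hA | refine Agree.setReg (by simp) ?_ |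
            refine Agree.setArr (by simp) ?_
      · intro h4
        refine ⟨by omega, len, by omega, by simp; omega, by simp [hX], by omega, by simp [hlen],
          by simpa using hinj', ?_, ?_⟩
        · intro y
          simp only [State.setReg_arr]
          rw [hmem y]
          constructor
          · rintro ⟨⟨j, hj, hj'⟩, h6⟩
            exact ⟨⟨j, by omega, hj'⟩, h6⟩
          · rintro ⟨⟨j, hj, rfl⟩, h6⟩
            refine ⟨⟨j, ?_, rfl⟩, h6⟩
            by_contra h7
            obtain rfl : j = i := by omega
            omega
        · repeat first | exact hA | refine Agree.setReg (by simp) ?_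
    · rintro i s' ⟨len, hle, hI, hX, him, hlen, hinj', hmem, hA⟩ hlt
      simp only [Test.Holds, hI, hX] at hlt
      obtain rfl : i = m := by omega
      exact ⟨len, hle, hlen, hinj', hmem, hA⟩
  have hstart : (Program.block [const rLen 0, load rI aStart rVertex, add rX rVertex rOne,
      load rX aStart rX]).wp w (I 0) s := by
    simp [hx, hone, hxw, hb, hm]
    refine ⟨0, le_rfl, by simp, by simp, by omega, by simp, by simp, by simp, ?_⟩
    repeat first | exact Agree.refl | refine Agree.setReg (by simp) ?_
  exact HaltsWithin.seq ((HaltsWithin.of_wp hstart).mono le_rfl key)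

/-! ### Sums modulo a number -/

/-- The sum of `a` and `b` modulo `K`, for `a, b < K`. -/
def addm (K a b : ℕ) : ℕ := if a + b < K then a + b else a + b - K

/-- The difference of `a` and `b` modulo `K`, for `a, b < K`. -/
def subm (K a b : ℕ) : ℕ := if a + K - b < K then a + K - b else a + K - b - K

theorem addm_lt {K a b : ℕ} (ha : a < K) (hb : b < K) : addm K a b < K := by
  unfold addm
  split_ifs <;> omega

theorem subm_lt {K a b : ℕ} (ha : a < K) : subm K a b < K := by
  unfold subm
  split_ifs <;> omega

theorem cast_addm {K a b : ℕ} : (addm K a b : ZMod K) = a + b := by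
  unfold addm
  split_ifs with h
  · push_cast
    rfl
  · rw [Nat.cast_sub (by omega)]
    simp

theorem cast_subm {K a b : ℕ} (hb : b < K) : (subm K a b : ZMod K) = a - b := by
  unfold subm
  split_ifs with h
  · rw [Nat.cast_sub (by omega)]
    simp
  · rw [Nat.cast_sub (by omega), Nat.cast_sub (by omega)]
    simp

theorem State.setReg_setReg (s : State) (r v v' : ℕ) :
    (s.setReg r v).setReg r v' = s.setReg r v' := by
  simp [State.setReg]

/-- Put the sum of the registers `p` and `q` modulo `rMod` into `r`. -/
def addMod (r p q : ℕ) : Program := .block [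
  add r p q, .ite (.lt r rMod) .skip (sub r r rMod)]

/-- Put the difference of the registers `p` and `q` modulo `rMod` into `r`. -/
def subMod (r p q : ℕ) : Program := .block [
  add r p rMod, sub r r q, .ite (.lt r rMod) .skip (sub r r rMod)]

@[simp] theorem wp_addMod {w r p q : ℕ} {Q : State → Prop} {s : State} (hr : r ≠ rMod) :
    (addMod r p q).wp w Q s ↔ s.reg p + s.reg q ≤ w ∧
      Q (s.setReg r (addm (s.reg rMod) (s.reg p) (s.reg q))) := by
  simp only [addMod, Program.block, Program.wp, Instr.Safe, Instr.apply, Instr.value, Test.Holds,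
    State.setReg_reg, if_true, if_neg hr.symm, State.setReg_setReg, true_and, addm]
  split_ifs with h <;> simp [h]

@[simp] theorem wp_subMod {w r p q : ℕ} {Q : State → Prop} {s : State} (hr : r ≠ rMod)
    (hq : r ≠ q) :
    (subMod r p q).wp w Q s ↔ s.reg p + s.reg rMod ≤ w ∧
      Q (s.setReg r (subm (s.reg rMod) (s.reg p) (s.reg q))) := by
  simp only [subMod, Program.block, Program.wp, Instr.Safe, Instr.apply, Instr.value, Test.Holds,
    State.setReg_reg, if_true, if_neg hr.symm, if_neg hq.symm, State.setReg_setReg, true_and, subm]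
  split_ifs with h <;> simp [h]

/-- `v` is the sum of the numbers in `S` modulo `K`. -/
def IsSumMod (K v : ℕ) (S : Finset ℕ) : Prop := v < K ∧ (v : ZMod K) = ∑ c ∈ S, (c : ZMod K)

theorem IsSumMod.add {K v c : ℕ} {S : Finset ℕ} (h : IsSumMod K v S) (hc : c < K) (hcS : c ∉ S) :
    IsSumMod K (addm K v c) (insert c S) :=
  ⟨addm_lt h.1 hc, by rw [cast_addm, h.2, Finset.sum_insert hcS, add_comm]⟩

theorem IsSumMod.sub {K v c : ℕ} {S : Finset ℕ} (h : IsSumMod K v S) (hc : c < K) (hcS : c ∈ S) :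
    IsSumMod K (subm K v c) (S.erase c) :=
  ⟨subm_lt h.1, by rw [cast_subm hc, h.2, ← Finset.sum_erase_add S _ hcS, add_sub_cancel_right]⟩

theorem IsSumMod.sdiff {K v v' : ℕ} {S S' : Finset ℕ} (h : IsSumMod K v S)
    (h' : IsSumMod K v' S') (hS : S' ⊆ S) : IsSumMod K (subm K v v') (S \ S') :=
  ⟨subm_lt h.1, by rw [cast_subm h'.1, h.2, h'.2, ← Finset.sum_sdiff hS, add_sub_cancel_right]⟩

theorem IsSumMod.eq_of_singleton {K v c : ℕ} (h : IsSumMod K v {c}) (hc : c < K) : v = c := by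
  have h1 := h.2
  rw [Finset.sum_singleton, ZMod.natCast_eq_natCast_iff'] at h1
  rwa [Nat.mod_eq_of_lt h.1, Nat.mod_eq_of_lt hc] at h1

/-! ### Passes over the queue -/

/-- For every entry of the queue with a marked parent, set a flag at the parent and at the
grandparent of that parent. -/
def flagBody : Program := .block [
  load rC aQueue rI, load rP aPar rC, load rX aCount rP, load rY aDeg rP,
  .ite (.eq rX rY) .skip (.block [
    load rX aPar rP, store aFlag rX rStamp, load rX aPar rX, store aFlag rX rStamp])]

/-- The parent of the `j`-th entry of the queue has not been completed. -/
def Incomplete (s : State) (j : ℕ) : Prop :=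
  s.arr aCount (s.arr aPar (s.arr aQueue j)) ≠ s.arr aDeg (s.arr aPar (s.arr aQueue j))

/-- The flags that do not hold the stamp before hold it afterwards exactly at the parents and
grandparents of marked nodes. -/
theorem flag_spec {w len : ℕ} {s : State} (hlen : s.reg rLen = len) (hone : s.reg rOne = 1)
    (hw : len ≤ w) :
    HaltsWithin w (forQueue flagBody) s (len * (flagBody.cost + 2) + 2) fun s' =>
      (∀ p, s'.arr aFlag p = s.arr aFlag p ∨ s'.arr aFlag p = s.reg rStamp) ∧
      (∀ p, s.arr aFlag p ≠ s.reg rStamp → (s'.arr aFlag p = s.reg rStamp ↔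
        ∃ j < len, Incomplete s j ∧ (p = s.arr aPar (s.arr aPar (s.arr aQueue j)) ∨
          p = s.arr aPar (s.arr aPar (s.arr aPar (s.arr aQueue j)))))) ∧
      Agree [] [aFlag] s s' := by
  refine forQueue_spec (fun i s' =>
      (∀ p, s'.arr aFlag p = s.arr aFlag p ∨ s'.arr aFlag p = s.reg rStamp) ∧
      (∀ p, s.arr aFlag p ≠ s.reg rStamp → (s'.arr aFlag p = s.reg rStamp ↔
        ∃ j < i, Incomplete s j ∧ (p = s.arr aPar (s.arr aPar (s.arr aQueue j)) ∨
          p = s.arr aPar (s.arr aPar (s.arr aPar (s.arr aQueue j)))))) ∧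
      Agree [] [aFlag] s s') hlen hone hw ⟨by simp, by simp, Agree.refl.setReg (by simp)⟩ ?_
  rintro i hi s' ⟨h1, h2, hA⟩ hrI hrLen hrOne
  have e1 : s'.arr aPar = s.arr aPar := hA.2 3 (by simp)
  have e2 : s'.arr aQueue = s.arr aQueue := hA.2 8 (by simp)
  have e3 : s'.arr aCount = s.arr aCount := hA.2 7 (by simp)
  have e4 : s'.arr aDeg = s.arr aDeg := hA.2 5 (by simp)
  have e5 : s'.reg rStamp = s.reg rStamp := hA.1 12 (by omega) (by simp)
  simp [flagBody, hrI, hrLen, hrOne, e1, e2, e3, e4, e5]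
  refine ⟨fun h3 => ⟨h1, fun p hp => ?_, ?_⟩, fun h3 => ⟨fun p => ?_, fun p hp => ?_, ?_⟩⟩
  · rw [h2 p hp]
    refine exists_congr fun j => ⟨fun h4 => ⟨by omega, h4.2⟩, fun h4 => ⟨?_, h4.2⟩⟩
    refine lt_of_le_of_ne (by omega) ?_
    rintro rfl
    exact h4.2.1 h3
  · repeat first | exact hA | refine Agree.setReg (by simp) ?_
  · simp only [Function.update_apply]
    split_ifs
    exacts [.inr rfl, .inr rfl, h1 p]
  · have h4 : (∃ j ≤ i, Incomplete s j ∧ (p = s.arr aPar (s.arr aPar (s.arr aQueue j)) ∨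
          p = s.arr aPar (s.arr aPar (s.arr aPar (s.arr aQueue j))))) ↔
        (∃ j < i, Incomplete s j ∧ (p = s.arr aPar (s.arr aPar (s.arr aQueue j)) ∨
          p = s.arr aPar (s.arr aPar (s.arr aPar (s.arr aQueue j))))) ∨
        (p = s.arr aPar (s.arr aPar (s.arr aQueue i)) ∨
          p = s.arr aPar (s.arr aPar (s.arr aPar (s.arr aQueue i)))) := by
      constructor
      · rintro ⟨j, hj, h5⟩
        by_cases hji : j = i
        · exact .inr (hji ▸ h5.2)
        · exact .inl ⟨j, by omega, h5⟩
      · rintro (⟨j, hj, h5⟩ | h5)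
        exacts [⟨j, by omega, h5⟩, ⟨i, by omega, h3, h5⟩]
    rw [h4, ← h2 p hp]
    simp only [Function.update_apply]
    split_ifs <;> tauto
  · repeat first | exact hA | refine Agree.setReg (by simp) ?_ | refine Agree.setArr (by simp) ?_

/-- Find a marked node without a flag. -/
def findBody : Program := .block [
  load rC aQueue rI, load rP aPar rC, load rX aCount rP, load rY aDeg rP,
  .ite (.eq rX rY) .skip (.block [
    load rX aFlag rP, .ite (.eq rX rStamp) .skip (move rLow rP)])]

theorem find_spec {w len u : ℕ} {s : State} (hlen : s.reg rLen = len) (hone : s.reg rOne = 1)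
    (hw : len ≤ w)
    (hex : ∃ j < len, Incomplete s j ∧ s.arr aFlag (s.arr aPar (s.arr aQueue j)) ≠ s.reg rStamp)
    (huniq : ∀ j < len, Incomplete s j →
      s.arr aFlag (s.arr aPar (s.arr aQueue j)) ≠ s.reg rStamp →
        s.arr aPar (s.arr aQueue j) = u) :
    HaltsWithin w (forQueue findBody) s (len * (findBody.cost + 2) + 2) fun s' =>
      s'.reg rLow = u ∧ Agree [rLow] [] s s' := by
  refine (forQueue_spec (fun i s' => ((∃ j < i, Incomplete s j ∧
      s.arr aFlag (s.arr aPar (s.arr aQueue j)) ≠ s.reg rStamp) → s'.reg rLow = u) ∧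
      Agree [rLow] [] s s') hlen hone hw ⟨by simp, Agree.refl.setReg (by simp)⟩ ?_).mono le_rfl
      fun s' h => ⟨h.1 hex, h.2⟩
  rintro i hi s' ⟨h1, hA⟩ hrI hrLen hrOne
  have e0 : s'.arr = s.arr := funext fun a => hA.2 a (by simp)
  have e5 : s'.reg rStamp = s.reg rStamp := hA.1 12 (by omega) (by simp)
  have hprev : ¬ (Incomplete s i ∧ s.arr aFlag (s.arr aPar (s.arr aQueue i)) ≠ s.reg rStamp) →
      (∃ j < i + 1, Incomplete s j ∧
        s.arr aFlag (s.arr aPar (s.arr aQueue j)) ≠ s.reg rStamp) → s'.reg rLow = u := by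
    rintro h2 ⟨j, hj, h3⟩
    by_cases hji : j = i
    · exact absurd (hji ▸ h3) h2
    · exact h1 ⟨j, by omega, h3⟩
  simp [findBody, hrI, hrLen, hrOne, e0, e5]
  refine ⟨fun h3 => ⟨fun j hj h4 h5 => hprev (fun h6 => h6.1 h3) ⟨j, by omega, h4, h5⟩, ?_⟩,
    fun h3 => ⟨fun h6 => ⟨fun j hj h4 h5 => hprev (fun h7 => h7.2 h6) ⟨j, by omega, h4, h5⟩, ?_⟩,
      fun h6 => ⟨fun j hj h4 h5 => huniq i hi h3 h6, ?_⟩⟩⟩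
  all_goals
    repeat first | exact hA | refine Agree.setReg (by simp) ?_

/-- Add up the full children of the node `rLow`. -/
def sumBody : Program := .block [
  load rC aQueue rI, load rP aPar rC, .ite (.eq rP rLow) (addMod rSum rSum rC) .skip]

theorem sum_spec {w len K : ℕ} {s : State} (hlen : s.reg rLen = len) (hone : s.reg rOne = 1)
    (hw : len ≤ w) (hK : s.reg rMod = K) (hKw : 2 * K ≤ w) (hK0 : 0 < K)
    (hsum : s.reg rSum = 0) (hQ : ∀ j < len, s.arr aQueue j < K)
    (hinj : ∀ j < len, ∀ k < len, s.arr aQueue j = s.arr aQueue k → j = k) :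
    HaltsWithin w (forQueue sumBody) s (len * (sumBody.cost + 2) + 2) fun s' =>
      IsSumMod K (s'.reg rSum)
        ({j ∈ Finset.range len | s.arr aPar (s.arr aQueue j) = s.reg rLow}.image (s.arr aQueue)) ∧
      Agree [rSum] [] s s' := by
  refine forQueue_spec (fun i s' => IsSumMod K (s'.reg rSum)
      ({j ∈ Finset.range i | s.arr aPar (s.arr aQueue j) = s.reg rLow}.image (s.arr aQueue)) ∧
      Agree [rSum] [] s s') hlen hone hw
      ⟨by simpa [IsSumMod, hsum] using hK0, Agree.refl.setReg (by simp)⟩ ?_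
  rintro i hi s' ⟨h1, hA⟩ hrI hrLen hrOne
  have e0 : s'.arr = s.arr := funext fun a => hA.2 a (by simp)
  have e1 : s'.reg rLow = s.reg rLow := hA.1 7 (by omega) (by simp)
  have e2 : s'.reg rMod = K := (hA.1 2 (by omega) (by simp)).trans hK
  have hlt := h1.1
  have hQi := hQ i hi
  simp [sumBody, hrI, hrLen, hrOne, e0, e1, e2]
  refine ⟨fun h3 => ⟨by omega, ?_, ?_⟩, fun h3 => ⟨?_, ?_⟩⟩
  · rw [Finset.range_add_one, Finset.filter_insert, if_pos h3, Finset.image_insert]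
    refine h1.add hQi fun h4 => ?_
    simp only [Finset.mem_image, Finset.mem_filter, Finset.mem_range] at h4
    obtain ⟨j, ⟨hj, -⟩, hji⟩ := h4
    have := hinj j (by omega) i hi hji
    omega
  · repeat first | exact hA | refine Agree.setReg (by simp) ?_
  · rwa [Finset.range_add_one, Finset.filter_insert, if_neg h3]
  · repeat first | exact hA | refine Agree.setReg (by simp) ?_

/-- Reset the counters to zero. -/
def resetBody : Program := .block [
  load rC aQueue rI, load rP aPar rC, store aCount rP rZero]

theorem reset_spec {w len : ℕ} {s : State} (hlen : s.reg rLen = len) (hone : s.reg rOne = 1)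
    (hw : len ≤ w) (hzero : s.reg rZero = 0)
    (hcount : ∀ p, s.arr aCount p ≠ 0 → ∃ j < len, s.arr aPar (s.arr aQueue j) = p) :
    HaltsWithin w (forQueue resetBody) s (len * (resetBody.cost + 2) + 2) fun s' =>
      (∀ p, s'.arr aCount p = 0) ∧ Agree [] [aCount] s s' := by
  refine (forQueue_spec (fun i s' => (∀ p, s'.arr aCount p ≠ 0 →
      ∃ j < len, i ≤ j ∧ s.arr aPar (s.arr aQueue j) = p) ∧
      Agree [] [aCount] s s') hlen hone hw ⟨?_, Agree.refl.setReg (by simp)⟩ ?_).mono le_rfl ?_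
  · simpa using hcount
  · rintro i hi s' ⟨h1, hA⟩ hrI hrLen hrOne
    have e1 : s'.arr aPar = s.arr aPar := hA.2 3 (by simp)
    have e2 : s'.arr aQueue = s.arr aQueue := hA.2 8 (by simp)
    have e3 : s'.reg rZero = 0 := (hA.1 14 (by omega) (by simp)).trans hzero
    simp [resetBody, hrI, hrLen, hrOne, e1, e2, e3]
    refine ⟨fun p => ?_, ?_⟩
    · rw [Function.update_apply]
      split_ifs with h3
      · exact fun h4 => absurd rfl h4
      · intro h4
        obtain ⟨j, hj, hij, hjp⟩ := h1 p h4
        refine ⟨j, hj, ?_, hjp⟩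
        by_contra h5
        obtain rfl : j = i := by omega
        exact h3 hjp.symm
    · repeat first | exact hA | refine Agree.setReg (by simp) ?_ | refine Agree.setArr (by simp) ?_
  · rintro s' ⟨h1, hA⟩
    refine ⟨fun p => ?_, hA⟩
    by_contra h2
    obtain ⟨j, hj, hij, -⟩ := h1 p h2
    omega

end WordRAM

namespace Cotree

variable {T T' : Cotree} {r : ℕ} {E : ℕ → ℕ → Prop} {a b c p q u v x y top bot : ℕ}
  {B : Finset ℕ}

/-! ### The children of the nodes after a surgery -/

theorem Attach.children_self (A : T.Attach T' r x q) :
    T'.children q = insert x (T.children q) := by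
  ext c
  rw [Finset.mem_insert, mem_children, mem_children, A.nodes]
  constructor
  · rintro ⟨rfl | hc, hcq⟩
    exacts [.inl rfl, .inr ⟨hc, A.par c hc ▸ hcq⟩]
  · rintro (rfl | ⟨hc, hcq⟩)
    exacts [⟨.inl rfl, A.par_leaf⟩, ⟨.inr hc, (A.par c hc).trans hcq⟩]

theorem Attach.children_of_ne (A : T.Attach T' r x q) (hp : p ≠ q) :
    T'.children p = T.children p := by
  ext c
  rw [mem_children, mem_children, A.nodes]
  constructor
  · rintro ⟨rfl | hc, hcp⟩
    exacts [absurd (hcp.symm.trans A.par_leaf) hp, ⟨hc, A.par c hc ▸ hcp⟩]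
  · rintro ⟨hc, hcp⟩
    exact ⟨.inr hc, (A.par c hc).trans hcp⟩

theorem Pair.ne_new (A : T.Pair T' r x q a) (hp : p ∈ insert r T.nodes) : p ≠ a := by
  rintro rfl
  exact (Finset.mem_insert.1 hp).elim A.root_lt.ne' A.notMem

theorem Pair.children_new (A : T.Pair T' r x q a) (h : T.IsTree r) :
    T'.children a = {q, x} := by
  ext c
  rw [mem_children, Finset.mem_insert, Finset.mem_singleton, A.nodes]
  constructor
  · rintro ⟨rfl | rfl | hc, hca⟩
    · rw [A.par_new] at hca
      exact absurd hca (A.ne_new (h.par_mem q A.mem))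
    · exact .inr rfl
    · by_contra h1
      rw [not_or] at h1
      rw [A.par c hc h1.1] at hca
      exact A.ne_new (h.par_mem c hc) hca
  · rintro (rfl | rfl)
    exacts [⟨.inr (.inr A.mem), A.par_old⟩, ⟨.inr (.inl rfl), A.par_leaf⟩]

theorem Pair.children_par (A : T.Pair T' r x q a) (h : T.IsTree r) :
    T'.children (T.par q) = insert a ((T.children (T.par q)).erase q) := by
  have hpa := A.ne_new (h.par_mem q A.mem)
  ext c
  rw [mem_children, Finset.mem_insert, Finset.mem_erase, mem_children, A.nodes]
  constructor
  · rintro ⟨rfl | rfl | hc, hcp⟩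
    · exact .inl rfl
    · exact absurd (hcp.symm.trans A.par_leaf) hpa
    · by_cases hcq : c = q
      · subst hcq
        exact absurd (hcp.symm.trans A.par_old) hpa
      · exact .inr ⟨hcq, hc, (A.par c hc hcq).symm.trans hcp⟩
  · rintro (rfl | ⟨hcq, hc, hcp⟩)
    exacts [⟨.inl rfl, A.par_new⟩, ⟨.inr (.inr hc), (A.par c hc hcq).trans hcp⟩]

theorem Pair.children_of_ne (A : T.Pair T' r x q a) (hpa : p ≠ a)
    (hp : p ≠ T.par q) : T'.children p = T.children p := by
  ext c
  rw [mem_children, mem_children, A.nodes]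
  constructor
  · rintro ⟨rfl | rfl | hc, hcp⟩
    · exact absurd (hcp.symm.trans A.par_new) hp
    · exact absurd (hcp.symm.trans A.par_leaf) hpa
    · by_cases hcq : c = q
      · subst hcq
        exact absurd (hcp.symm.trans A.par_old) hpa
      · exact ⟨hc, (A.par c hc hcq).symm.trans hcp⟩
  · rintro ⟨hc, hcp⟩
    have hcq : c ≠ q := by
      rintro rfl
      exact hp hcp.symm
    exact ⟨.inr (.inr hc), (A.par c hc hcq).trans hcp⟩

theorem Split.children_bot (S : T.Split T' r u y top bot B) (h : T.IsTree r) :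
    T'.children bot = B := by
  ext c
  rw [mem_children]
  constructor
  · rintro ⟨hc, hcb⟩
    rcases S.cases h hc with ⟨-, h1, -⟩ | ⟨h1, -⟩ | ⟨h1, -⟩ | ⟨d, hd, h1, -, h2, -⟩
    · exact h1
    · exact absurd (h1.symm.trans hcb) S.top_ne_bot
    · exact absurd (h1.symm.trans hcb) S.top_ne_bot
    · exact absurd (h1.symm.trans hcb) h2
  · exact fun hc => ⟨(S.nodes c).2 (.inr (S.subset c hc).1), S.par_of_mem c hc⟩

theorem Split.children_top (S : T.Split T' r u y top bot B) (h : T.IsTree r) :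
    T'.children top = insert bot (T.children u \ B) := by
  ext c
  rw [mem_children, Finset.mem_insert, Finset.mem_sdiff, mem_children]
  constructor
  · rintro ⟨hc, hcb⟩
    rcases S.cases h hc with ⟨h1, -⟩ | ⟨-, h1⟩ | ⟨-, h1, h2, h3, -⟩ | ⟨d, hd, h1, h2, -⟩
    · exact absurd (hcb.symm.trans h1) S.top_ne_bot
    · exact .inl h1
    · exact .inr ⟨⟨h1, h2⟩, h3⟩
    · exact absurd (h1.symm.trans hcb) h2
  · rintro (rfl | ⟨⟨h1, h2⟩, h3⟩)
    · exact ⟨S.bot_mem.1, S.par_bot⟩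
    · exact ⟨(S.nodes c).2 (.inr h1), S.par_of_notMem c h1 h2 h3⟩

/-- After a split, `top` takes the place of `u` among the children of the parent of `u`. -/
theorem Split.children_of_ne (S : T.Split T' r u y top bot B) (h : T.IsTree r)
    (hpu : p ≠ u) (hpy : p ≠ y) :
    T'.children p = if u ∈ T.nodes ∧ T.par u = p then insert top ((T.children p).erase u)
      else T.children p := by
  have hpb : p ≠ bot ∧ p ≠ top := by
    rcases S.ids with ⟨rfl, rfl⟩ | ⟨_, rfl, rfl⟩ <;> exact ⟨by assumption, by assumption⟩
  have key : ∀ c, c ∈ T'.children p ↔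
      (c ≠ u ∧ c ∈ T.children p) ∨ (c = top ∧ u ∈ T.nodes ∧ T.par u = p) := by
    intro c
    rw [mem_children, mem_children]
    constructor
    · rintro ⟨hc, hcp⟩
      rcases S.cases h hc with ⟨h1, -⟩ | ⟨h1, -⟩ | ⟨h1, -⟩ | ⟨d, hd, h1, -, -, -, h2, -⟩
      · exact absurd (hcp.symm.trans h1) hpb.1
      · exact absurd (hcp.symm.trans h1) hpb.2
      · exact absurd (hcp.symm.trans h1) hpb.2
      · rcases h2 with ⟨rfl, h2⟩ | ⟨rfl, rfl⟩
        · exact .inl ⟨h2, hd, h1.symm.trans hcp⟩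
        · exact .inr ⟨rfl, hd, h1.symm.trans hcp⟩
    · rintro (⟨h1, h2, h3⟩ | ⟨rfl, h1, h2⟩)
      · exact ⟨(S.nodes c).2 (.inr h2), (S.par c h2 h1 (h3 ▸ hpu)).trans h3⟩
      · refine ⟨?_, (S.par_top h1).trans h2⟩
        exact (Finset.mem_insert.1 S.top_mem.1).resolve_left (S.ne_root h h1)
  ext c
  rw [key]
  split_ifs with h1
  · rw [Finset.mem_insert, Finset.mem_erase]
    tauto
  · refine ⟨fun h2 => (h2.resolve_right fun h3 => h1 h3.2).2, fun h2 => .inl ⟨?_, h2⟩⟩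
    rintro rfl
    exact h1 (mem_children.1 h2)

/-! ### Existence of the results of surgeries with prescribed parents and types -/

theorem exists_attach (hxr : x < r) (hx : x ∉ T.nodes)
    (hq : q ∈ insert r T.nodes) (hrq : r ≤ q) (f g : ℕ → ℕ) (hfx : f x = q)
    (hf : ∀ c ∈ T.nodes, f c = T.par c) :
    ∃ T', T'.par = f ∧ T'.ty = g ∧ T.Attach T' r x q := by
  classical
  have hNx : ∀ c ∈ insert r T.nodes, c ≠ x := by
    rintro c hc rfl
    exact (Finset.mem_insert.1 hc).elim hxr.ne hx
  refine ⟨{ nodes := insert x T.nodes, par := f, ty := g,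
            desc := fun c => if c = x then {x} else
              {v ∈ insert x (T.desc c) | v ∈ T.desc c ∨ v = x ∧ T.Le q c} }, rfl, rfl,
    ⟨hxr, hx, hq, hrq, by simp, hfx, hf, by simp, fun c hc v => ?_⟩⟩
  simp only [if_neg (hNx c hc), Finset.mem_filter, Finset.mem_insert]
  tauto

theorem exists_pair (hxr : x < r) (hx : x ∉ T.nodes)
    (hq : q ∈ T.nodes) (ha : a ∉ T.nodes) (hra : r < a) (f g : ℕ → ℕ) (hfx : f x = a)
    (hfq : f q = a) (hfa : f a = T.par q) (hf : ∀ c ∈ T.nodes, c ≠ q → f c = T.par c) :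
    ∃ T', T'.par = f ∧ T'.ty = g ∧ T.Pair T' r x q a := by
  classical
  have hNx : ∀ c ∈ insert r T.nodes, c ≠ x := by
    rintro c hc rfl
    exact (Finset.mem_insert.1 hc).elim hxr.ne hx
  have hNa : ∀ c ∈ insert r T.nodes, c ≠ a := by
    rintro c hc rfl
    exact (Finset.mem_insert.1 hc).elim hra.ne' ha
  refine ⟨{ nodes := insert a (insert x T.nodes), par := f, ty := g,
            desc := fun c => if c = x then {x} else if c = a then insert x (T.desc q) else
              {v ∈ insert x (T.desc c) | v ∈ T.desc c ∨ v = x ∧ T.Le (T.par q) c} }, rfl, rfl,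
    ⟨hxr, hx, hq, ha, hra, by simp, hfx, hfq, hfa, hf, by simp, ?_, fun c hc v => ?_⟩⟩
  · have : a ≠ x := by omega
    simp [this]
  · simp only [if_neg (hNx c hc), if_neg (hNa c hc), Finset.mem_filter, Finset.mem_insert]
    tauto

theorem exists_split
    (hids : top = u ∧ bot = y ∨ u ∈ T.nodes ∧ top = y ∧ bot = u) (hu : u ∈ insert r T.nodes)
    (hru : r ≤ u) (hy : y ∉ T.nodes) (hry : r < y) (hB : B ⊆ T.children u) (hB2 : 2 ≤ B.card)
    (hrest : ∃ c ∈ T.children u, c ∉ B) (f g : ℕ → ℕ) (hft : u ∈ T.nodes → f top = T.par u)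
    (hfb : f bot = top) (hfB : ∀ c ∈ B, f c = bot)
    (hfu : ∀ c ∈ T.nodes, T.par c = u → c ∉ B → f c = top)
    (hf : ∀ c ∈ T.nodes, c ≠ u → T.par c ≠ u → f c = T.par c) :
    ∃ T', T'.par = f ∧ T'.ty = g ∧ T.Split T' r u y top bot B := by
  have huy : u ≠ y := by
    rintro rfl
    exact (Finset.mem_insert.1 hu).elim hry.ne' hy
  have htb : bot ≠ top := by
    rcases hids with ⟨rfl, rfl⟩ | ⟨_, rfl, rfl⟩
    exacts [huy.symm, huy]
  refine ⟨{ nodes := insert y T.nodes, par := f, ty := g,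
            desc := fun c => if c = top then T.desc u else
              if c = bot then B.biUnion T.desc else T.desc c }, rfl, rfl,
    ⟨hids, hu, hru, hy, hry, by simp, hft, hfb, hfB, hfu, hf, by simp, by simp [htb],
      fun c hc hcu => ?_, fun c hc => mem_children.1 (hB hc), fun c hc => ?_, ?_, ?_⟩⟩
  · have hcy : c ≠ y := by
      rintro rfl
      exact (Finset.mem_insert.1 hc).elim hry.ne' hy
    have : c ≠ top ∧ c ≠ bot := by
      rcases hids with ⟨rfl, rfl⟩ | ⟨_, rfl, rfl⟩ <;> exact ⟨by assumption, by assumption⟩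
    simp [this.1, this.2]
  · obtain ⟨d, hd, hdc⟩ := Finset.exists_mem_ne (by omega : 1 < B.card) c
    exact ⟨d, hd, hdc⟩
  · exact Finset.card_pos.1 (by omega)
  · obtain ⟨c, hc, hcB⟩ := hrest
    rw [mem_children] at hc
    exact ⟨c, hc.1, hc.2, hcB⟩

end Cotree

namespace WordRAM

/-! ### Surgery on the cotree in the memory -/

/-- The tree `T` is stored in the memory. Its root is `n + 2`, and `n + 3` serves as the parent of
the root; `rNext` is the first unused number. -/
structure Heap (n : ℕ) (T : Cotree) (s : State) : Prop where
  isTree : T.IsTree (n + 2)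
  num : s.reg rNum = n
  one : s.reg rOne = 1
  mod : s.reg rMod = 3 * n + 4
  root : s.reg rRoot = n + 2
  zero : s.reg rZero = 0
  par : s.arr aPar = T.par
  ty : s.arr aType = T.ty
  par_root : T.par (n + 2) = n + 3
  par_null : T.par (n + 3) = n + 3
  null_notMem : n + 3 ∉ T.nodes
  lt_next : ∀ c ∈ insert (n + 2) T.nodes, c < s.reg rNext
  null_lt_next : n + 3 < s.reg rNext
  deg : ∀ p ∈ insert (n + 2) T.nodes, n + 2 ≤ p → s.arr aDeg p = (T.children p).card
  sum : ∀ p ∈ insert (n + 2) T.nodes, n + 2 ≤ p →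
    IsSumMod (3 * n + 4) (s.arr aSum p) (T.children p)
  deg_null : s.arr aDeg (n + 3) = 0
  count : ∀ p, s.arr aCount p = 0

theorem Heap.card_children_le {n p : ℕ} {T : Cotree} {s : State} (H : Heap n T s) :
    (T.children p).card ≤ s.reg rNext := by
  have : T.children p ⊆ Finset.range (s.reg rNext) := fun c hc =>
    Finset.mem_range.2 (H.lt_next c (Finset.mem_insert_of_mem (Cotree.mem_children.1 hc).1))
  simpa using Finset.card_le_card this

/-- Make the vertex `rVertex` a child of the node `rNode`. -/
def attach : Program := .block [
  store aPar rVertex rNode, load rX aDeg rNode, add rX rX rOne, store aDeg rNode rX,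
  load rX aSum rNode, addMod rX rX rVertex, store aSum rNode rX]

theorem attach_spec {w n x q : ℕ} {T : Cotree} {s : State} (H : Heap n T s)
    (hx : s.reg rVertex = x) (hq : s.reg rNode = q) (hxn : x < n) (hxT : x ∉ T.nodes)
    (hqT : q ∈ insert (n + 2) T.nodes) (hrq : n + 2 ≤ q) (hnext : s.reg rNext ≤ 3 * n + 4)
    (hw : 6 * n + 8 ≤ w) :
    attach.wp w (fun s' => ∃ T', T.Attach T' (n + 2) x q ∧ T'.ty = T.ty ∧ Heap n T' s' ∧
      Agree [] [aPar, aDeg, aSum] s s') s := by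
  obtain ⟨T', h1, h2, A⟩ := Cotree.exists_attach (T := T) (r := n + 2) (x := x) (by omega)
    hxT hqT hrq
    (Function.update T.par x q) T.ty (by simp) (fun c hc => by
      rw [Function.update_of_ne]
      rintro rfl
      exact hxT hc)
  have hcard := H.card_children_le (p := q)
  have hsum := H.sum q hqT hrq
  have hqK := H.lt_next q hqT
  have hsumlt := hsum.1
  have hxc : x ∉ T.children q := fun h3 => hxT (Cotree.mem_children.1 h3).1
  have hmem : ∀ p ∈ insert (n + 2) T'.nodes, n + 2 ≤ p → p ∈ insert (n + 2) T.nodes := by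
    intro p hp hrp
    rw [Finset.mem_insert, A.nodes] at hp
    rw [Finset.mem_insert]
    have : p ≠ x := by omega
    tauto
  simp [attach, hx, hq, H.one, H.mod, H.deg q hqT hrq]
  refine ⟨by omega, by omega, T', A, h2, ?_, ?_⟩
  · have hnx : n + 2 ≠ x ∧ n + 3 ≠ x := by omega
    exact
    { isTree := A.isTree H.isTree
      num := by simp [H.num]
      one := by simp [H.one]
      mod := by simp [H.mod]
      root := by simp [H.root]
      zero := by simp [H.zero]
      par := by simp [H.par, h1]
      ty := by simp [H.ty, h2]
      par_root := by simp [h1, hnx.1, H.par_root]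
      par_null := by simp [h1, hnx.2, H.par_null]
      null_notMem := by
        rw [A.nodes]
        exact fun h3 => h3.elim hnx.2 H.null_notMem
      lt_next := fun c hc => by
        have h3 := H.null_lt_next
        simp only [State.setReg_reg, State.setArr_reg, Nat.reduceEqDiff, if_false]
        by_cases hcx : c = x
        · omega
        · refine H.lt_next c ?_
          rw [Finset.mem_insert, A.nodes] at hc
          rw [Finset.mem_insert]
          tauto
      null_lt_next := by simpa using H.null_lt_next
      deg := fun p hp hrp => by
        have hp' := hmem p hp hrp
        by_cases hpq : p = q
        · subst hpq
          simp [A.children_self, Finset.card_insert_of_notMem hxc]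
        · simp [hpq, A.children_of_ne hpq, H.deg p hp' hrp]
      sum := fun p hp hrp => by
        have hp' := hmem p hp hrp
        by_cases hpq : p = q
        · subst hpq
          simpa [A.children_self] using hsum.add (by omega) hxc
        · simpa [hpq, A.children_of_ne hpq] using H.sum p hp' hrp
      deg_null := by
        have : n + 3 ≠ q := by
          rintro rfl
          rw [Finset.mem_insert] at hqT
          exact hqT.elim (by omega) H.null_notMem
        simp [this, H.deg_null]
      count := by simp [H.count] }
  · repeat first | exact Agree.refl | refine Agree.setReg (by simp) ?_ |
      refine Agree.setArr (by simp) ?_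

/-- Replace the node `rNode` by a new node of type `rType` whose children are `rNode` and the vertex
`rVertex`. -/
def pair : Program := .block [
  move rZ rNext, add rNext rNext rOne, load rP aPar rNode, store aPar rZ rP, store aPar rNode rZ,
  store aPar rVertex rZ, store aType rZ rType, const rX 2, store aDeg rZ rX,
  addMod rX rNode rVertex, store aSum rZ rX, load rX aSum rP, subMod rX rX rNode, addMod rX rX rZ,
  store aSum rP rX]

theorem pair_spec {w n x q a : ℕ} {T : Cotree} {s : State} (H : Heap n T s)
    (hx : s.reg rVertex = x) (hq : s.reg rNode = q) (ha : s.reg rNext = a) (hxn : x < n)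
    (hxT : x ∉ T.nodes) (hqT : q ∈ T.nodes) (hnext : a < 3 * n + 4) (hw : 6 * n + 8 ≤ w) :
    pair.wp w (fun s' => ∃ T', T.Pair T' (n + 2) x q a ∧
      (∀ c ∈ insert (n + 2) T.nodes, T'.ty c = T.ty c) ∧ T'.ty a = s.reg rType ∧ Heap n T' s' ∧
      s'.reg rNext = a + 1 ∧ Agree [rNext] [aPar, aType, aDeg, aSum] s s') s := by
  have hins : ∀ c ∈ T.nodes, c ∈ insert (n + 2) T.nodes := fun c hc => Finset.mem_insert_of_mem hc
  have haT : ∀ c ∈ insert (n + 2) T.nodes, c ≠ a := fun c hc => by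
    have := H.lt_next c hc
    omega
  have hna := H.null_lt_next
  have hxa : x ≠ a := by omega
  have hqa := haT q (hins q hqT)
  have hqx : q ≠ x := by
    rintro rfl
    exact hxT hqT
  have hpa := haT _ (H.isTree.par_mem q hqT)
  have hpK := H.lt_next _ (H.isTree.par_mem q hqT)
  have hrp := H.isTree.le_par q hqT
  obtain ⟨T', h1, h2, A⟩ := Cotree.exists_pair (T := T) (r := n + 2) (x := x) (q := q) (a := a)
    (by omega) hxT hqT
    (fun h3 => haT a (hins a h3) rfl) (by omega)
    (Function.update (Function.update (Function.update T.par a (T.par q)) q a) x a)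
    (Function.update T.ty a (s.reg rType)) (by simp) (by simp [hqx])
    (by simp [hqa.symm, hxa.symm]) (fun c hc hcq => by
      have hca := haT c (hins c hc)
      have hcx : c ≠ x := by
        rintro rfl
        exact hxT hc
      simp [hca, hcx, hcq])
  have hsum := H.sum _ (H.isTree.par_mem q hqT) hrp
  have hqK := H.lt_next q (hins q hqT)
  have hsumlt := hsum.1
  have hqc : q ∈ T.children (T.par q) := Cotree.mem_children.2 ⟨hqT, rfl⟩
  have hac : a ∉ (T.children (T.par q)).erase q := fun h3 =>
    haT a (hins a (Cotree.mem_children.1 (Finset.mem_of_mem_erase h3)).1) rfl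
  have hmem : ∀ p ∈ insert (n + 2) T'.nodes, n + 2 ≤ p → p ≠ a → p ∈ insert (n + 2) T.nodes := by
    intro p hp hrp hpa
    rw [Finset.mem_insert, A.nodes] at hp
    rw [Finset.mem_insert]
    have : p ≠ x := by omega
    tauto
  have hsub := subm_lt (b := q) hsumlt
  simp [pair, hx, hq, ha, H.one, H.mod, H.par, hpa]
  refine ⟨by omega, by omega, by omega, by omega, by omega, T', A, ?_, by simp [h2], ?_, ?_⟩
  · exact ⟨by simp [h2, haT _ (Finset.mem_insert_self _ _)],
      fun c hc => by simp [h2, haT _ (hins c hc)]⟩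
  · have hnx : n + 2 ≠ x ∧ n + 3 ≠ x ∧ n + 2 ≠ a ∧ n + 3 ≠ a := by omega
    have hn2q : n + 2 ≠ q := by
      rintro rfl
      exact H.isTree.root_notMem hqT
    have hn3q : n + 3 ≠ q := by
      rintro rfl
      exact H.null_notMem hqT
    exact
    { isTree := A.isTree H.isTree
      num := by simp [H.num]
      one := by simp [H.one]
      mod := by simp [H.mod]
      root := by simp [H.root]
      zero := by simp [H.zero]
      par := by simp [H.par, h1]
      ty := by simp [H.ty, h2]
      par_root := by simp [h1, hnx, hn2q, H.par_root]
      par_null := by simp [h1, hnx, hn3q, H.par_null]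
      null_notMem := by
        rw [A.nodes]
        exact fun h3 => h3.elim hnx.2.2.2 fun h3 => h3.elim hnx.2.1 H.null_notMem
      lt_next := fun c hc => by
        simp
        by_cases hcx : c = x
        · omega
        · by_cases hca : c = a
          · omega
          · have := H.lt_next c (by
              rw [Finset.mem_insert, A.nodes] at hc
              rw [Finset.mem_insert]
              tauto)
            omega
      null_lt_next := by
        simp
        omega
      deg := fun p hp hrp => by
        by_cases hpa' : p = a
        · subst hpa'
          simp [A.children_new H.isTree, Finset.card_pair hqx]
        have hp' := hmem p hp hrp hpa'
        by_cases hpq : p = T.par q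
        · subst hpq
          simp [hpa, H.deg _ hp' hrp, A.children_par H.isTree, Finset.card_insert_of_notMem hac,
            Finset.card_erase_add_one hqc]
        · simp [hpa', A.children_of_ne hpa' hpq, H.deg p hp' hrp]
      sum := fun p hp hrp => by
        by_cases hpa' : p = a
        · subst hpa'
          rw [A.children_new H.isTree, Finset.pair_comm]
          have : IsSumMod (3 * n + 4) q {q} := ⟨by omega, by simp⟩
          simpa [hpa.symm] using this.add (by omega) (by simpa using hqx.symm)
        have hp' := hmem p hp hrp hpa'
        by_cases hpq : p = T.par q
        · subst hpq
          simpa [hpa, A.children_par H.isTree] using (hsum.sub (by omega) hqc).add (by omega) hac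
        · simpa [hpa', hpq, A.children_of_ne hpa' hpq] using H.sum p hp' hrp
      deg_null := by simp [hnx, H.deg_null]
      count := by simp [H.count] }
  · repeat first | exact Agree.refl | refine Agree.setReg (by simp) ?_ |
      refine Agree.setArr (by simp) ?_

/-- Make the full children of `rLow` children of `rSplit`. -/
def moveBody : Program := .block [
  load rC aQueue rI, load rP aPar rC, .ite (.eq rP rLow) (store aPar rC rSplit) .skip]

theorem move_spec {w len u y : ℕ} {s : State} (hlen : s.reg rLen = len) (hone : s.reg rOne = 1)
    (hw : len ≤ w) (hu : s.reg rLow = u) (hy : s.reg rSplit = y)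
    (hinj : ∀ j < len, ∀ k < len, s.arr aQueue j = s.arr aQueue k → j = k) {F : Finset ℕ}
    (hF : ∀ c, c ∈ F ↔ (∃ j < len, s.arr aQueue j = c) ∧ s.arr aPar c = u) :
    HaltsWithin w (forQueue moveBody) s (len * (moveBody.cost + 2) + 2) fun s' =>
      (∀ c, s'.arr aPar c = if c ∈ F then y else s.arr aPar c) ∧ Agree [] [aPar] s s' := by
  refine (forQueue_spec (fun i s' => (∀ c, ((∃ j < i, s.arr aQueue j = c) ∧ s.arr aPar c = u →
      s'.arr aPar c = y) ∧ (¬ ((∃ j < i, s.arr aQueue j = c) ∧ s.arr aPar c = u) →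
      s'.arr aPar c = s.arr aPar c)) ∧
      Agree [] [aPar] s s') hlen hone hw ⟨by simp, Agree.refl.setReg (by simp)⟩ ?_).mono le_rfl ?_
  · rintro i hi s' ⟨h1, hA⟩ hrI hrLen hrOne
    have e1 : s'.arr aQueue = s.arr aQueue := hA.2 8 (by simp)
    have e2 : s'.reg rLow = u := (hA.1 7 (by omega) (by simp)).trans hu
    have e3 : s'.reg rSplit = y := (hA.1 10 (by omega) (by simp)).trans hy
    have e4 : s'.arr aPar (s.arr aQueue i) = s.arr aPar (s.arr aQueue i) := by
      refine (h1 _).2 ?_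
      rintro ⟨⟨j, hj, hji⟩, -⟩
      have := hinj j (by omega) i hi hji
      omega
    simp only [moveBody, Program.block, Program.wp, Instr.Safe, Instr.apply, Instr.value,
      Test.Holds, State.setReg_reg, State.setReg_arr, State.setArr_reg, State.setArr_arr, hrI,
      hrLen, hrOne, e1, e2, e3, e4, Nat.reduceEqDiff, if_true, if_false, true_and]
    refine ⟨fun h3 => ⟨fun c => ?_, ?_⟩, fun h3 => ⟨fun c => ?_, ?_⟩⟩
    · simp only [Function.update_apply]
      split_ifs with h4
      · refine ⟨fun _ => rfl, fun h5 => absurd ⟨⟨i, by omega, h4.symm⟩, ?_⟩ h5⟩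
        rw [h4, h3]
      · refine ⟨fun ⟨⟨j, hj, hjc⟩, hcu⟩ => (h1 c).1 ⟨⟨j, ?_, hjc⟩, hcu⟩, fun h5 => (h1 c).2 ?_⟩
        · refine lt_of_le_of_ne (by omega) ?_
          rintro rfl
          exact h4 hjc.symm
        · rintro ⟨⟨j, hj, hjc⟩, hcu⟩
          exact h5 ⟨⟨j, by omega, hjc⟩, hcu⟩
    · repeat first | exact hA | refine Agree.setReg (by simp) ?_ | refine Agree.setArr (by simp) ?_
    · refine ⟨fun ⟨⟨j, hj, hjc⟩, hcu⟩ => (h1 c).1 ⟨⟨j, ?_, hjc⟩, hcu⟩, fun h5 => (h1 c).2 ?_⟩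
      · refine lt_of_le_of_ne (by omega) ?_
        rintro rfl
        exact h3 (hjc ▸ hcu)
      · rintro ⟨⟨j, hj, hjc⟩, hcu⟩
        exact h5 ⟨⟨j, by omega, hjc⟩, hcu⟩
    · repeat first | exact hA | refine Agree.setReg (by simp) ?_
  · rintro s' ⟨h1, hA⟩
    refine ⟨fun c => ?_, hA⟩
    split_ifs with h2
    · exact (h1 c).1 ((hF c).1 h2)
    · exact (h1 c).2 (mt (hF c).2 h2)

/-- The data of the lowest mixed node `u` that are gathered before the surgery: the queue holds the
full nodes, and `rFull` and `rSum` are the number and the sum of the full children of `u`. -/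
structure Located (n len u : ℕ) (F : Finset ℕ) (T : Cotree) (s : State) : Prop where
  len_eq : s.reg rLen = len
  inj : ∀ j < len, ∀ k < len, s.arr aQueue j = s.arr aQueue k → j = k
  low : s.reg rLow = u
  mem : u ∈ insert (n + 2) T.nodes
  root_le : n + 2 ≤ u
  full_iff : ∀ c, c ∈ F ↔ (∃ j < len, s.arr aQueue j = c) ∧ T.par c = u
  subset : F ⊆ T.children u
  card : s.reg rFull = F.card
  sum : IsSumMod (3 * n + 4) (s.reg rSum) F

/-- Start the splitting of `rLow`: create the node `rSplit` and give it the full children. -/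
def startSplit : Program := .seq (.block [move rSplit rNext, add rNext rNext rOne])
  (forQueue moveBody)

theorem startSplit_spec {w n len u y : ℕ} {F : Finset ℕ} {T : Cotree} {s : State} (H : Heap n T s)
    (D : Located n len u F T s) (hy : s.reg rNext = y) (hnext : y < 3 * n + 4) (hlen : len ≤ w)
    (hw : 6 * n + 8 ≤ w) :
    HaltsWithin w startSplit s (2 + (len * (moveBody.cost + 2) + 2)) fun s' =>
      (∀ c, s'.arr aPar c = if c ∈ F then y else T.par c) ∧ s'.reg rSplit = y ∧
      s'.reg rNext = y + 1 ∧ Agree [rSplit, rNext] [aPar] s s' := by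
  refine HaltsWithin.seq ((HaltsWithin.of_wp (Q := fun s' => s' =
    (s.setReg rSplit y).setReg rNext (y + 1)) ?_).mono le_rfl ?_)
  · simp [hy, H.one]
    omega
  · rintro s' rfl
    refine (move_spec (u := u) (y := y) (F := F) (by simp [D.len_eq]) (by simp [H.one])
      hlen (by simp [D.low]) (by simp) (by simpa using D.inj)
      (by simpa [H.par] using D.full_iff)).mono le_rfl ?_
    rintro s' ⟨h1, h2⟩
    refine ⟨by simpa [H.par] using h1, ?_, ?_, ?_⟩
    · rw [h2.1 10 (by omega) (by simp)]
      simp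
    · rw [h2.1 4 (by omega) (by simp)]
      simp
    · refine Agree.trans ?_ (h2.mono (by simp) (by simp))
      exact (Agree.refl.setReg (by simp)).setReg (by simp)

/-- Finish the splitting of the union node `rLow`, whose full children move to the new lower
node. -/
def splitDown : Program := .block [
  store aPar rSplit rLow, load rX aType rLow, store aType rSplit rX, store aDeg rSplit rFull,
  store aSum rSplit rSum, load rX aDeg rLow, sub rX rX rFull, add rX rX rOne, store aDeg rLow rX,
  load rX aSum rLow, subMod rX rX rSum, addMod rX rX rSplit, store aSum rLow rX, move rNode rSplit]

/-- Finish the splitting of the join node `rLow`, whose full children move to the new upper node. -/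
def splitUp : Program := .block [
  load rP aPar rLow, store aPar rSplit rP, store aPar rLow rSplit, load rX aType rLow,
  store aType rSplit rX, load rX aSum rP, subMod rX rX rLow, addMod rX rX rSplit, store aSum rP rX,
  load rX aDeg rLow, sub rX rX rFull, store aDeg rLow rX, load rX aSum rLow, subMod rX rX rSum,
  store aSum rLow rX, add rX rFull rOne, store aDeg rSplit rX, addMod rX rSum rLow,
  store aSum rSplit rX, move rNode rLow]

theorem splitDown_spec {w n len u y : ℕ} {F : Finset ℕ} {T : Cotree} {s s₁ : State}
    (H : Heap n T s) (D : Located n len u F T s) (hy : s.reg rNext = y) (hnext : y < 3 * n + 4)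
    (hw : 6 * n + 8 ≤ w)
    (hF : 2 ≤ F.card) (hrest : ∃ c ∈ T.children u, c ∉ F)
    (hpar : ∀ c, s₁.arr aPar c = if c ∈ F then y else T.par c) (hy₁ : s₁.reg rSplit = y)
    (hy₂ : s₁.reg rNext = y + 1) (hA : Agree [rSplit, rNext] [aPar] s s₁) :
    splitDown.wp w (fun s' => ∃ T', T.Split T' (n + 2) u y u y F ∧
      (∀ c ∈ insert (n + 2) T.nodes, T'.ty c = T.ty c) ∧ T'.ty y = T.ty u ∧ Heap n T' s' ∧
      s'.reg rNode = y ∧ s'.reg rNext = y + 1 ∧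
      Agree [rSplit, rNext, rNode] [aPar, aType, aDeg, aSum] s s') s₁ := by
  have hins : ∀ c ∈ T.nodes, c ∈ insert (n + 2) T.nodes := fun c hc => Finset.mem_insert_of_mem hc
  have hyT : ∀ c ∈ insert (n + 2) T.nodes, c ≠ y := fun c hc => by
    have := H.lt_next c hc
    omega
  have hny := H.null_lt_next
  have huy := hyT u D.mem
  have hyF : y ∉ F := fun h1 => hyT y (hins y (Cotree.mem_children.1 (D.subset h1)).1) rfl
  have hFu : ∀ c ∈ F, c ∈ T.nodes ∧ T.par c = u := fun c hc => Cotree.mem_children.1 (D.subset hc)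
  obtain ⟨T', h1, h2, S⟩ := Cotree.exists_split (T := T) (r := n + 2) (u := u) (y := y) (top := u)
    (bot := y) (.inl ⟨rfl, rfl⟩) D.mem D.root_le (fun h3 => hyT y (hins y h3) rfl) (by omega)
    D.subset hF hrest (Function.update (s₁.arr aPar) y u) (Function.update T.ty y (T.ty u))
    (fun hu => by
      rw [Function.update_of_ne huy, hpar, if_neg]
      exact fun h3 => H.isTree.par_ne_self hu (hFu u h3).2)
    (by simp) (fun c hc => by
      rw [Function.update_of_ne (hyT c (hins c (hFu c hc).1)), hpar, if_pos hc])
    (fun c hc hcu hcF => by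
      rw [Function.update_of_ne (hyT c (hins c hc)), hpar, if_neg hcF, hcu])
    (fun c hc hcu hcp => by
      rw [Function.update_of_ne (hyT c (hins c hc)), hpar, if_neg fun h3 => hcp (hFu c h3).2])
  have a1 : s₁.reg rLow = u := (hA.1 7 (by omega) (by simp)).trans D.low
  have a2 : s₁.reg rFull = F.card := (hA.1 8 (by omega) (by simp)).trans D.card
  have a3 : s₁.reg rSum = s.reg rSum := hA.1 9 (by omega) (by simp)
  have a4 : s₁.reg rOne = 1 := (hA.1 1 (by omega) (by simp)).trans H.one
  have a5 : s₁.reg rMod = 3 * n + 4 := (hA.1 2 (by omega) (by simp)).trans H.mod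
  have a6 : s₁.arr aType = T.ty := (hA.2 4 (by simp)).trans H.ty
  have a7 : s₁.arr aDeg = s.arr aDeg := hA.2 5 (by simp)
  have a8 : s₁.arr aSum = s.arr aSum := hA.2 6 (by simp)
  have a9 := H.deg u D.mem D.root_le
  have hsum := H.sum u D.mem D.root_le
  have hsub := (hsum.sdiff D.sum D.subset)
  have hyS : y ∉ T.children u \ F := fun h3 =>
    hyT y (hins y (Cotree.mem_children.1 (Finset.mem_sdiff.1 h3).1).1) rfl
  have hch := H.card_children_le (p := u)
  have hs1 := hsum.1
  have hs2 := hsub.1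
  have hcard := Finset.card_sdiff_add_card_eq_card D.subset
  have hmem : ∀ p ∈ insert (n + 2) T'.nodes, p ≠ y → p ∈ insert (n + 2) T.nodes := by
    intro p hp hpy
    rw [Finset.mem_insert, S.nodes] at hp
    rw [Finset.mem_insert]
    tauto
  simp [splitDown, a1, a2, a3, a4, a5, a6, a7, a8, a9, hy₁, hy₂, huy]
  refine ⟨by omega, by omega, by omega, T', S, ?_, by simp [h2], ?_, ?_⟩
  · exact ⟨by simp [h2, hyT _ (Finset.mem_insert_self _ _)],
      fun c hc => by simp [h2, hyT _ (hins c hc)]⟩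
  · have hrF : n + 2 ∉ F := fun h3 => H.isTree.root_notMem (hFu _ h3).1
    have hnF : n + 3 ∉ F := fun h3 => H.null_notMem (hFu _ h3).1
    have hny' : n + 2 ≠ y ∧ n + 3 ≠ y := by omega
    have hnu : n + 3 ≠ u := by
      rintro rfl
      have := D.mem
      rw [Finset.mem_insert] at this
      exact this.elim (by omega) H.null_notMem
    exact
    { isTree := S.isTree H.isTree
      num := by simp [hA.1 0 (by omega) (by simp), H.num]
      one := by simp [a4]
      mod := by simp [a5]
      root := by simp [hA.1 3 (by omega) (by simp), H.root]
      zero := by simp [hA.1 14 (by omega) (by simp), H.zero]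
      par := by simp [h1]
      ty := by simp [h2, a6]
      par_root := by simp [h1, hny', hpar, hrF, H.par_root]
      par_null := by simp [h1, hny', hpar, hnF, H.par_null]
      null_notMem := by
        rw [S.nodes]
        exact fun h3 => h3.elim hny'.2 H.null_notMem
      lt_next := fun c hc => by
        simp [hy₂]
        by_cases hcy : c = y
        · omega
        · have := H.lt_next c (hmem c hc hcy)
          omega
      null_lt_next := by
        simp [hy₂]
        omega
      deg := fun p hp hrp => by
        by_cases hpy : p = y
        · subst hpy
          simp [S.children_bot H.isTree, huy.symm]
        by_cases hpu : p = u
        · subst hpu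
          simp [S.children_top H.isTree, Finset.card_insert_of_notMem hyS]
          omega
        · have hp' := hmem p hp hpy
          simp [hpu, hpy, a7, S.children_of_ne H.isTree hpu hpy, H.deg p hp' hrp]
          split_ifs with h3
          · rw [Finset.insert_erase (Cotree.mem_children.2 h3)]
          · rfl
      sum := fun p hp hrp => by
        by_cases hpy : p = y
        · subst hpy
          simpa [S.children_bot H.isTree, huy.symm] using D.sum
        by_cases hpu : p = u
        · subst hpu
          simpa [S.children_top H.isTree] using hsub.add (by omega) hyS
        · have hp' := hmem p hp hpy
          simp [hpu, hpy, a8, S.children_of_ne H.isTree hpu hpy]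
          split_ifs with h3
          · rw [Finset.insert_erase (Cotree.mem_children.2 h3)]
            exact H.sum p hp' hrp
          · exact H.sum p hp' hrp
      deg_null := by simp [hny', hnu, a7, H.deg_null]
      count := by simp [hA.2 7 (by simp), H.count] }
  · have hA' : Agree [rSplit, rNext, rNode] [aPar, aType, aDeg, aSum] s s₁ :=
      hA.mono (by simp) (by simp)
    repeat first | exact hA' | refine Agree.setReg (by simp) ?_ | refine Agree.setArr (by simp) ?_

theorem splitUp_spec {w n len u y : ℕ} {F : Finset ℕ} {T : Cotree} {s s₁ : State}
    (H : Heap n T s) (D : Located n len u F T s) (hy : s.reg rNext = y) (hnext : y < 3 * n + 4)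
    (hw : 6 * n + 8 ≤ w) (huT : u ∈ T.nodes)
    (hF : F.Nonempty) (hrest : F.card + 2 ≤ (T.children u).card)
    (hpar : ∀ c, s₁.arr aPar c = if c ∈ F then y else T.par c) (hy₁ : s₁.reg rSplit = y)
    (hy₂ : s₁.reg rNext = y + 1) (hA : Agree [rSplit, rNext] [aPar] s s₁) :
    splitUp.wp w (fun s' => ∃ T', T.Split T' (n + 2) u y y u (T.children u \ F) ∧
      (∀ c ∈ insert (n + 2) T.nodes, T'.ty c = T.ty c) ∧ T'.ty y = T.ty u ∧ Heap n T' s' ∧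
      s'.reg rNode = u ∧ s'.reg rNext = y + 1 ∧
      Agree [rSplit, rNext, rNode] [aPar, aType, aDeg, aSum] s s') s₁ := by
  have hins : ∀ c ∈ T.nodes, c ∈ insert (n + 2) T.nodes := fun c hc => Finset.mem_insert_of_mem hc
  have hyT : ∀ c ∈ insert (n + 2) T.nodes, c ≠ y := fun c hc => by
    have := H.lt_next c hc
    omega
  have hny := H.null_lt_next
  have huy := hyT u D.mem
  have hFu : ∀ c ∈ F, c ∈ T.nodes ∧ T.par c = u := fun c hc => Cotree.mem_children.1 (D.subset hc)
  have hcF : ∀ c ∈ T.nodes, T.par c = u → c ∉ T.children u \ F → c ∈ F := fun c hc hcu h3 => by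
    by_contra h4
    exact h3 (Finset.mem_sdiff.2 ⟨Cotree.mem_children.2 ⟨hc, hcu⟩, h4⟩)
  have hcard := Finset.card_sdiff_add_card_eq_card D.subset
  have hpu := H.isTree.par_ne_self huT
  have hpy := hyT _ (H.isTree.par_mem u huT)
  have hcu : ∀ c ∈ T.nodes, T.par c = u → c ≠ u := fun c hc h3 h4 =>
    H.isTree.par_ne_self hc (h3.trans h4.symm)
  obtain ⟨T', h1, h2, S⟩ := Cotree.exists_split (T := T) (r := n + 2) (u := u) (y := y) (top := y)
    (bot := u) (B := T.children u \ F) (.inr ⟨huT, rfl, rfl⟩) D.mem D.root_le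
    (fun h3 => hyT y (hins y h3) rfl) (by omega)
    Finset.sdiff_subset (by omega) (by
      obtain ⟨c, hc⟩ := hF
      exact ⟨c, D.subset hc, by simp [hc]⟩)
    (Function.update (Function.update (s₁.arr aPar) y (T.par u)) u y)
    (Function.update T.ty y (T.ty u)) (fun hu => by simp [huy.symm])
    (by simp) (fun c hc => by
      obtain ⟨h3, h4⟩ := Finset.mem_sdiff.1 hc
      obtain ⟨h5, h6⟩ := Cotree.mem_children.1 h3
      rw [Function.update_of_ne (hcu c h5 h6), Function.update_of_ne (hyT c (hins c h5)), hpar,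
        if_neg h4, h6])
    (fun c hc hcp hcB => by
      rw [Function.update_of_ne (hcu c hc hcp), Function.update_of_ne (hyT c (hins c hc)), hpar,
        if_pos (hcF c hc hcp hcB)])
    (fun c hc hcu hcp => by
      rw [Function.update_of_ne hcu, Function.update_of_ne (hyT c (hins c hc)), hpar,
        if_neg fun h3 => hcp (hFu c h3).2])
  have a0 : s₁.arr aPar u = T.par u := by
    rw [hpar, if_neg]
    exact fun h3 => hpu (hFu u h3).2
  have a1 : s₁.reg rLow = u := (hA.1 7 (by omega) (by simp)).trans D.low
  have a2 : s₁.reg rFull = F.card := (hA.1 8 (by omega) (by simp)).trans D.card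
  have a3 : s₁.reg rSum = s.reg rSum := hA.1 9 (by omega) (by simp)
  have a4 : s₁.reg rOne = 1 := (hA.1 1 (by omega) (by simp)).trans H.one
  have a5 : s₁.reg rMod = 3 * n + 4 := (hA.1 2 (by omega) (by simp)).trans H.mod
  have a6 : s₁.arr aType = T.ty := (hA.2 4 (by simp)).trans H.ty
  have a7 : s₁.arr aDeg = s.arr aDeg := hA.2 5 (by simp)
  have a8 : s₁.arr aSum = s.arr aSum := hA.2 6 (by simp)
  have a9 := H.deg u D.mem D.root_le
  have hsum := H.sum u D.mem D.root_le
  have hsub := (hsum.sdiff D.sum D.subset)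
  have hsump := H.sum _ (H.isTree.par_mem u huT) (H.isTree.le_par u huT)
  have huF : u ∉ F := fun h3 => hcu u huT (hFu u h3).2 rfl
  have huC : u ∈ T.children (T.par u) := Cotree.mem_children.2 ⟨huT, rfl⟩
  have hyC : y ∉ (T.children (T.par u)).erase u := fun h3 =>
    hyT y (hins y (Cotree.mem_children.1 (Finset.mem_of_mem_erase h3)).1) rfl
  have hch := H.card_children_le (p := u)
  have hs1 := hsum.1
  have hs2 := hsub.1
  have hs3 := hsump.1
  have hs4 := D.sum.1
  have hs5 := subm_lt (b := u) hs3
  have hu1 := H.lt_next u D.mem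
  have hmem : ∀ p ∈ insert (n + 2) T'.nodes, p ≠ y → p ∈ insert (n + 2) T.nodes := by
    intro p hp hpy
    rw [Finset.mem_insert, S.nodes] at hp
    rw [Finset.mem_insert]
    tauto
  simp [splitUp, a0, a1, a2, a3, a4, a5, a6, a7, a8, a9, hy₁, hy₂, hpu.symm]
  refine ⟨by omega, by omega, by omega, by omega, by omega, T', S, ?_, by simp [h2], ?_, ?_⟩
  · exact ⟨by simp [h2, hyT _ (Finset.mem_insert_self _ _)],
      fun c hc => by simp [h2, hyT _ (hins c hc)]⟩
  · have hrF : n + 2 ∉ F := fun h3 => H.isTree.root_notMem (hFu _ h3).1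
    have hnF : n + 3 ∉ F := fun h3 => H.null_notMem (hFu _ h3).1
    have hny' : n + 2 ≠ y ∧ n + 3 ≠ y := by omega
    have hru : n + 2 ≠ u := fun h3 => H.isTree.root_notMem (h3 ▸ huT)
    have hnu : n + 3 ≠ u := fun h3 => H.null_notMem (h3 ▸ huT)
    have hFin : (T.children u \ (T.children u \ F)) = F := Finset.sdiff_sdiff_eq_self D.subset
    exact
    { isTree := S.isTree H.isTree
      num := by simp [hA.1 0 (by omega) (by simp), H.num]
      one := by simp [a4]
      mod := by simp [a5]
      root := by simp [hA.1 3 (by omega) (by simp), H.root]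
      zero := by simp [hA.1 14 (by omega) (by simp), H.zero]
      par := by simp [h1]
      ty := by simp [h2, a6]
      par_root := by simp [h1, hny', hru, hpar, hrF, H.par_root]
      par_null := by simp [h1, hny', hnu, hpar, hnF, H.par_null]
      null_notMem := by
        rw [S.nodes]
        exact fun h3 => h3.elim hny'.2 H.null_notMem
      lt_next := fun c hc => by
        simp [hy₂]
        by_cases hcy : c = y
        · omega
        · have := H.lt_next c (hmem c hc hcy)
          omega
      null_lt_next := by
        simp [hy₂]
        omega
      deg := fun p hp hrp => by
        by_cases hpy : p = y
        · subst hpy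
          simp [S.children_top H.isTree, hFin, Finset.card_insert_of_notMem huF]
        by_cases hpu : p = u
        · subst hpu
          simp [S.children_bot H.isTree, huy]
          omega
        · have hp' := hmem p hp hpy
          simp only [State.setReg_arr, State.setArr_arr, Nat.reduceEqDiff,
            if_true, if_false, Function.update_of_ne hpy, Function.update_of_ne hpu, a7,
            S.children_of_ne H.isTree hpu hpy, H.deg p hp' hrp]
          split_ifs with h3
          · obtain ⟨-, rfl⟩ := h3
            rw [Finset.card_insert_of_notMem hyC, Finset.card_erase_add_one huC]
          · rfl
      sum := fun p hp hrp => by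
        by_cases hpy : p = y
        · subst hpy
          simpa [S.children_top H.isTree, hFin] using D.sum.add (by omega) huF
        by_cases hpu' : p = u
        · subst hpu'
          simpa [S.children_bot H.isTree, huy] using hsub
        · have hp' := hmem p hp hpy
          simp only [State.setReg_arr, State.setArr_arr, Nat.reduceEqDiff,
            if_true, if_false, Function.update_of_ne hpy, Function.update_of_ne hpu', a8,
            S.children_of_ne H.isTree hpu' hpy]
          split_ifs with h3
          · obtain ⟨-, rfl⟩ := h3
            rw [Function.update_self]
            exact (hsump.sub (by omega) huC).add (by omega) hyC
          · rw [Function.update_of_ne fun h4 => h3 ⟨huT, h4.symm⟩]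
            exact H.sum p hp' hrp
      deg_null := by simp [hny', hnu, a7, H.deg_null]
      count := by simp [hA.2 7 (by simp), H.count] }
  · have hA' : Agree [rSplit, rNext, rNode] [aPar, aType, aDeg, aSum] s s₁ :=
      hA.mono (by simp) (by simp)
    repeat first | exact hA' | refine Agree.setReg (by simp) ?_ | refine Agree.setArr (by simp) ?_

end WordRAM

namespace Cotree

variable {T : Cotree} {r : ℕ} {P : ℕ → Prop} {L : ℕ} {Q : ℕ → ℕ} {len p : ℕ}

/-! ### Locating the lowest mixed node -/

/-- After the sweep, the full internal nodes are those all of whose children have been counted. -/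
theorem Sweep.count_eq_iff_full (S : T.Sweep r P L Q len len) (h : T.IsTree r)
    (hr : T.par r ∉ insert r T.nodes) (hp : p ∈ insert r T.nodes) (hrp : r ≤ p) :
    T.count Q len p = (T.children p).card ↔ T.Full P p := by
  rw [S.count_eq_iff hr le_rfl hp]
  constructor
  · intro h1 v hv
    obtain ⟨c, hc, hcp, hvc⟩ := h.cover p hp hrp v hv
    exact ((S.mem_iff h).1 (h1 c (mem_children.2 ⟨hc, hcp⟩))).2 v hvc
  · intro h1 c hc
    obtain ⟨hcN, rfl⟩ := mem_children.1 hc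
    exact (S.mem_iff h).2 ⟨Finset.mem_insert_of_mem hcN,
      fun v hv => h1 v ((h.desc_ssubset c hcN).subset hv)⟩

theorem Sweep.mem_nodes (S : T.Sweep r P L Q len len) (h : T.IsTree r) (hroot : ¬ T.Full P r)
    {j : ℕ} (hj : j < len) : Q j ∈ T.nodes ∧ T.Full P (Q j) := by
  obtain ⟨h1, h2⟩ := (S.mem_iff h).1 ⟨j, hj, rfl⟩
  refine ⟨(Finset.mem_insert.1 h1).resolve_left fun h3 => hroot (h3 ▸ h2), h2⟩

theorem Sweep.marked (S : T.Sweep r P L Q len len) (h : T.IsTree r)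
    (hr : T.par r ∉ insert r T.nodes) (hroot : ¬ T.Full P r) {j : ℕ} (hj : j < len)
    (hne : T.count Q len (T.par (Q j)) ≠ (T.children (T.par (Q j))).card) :
    T.Marked r P (T.par (Q j)) := by
  obtain ⟨h1, h2⟩ := S.mem_nodes h hroot hj
  exact ⟨h.par_mem _ h1,
    mt (S.count_eq_iff_full h hr (h.par_mem _ h1) (h.le_par _ h1)).2 hne, _, h1, rfl, h2⟩

theorem Sweep.exists_of_marked (S : T.Sweep r P L Q len len) (h : T.IsTree r)
    (hr : T.par r ∉ insert r T.nodes) (hp : T.Marked r P p) :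
    ∃ j < len, T.par (Q j) = p ∧ T.count Q len p ≠ (T.children p).card := by
  obtain ⟨h1, h2, c, hc, rfl, hf⟩ := hp
  obtain ⟨j, hj, rfl⟩ := (S.mem_iff h).2 ⟨Finset.mem_insert_of_mem hc, hf⟩
  exact ⟨j, hj, rfl, mt (S.count_eq_iff_full h hr h1 (h.le_par _ hc)).1 h2⟩

end Cotree

namespace WordRAM

theorem Heap.congr {n : ℕ} {T : Cotree} {s s' : State} {R A : List ℕ} (H : Heap n T s)
    (h : Agree R A s s') (hR : ∀ r ∈ R, r ∉ [rNum, rOne, rMod, rRoot, rNext, rZero])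
    (hA : ∀ a ∈ A, a ∉ [aPar, aType, aDeg, aSum]) (hcount : ∀ p, s'.arr aCount p = 0) :
    Heap n T s' := by
  have hr : ∀ r < 20, r ∈ [rNum, rOne, rMod, rRoot, rNext, rZero] → s'.reg r = s.reg r :=
    fun r h1 h2 => h.1 r h1 fun h3 => hR r h3 h2
  have ha : ∀ a ∈ [aPar, aType, aDeg, aSum], s'.arr a = s.arr a :=
    fun a h1 => h.2 a fun h3 => hA a h3 h1
  have hnext : s'.reg rNext = s.reg rNext := hr 4 (by omega) (by simp)
  have hdeg : s'.arr aDeg = s.arr aDeg := ha 5 (by simp)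
  have hsum : s'.arr aSum = s.arr aSum := ha 6 (by simp)
  exact
  { H with
    num := (hr 0 (by omega) (by simp)).trans H.num
    one := (hr 1 (by omega) (by simp)).trans H.one
    mod := (hr 2 (by omega) (by simp)).trans H.mod
    root := (hr 3 (by omega) (by simp)).trans H.root
    zero := (hr 14 (by omega) (by simp)).trans H.zero
    par := (ha 3 (by simp)).trans H.par
    ty := (ha 4 (by simp)).trans H.ty
    lt_next := hnext ▸ H.lt_next
    null_lt_next := hnext ▸ H.null_lt_next
    deg := hdeg ▸ H.deg
    sum := hsum ▸ H.sum
    deg_null := hdeg ▸ H.deg_null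
    count := hcount }

theorem Heap.par_root_notMem {n : ℕ} {T : Cotree} {s : State} (H : Heap n T s) :
    T.par (n + 2) ∉ insert (n + 2) T.nodes := by
  rw [H.par_root, Finset.mem_insert, not_or]
  exact ⟨by omega, H.null_notMem⟩

/-- Find the lowest mixed node for the vertex `rVertex`, whose neighbours are the `rLen` leaves in
the queue, together with the number and the sum of its full children. The lowest mixed node is the
only marked node that is neither a parent nor a grandparent of a marked node. -/
def locate : Program := .seq sweep (.seq (forQueue flagBody) (.seq (forQueue findBody)
  (.seq (.block [load rFull aCount rLow, const rSum 0]) (.seq (forQueue sumBody)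
    (.seq (forQueue resetBody) (.block [load rX aType rLow, sub rType rOne rX]))))))

/-- The number of steps of `locate` when `L` leaves are given. -/
def locateCost (L : ℕ) : ℕ :=
  (1 + (2 * L * (sweepBody.cost + 1) + 1)) + ((2 * L * (flagBody.cost + 2) + 2) +
    ((2 * L * (findBody.cost + 2) + 2) + (2 + ((2 * L * (sumBody.cost + 2) + 2) +
      ((2 * L * (resetBody.cost + 2) + 2) + 2)))))

open Cotree in
theorem locate_spec {w n x L : ℕ} {E : ℕ → ℕ → Prop} {T : Cotree} {s : State} (H : Heap n T s)
    (h : T.Represents (n + 2) E) (hT : T.Alternates (n + 2)) (hE : PathFree E)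
    (hsymm : ∀ u v, E u v → E v u) (hroot : T.Mixed (E x) (n + 2)) (hlen : s.reg rLen = L)
    (S : T.Sweep (n + 2) (E x) L (s.arr aQueue) 0 L) (hflag : ∀ p, s.arr aFlag p ≠ s.reg rStamp)
    (hnext : s.reg rNext ≤ 3 * n + 4) (hL : L ≤ n) (hw : 6 * n + 8 ≤ w) :
    HaltsWithin w locate s (locateCost L) fun s' => ∃ len u F, len ≤ 2 * L ∧
      T.IsLowestMixed (n + 2) (E x) u ∧ Heap n T s' ∧ Located n len u F T s' ∧
      (∀ c ∈ T.children u, c ∈ F ↔ T.Full (E x) c) ∧ s'.reg rType = 1 - T.ty u ∧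
      (∀ p, s'.arr aFlag p = s.arr aFlag p ∨ s'.arr aFlag p = s.reg rStamp) ∧
      Agree [rLen, rLow, rFull, rSum, rType] [aCount, aQueue, aFlag] s s' := by
  have hr := H.par_root_notMem
  obtain ⟨u, hu⟩ := h.exists_isLowestMixed hT hE hsymm hroot
  have huT := hu.mem
  have hru := hu.root_le h.toIsTree
  refine HaltsWithin.seq ((sweep_spec h.toIsTree hr H.par H.deg (by rw [H.par_root, H.deg_null])
    H.count H.one hlen S (by omega)).mono le_rfl ?_)
  rintro s₁ ⟨len, hlen₁, S₁, hcount₁, hA₁⟩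
  have hlenL := S₁.len_le h.toIsTree hr
  have one₁ : s₁.reg rOne = 1 := (hA₁.1 1 (by omega) (by simp)).trans H.one
  have par₁ : s₁.arr aPar = T.par := (hA₁.2 3 (by simp)).trans H.par
  have deg₁ : s₁.arr aDeg = s.arr aDeg := hA₁.2 5 (by simp)
  have stamp₁ : s₁.reg rStamp = s.reg rStamp := hA₁.1 12 (by omega) (by simp)
  have flag₁ : s₁.arr aFlag = s.arr aFlag := hA₁.2 9 (by simp)
  set Q := s₁.arr aQueue with hQ
  have hinc : ∀ s', Agree [] [aFlag] s₁ s' → ∀ j < len, (Incomplete s' j ↔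
      T.count Q len (T.par (Q j)) ≠ (T.children (T.par (Q j))).card) := by
    intro s' hA j hj
    have e1 : s'.arr aQueue = Q := hA.2 8 (by simp)
    have e2 : s'.arr aPar = T.par := (hA.2 3 (by simp)).trans par₁
    have e3 : s'.arr aDeg = s.arr aDeg := (hA.2 5 (by simp)).trans deg₁
    have e4 : s'.arr aCount = s₁.arr aCount := hA.2 7 (by simp)
    have hm := (S₁.mem_nodes h.toIsTree hroot.1 hj).1
    rw [Incomplete, e1, e2, e3, e4, hcount₁, H.deg _ (h.par_mem _ hm) (h.le_par _ hm)]
  refine HaltsWithin.seq ((flag_spec hlen₁ one₁ (by omega)).mono (by gcongr) ?_)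
  rintro s₂ ⟨h2, h2', hA₂⟩
  have e₂ : s₂.arr aQueue = Q := hA₂.2 8 (by simp)
  have par₂ : s₂.arr aPar = T.par := (hA₂.2 3 (by simp)).trans par₁
  have stamp₂ : s₂.reg rStamp = s.reg rStamp := (hA₂.1 12 (by omega) (by simp)).trans stamp₁
  have hflag₂ : ∀ p, s₂.arr aFlag p = s.reg rStamp ↔ ∃ p', T.Marked (n + 2) (E x) p' ∧
      (p = T.par p' ∨ p = T.par (T.par p')) := by
    intro p
    rw [← stamp₁, h2' p (by rw [flag₁, stamp₁]; exact hflag p), par₁]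
    constructor
    · rintro ⟨j, hj, hj1, hj2⟩
      exact ⟨_, S₁.marked h.toIsTree hr hroot.1 hj ((hinc s₁ Agree.refl j hj).1 hj1), hj2⟩
    · rintro ⟨p', hp', hp2⟩
      obtain ⟨j, hj, rfl, hj2⟩ := S₁.exists_of_marked h.toIsTree hr hp'
      exact ⟨j, hj, (hinc s₁ Agree.refl j hj).2 hj2, hp2⟩
  have hnull : ∀ p, p ∉ T.nodes → p ∈ insert (n + 2) T.nodes → T.par p ≠ u ∧
      T.par (T.par p) ≠ u := by
    intro p hp hp'
    obtain rfl := (Finset.mem_insert.1 hp').resolve_right hp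
    rw [H.par_root, H.par_null, and_self]
    rintro rfl
    exact (Finset.mem_insert.1 huT).elim (by omega) H.null_notMem
  have hunflagged : s₂.arr aFlag u ≠ s.reg rStamp := by
    rw [Ne, hflag₂]
    rintro ⟨p, hp, hp'⟩
    by_cases hpT : p ∈ T.nodes
    · have h3 := hp.par_ne hu h.toIsTree hpT
      rcases hp' with h4 | h4
      · exact h3.1 h4.symm
      · by_cases h5 : T.par p ∈ T.nodes
        · exact h3.2 h5 h4.symm
        · exact (hnull _ h5 (h.par_mem p hpT)).1 h4.symm
    · have := hnull p hpT hp.1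
      rcases hp' with h4 | h4
      · exact this.1 h4.symm
      · exact this.2 h4.symm
  refine HaltsWithin.seq ((find_spec (u := u) ((hA₂.1 6 (by omega) (by simp)).trans hlen₁)
    ((hA₂.1 1 (by omega) (by simp)).trans one₁) (by omega) ?_ ?_).mono (by gcongr) ?_)
  · obtain ⟨j, hj, hj1, hj2⟩ := S₁.exists_of_marked h.toIsTree hr (hu.marked h.toIsTree)
    refine ⟨j, hj, (hinc s₂ hA₂ j hj).2 (by rwa [hj1]), ?_⟩
    rwa [par₂, e₂, hj1, stamp₂]
  · intro j hj hj1 hj2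
    rw [par₂, e₂] at hj2 ⊢
    have hm := S₁.marked h.toIsTree hr hroot.1 hj ((hinc s₂ hA₂ j hj).1 hj1)
    rcases hm.eq_or_exists hu h hT hE hsymm with h3 | ⟨p', -, hp', hp2⟩
    · exact h3
    · rw [stamp₂, Ne, hflag₂] at hj2
      exact absurd ⟨p', hp', hp2.imp (fun h4 => h4.symm) fun h4 => h4.2.symm⟩ hj2
  rintro s₃ ⟨low₃, hA₃⟩
  refine HaltsWithin.seq ((HaltsWithin.of_wp (Q := fun s' => s' =
    (s₃.setReg rFull (T.count Q len u)).setReg rSum 0) ?_).mono le_rfl ?_)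
  · have : s₃.arr aCount = s₁.arr aCount := (hA₃.2 7 (by simp)).trans (hA₂.2 7 (by simp))
    simp [low₃, this, hcount₁]
  rintro s₄ rfl
  have hinj : ∀ j < len, ∀ k < len, Q j = Q k → j = k := S₁.inj
  have e₃ : s₃.arr aQueue = Q := (hA₃.2 8 (by simp)).trans e₂
  have par₃ : s₃.arr aPar = T.par := (hA₃.2 3 (by simp)).trans par₂
  have len₃ : s₃.reg rLen = len :=
    (hA₃.1 6 (by omega) (by simp)).trans ((hA₂.1 6 (by omega) (by simp)).trans hlen₁)
  have one₃ : s₃.reg rOne = 1 :=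
    (hA₃.1 1 (by omega) (by simp)).trans ((hA₂.1 1 (by omega) (by simp)).trans one₁)
  have mod₃ : s₃.reg rMod = 3 * n + 4 := (hA₃.1 2 (by omega) (by simp)).trans
    ((hA₂.1 2 (by omega) (by simp)).trans ((hA₁.1 2 (by omega) (by simp)).trans H.mod))
  have zero₃ : s₃.reg rZero = 0 := (hA₃.1 14 (by omega) (by simp)).trans
    ((hA₂.1 14 (by omega) (by simp)).trans ((hA₁.1 14 (by omega) (by simp)).trans H.zero))
  refine HaltsWithin.seq ((sum_spec (K := 3 * n + 4) (len := len) (by simp [len₃]) (by simp [one₃])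
    (by omega) (by simp [mod₃]) (by omega) (by omega) (by simp) (fun j hj => ?_)
    (by simpa [e₃] using hinj)).mono (by gcongr) ?_)
  · have := H.lt_next _ (S₁.mem hj)
    simp only [State.setReg_arr, e₃]
    omega
  rintro s₅ ⟨hsum₅, hA₅⟩
  simp only [State.setReg_arr, e₃, par₃, State.setReg_reg, Nat.reduceEqDiff, if_false,
    low₃] at hsum₅
  have e₅ : s₅.arr = s₃.arr := funext fun a => hA₅.2 a (by simp)
  have low₅ : s₅.reg rLow = u := (hA₅.1 7 (by omega) (by simp)).trans (by simp [low₃])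
  have full₅ : s₅.reg rFull = T.count Q len u := (hA₅.1 8 (by omega) (by simp)).trans (by simp)
  have len₅ : s₅.reg rLen = len := (hA₅.1 6 (by omega) (by simp)).trans (by simp [len₃])
  have one₅ : s₅.reg rOne = 1 := (hA₅.1 1 (by omega) (by simp)).trans (by simp [one₃])
  refine HaltsWithin.seq ((reset_spec len₅ one₅ (by omega)
    ((hA₅.1 14 (by omega) (by simp)).trans (by simp [zero₃])) ?_).mono (by gcongr) ?_)
  · intro p hp
    rw [e₅, (hA₃.2 7 (by simp)).trans (hA₂.2 7 (by simp)), hcount₁, count, ← Nat.pos_iff_ne_zero,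
      Finset.card_pos] at hp
    obtain ⟨j, hj⟩ := hp
    rw [Finset.mem_filter, Finset.mem_range] at hj
    exact ⟨j, hj.1, by rw [e₅, par₃, e₃, hj.2]⟩
  rintro s₆ ⟨hcount₆, hA₆⟩
  have hA : Agree [rLen, rLow, rFull, rSum, rType] [aCount, aQueue, aFlag] s s₆ := by
    refine (hA₁.mono (by simp) (by simp)).trans ((hA₂.mono (by simp) (by simp)).trans
      ((hA₃.mono (by simp) (by simp)).trans (Agree.trans ?_ ((hA₅.mono (by simp) (by simp)).trans
        (hA₆.mono (by simp) (by simp))))))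
    exact (Agree.refl.setReg (by simp)).setReg (by simp)
  have e₆ : s₆.arr aQueue = Q := (hA₆.2 8 (by simp)).trans (by rw [e₅, e₃])
  have low₆ : s₆.reg rLow = u := (hA₆.1 7 (by omega) (by simp)).trans low₅
  have ty₆ : s₆.arr aType = T.ty := (hA.2 4 (by simp)).trans H.ty
  have one₆ : s₆.reg rOne = 1 := (hA₆.1 1 (by omega) (by simp)).trans one₅
  have him := S₁.image_subset hr le_rfl huT
  refine HaltsWithin.of_wp (P := .block [load rX aType rLow, sub rType rOne rX]) ?_
  simp [low₆, ty₆, one₆]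
  refine ⟨len, hlenL, u, hu, ?_, {j ∈ Finset.range len | T.par (Q j) = u}.image Q,
    ⟨?_, ?_, ?_, huT, hru, fun c => ?_, him.1, ?_, ?_⟩, ?_, rfl, ?_, ?_⟩
  · refine H.congr ((hA.setReg (r := rX) (by simp)).setReg (r := rType) (by simp)) (by simp)
      (by simp) ?_
    simpa using hcount₆
  · simp [(hA₆.1 6 (by omega) (by simp)).trans len₅]
  · simpa [e₆] using hinj
  · simp [low₆]
  · simp only [State.setReg_arr, e₆, Finset.mem_image, Finset.mem_filter, Finset.mem_range]
    constructor
    · rintro ⟨j, ⟨h3, h4⟩, rfl⟩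
      exact ⟨⟨j, h3, rfl⟩, h4⟩
    · rintro ⟨⟨j, h3, rfl⟩, h4⟩
      exact ⟨j, ⟨h3, h4⟩, rfl⟩
  · simp [him.2, (hA₆.1 8 (by omega) (by simp)).trans full₅]
  · have : s₆.reg rSum = s₅.reg rSum := hA₆.1 9 (by omega) (by simp)
    simpa [this] using hsum₅
  · intro c hc hcu
    have h3 := S₁.mem_iff h.toIsTree (c := c)
    simp only [Finset.mem_image, Finset.mem_filter, Finset.mem_range]
    constructor
    · rintro ⟨j, ⟨h4, -⟩, rfl⟩
      exact (h3.1 ⟨j, h4, rfl⟩).2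
    · intro h4
      obtain ⟨j, hj, rfl⟩ := h3.2 ⟨Finset.mem_insert_of_mem hc, h4⟩
      exact ⟨j, ⟨hj, hcu⟩, rfl⟩
  · intro p
    have h3 : s₆.arr aFlag = s₂.arr aFlag :=
      (hA₆.2 9 (by simp)).trans ((congrFun e₅ 9).trans (hA₃.2 9 (by simp)))
    rw [h3]
    simpa [flag₁, stamp₁] using h2 p
  · exact (hA.setReg (by simp)).setReg (by simp)

/-! ### Placing a new vertex -/

theorem Program.wp_seq {w : ℕ} {P P' : Program} {s : State} {Q Q' : State → Prop}
    (h : P.wp w Q s) (h' : ∀ s', Q s' → P'.wp w Q' s') : Program.wp w (.seq P P') Q' s :=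
  Program.wp_mono (P := P) h h'

theorem HaltsWithin.seq_wp {w c : ℕ} {P P' : Program} {s : State} {Q : State → Prop}
    (h : P.wp w (fun s' => HaltsWithin w P' s' c Q) s) :
    HaltsWithin w (.seq P P') s (P.cost + c) Q :=
  HaltsWithin.seq (HaltsWithin.of_wp h)

/-- The child `rNode` of the lowest mixed node is the only one of the wrong status: place the vertex
`rVertex` next to it or below it. -/
def single : Program := .ite (.lt rNode rRoot) pair attach

/-- Place the vertex `rVertex` in the tree, after the lowest mixed node has been located. -/
def place : Program :=
  .ite (.eq rType rOne)
    (.ite (.eq rFull rOne) (.seq (move rNode rSum) single)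
      (.seq startSplit (.seq splitDown pair)))
    (.seq (.block [add rX rFull rOne, load rY aDeg rLow])
      (.ite (.eq rX rY) (.seq (.block [load rX aSum rLow, subMod rNode rX rSum]) single)
        (.seq startSplit (.seq splitUp pair))))

/-- The tree in the memory has got the new leaf `x`, and at most two new internal nodes. -/
def Inserted (n x : ℕ) (E : ℕ → ℕ → Prop) (T : Cotree) (s s' : State) : Prop :=
  ∃ T', Heap n T' s' ∧ T'.Represents (n + 2) E ∧ T'.Alternates (n + 2) ∧
    T'.desc (n + 2) = insert x (T.desc (n + 2)) ∧ s'.reg rNext ≤ s.reg rNext + 2 ∧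
    Agree [rSplit, rNext, rNode] [aPar, aType, aDeg, aSum] s s'

section

variable {w n x len u q : ℕ} {E : ℕ → ℕ → Prop} {F : Finset ℕ} {T : Cotree} {s : State}

theorem single_spec (H : Heap n T s) (h : T.Represents (n + 2) E) (hT : T.Alternates (n + 2))
    (hE : PathFree E) (hsymm : ∀ u v, E u v → E v u) (hu : T.IsLowestMixed (n + 2) (E x) u)
    (hx : s.reg rVertex = x) (hxn : x < n) (hxT : x ∉ T.nodes) (hq : s.reg rNode = q)
    (hqT : q ∈ T.nodes) (hqu : T.par q = u) (hty : s.reg rType = 1 - T.ty u)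
    (hnext : s.reg rNext < 3 * n + 4) (hw : 6 * n + 8 ≤ w)
    (hbad : ∀ v ∈ T.desc q, (E x v ↔ T.ty u ≠ 1))
    (hgood : ∀ c ∈ T.nodes, T.par c = u → c ≠ q → ∀ v ∈ T.desc c, (E x v ↔ T.ty u = 1)) :
    single.wp w (Inserted n x E T s) s := by
  refine ⟨fun hlt => ?_, fun hlt => ?_⟩ <;> simp only [Test.Holds, hq, H.root] at hlt
  · refine Program.wp_mono (pair_spec H hx hq rfl hxn hxT hqT hnext hw) ?_
    rintro s' ⟨T', A, h1, h2, H', h3, hA⟩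
    obtain ⟨h4, h5⟩ := A.insertion hu h hT hE hsymm h1 (h2.trans hty) hqu hlt hbad hgood
    exact ⟨T', H', h4, h5, A.desc_root h.toIsTree, by omega, hA.mono (by simp) (by simp)⟩
  · have hrq : n + 2 < q := lt_of_le_of_ne (by omega) (h.ne_root hqT).symm
    refine Program.wp_mono (attach_spec H hx hq hxn hxT (Finset.mem_insert_of_mem hqT) hrq.le
      hnext.le hw) ?_
    rintro s' ⟨T', A, h1, H', hA⟩
    obtain ⟨h4, h5⟩ := A.insertion hu h hT hE hsymm h1 hqT hqu hrq hbad hgood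
    have h3 : s'.reg rNext = s.reg rNext := hA.1 4 (by omega) (by simp)
    exact ⟨T', H', h4, h5, A.desc_root h.toIsTree, by omega, hA.mono (by simp) (by simp)⟩

/-- The number of steps of `place` when the queue holds `len` nodes. -/
def placeCost (len : ℕ) : ℕ :=
  (Program.cost (.seq (move rNode rSum) single) + ((2 + (len * (moveBody.cost + 2) + 2)) +
    Program.cost (.seq splitDown pair)) + 1) +
  (Program.cost (.block [add rX rFull rOne, load rY aDeg rLow]) +
    (Program.cost (.seq (.block [load rX aSum rLow, subMod rNode rX rSum]) single) +
      ((2 + (len * (moveBody.cost + 2) + 2)) + Program.cost (.seq splitUp pair)) + 1)) + 1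

/-- The second half of placing a vertex at a node that had to be split: it is paired with the lower
one of the two nodes. -/
theorem split_insertion {T₁ : Cotree} {s₁ : State} {y top bot : ℕ} {B : Finset ℕ}
    (H₁ : Heap n T₁ s₁)
    (h : T.Represents (n + 2) E) (hT : T.Alternates (n + 2)) (hE : PathFree E)
    (hsymm : ∀ u v, E u v → E v u) (hu : T.IsLowestMixed (n + 2) (E x) u)
    (hx : s₁.reg rVertex = x) (hxn : x < n) (hxT : x ∉ T.nodes) (hny : n < y)
    (S : T.Split T₁ (n + 2) u y top bot B) (hty₁ : ∀ c ∈ insert (n + 2) T.nodes, T₁.ty c = T.ty c)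
    (hy : T₁.ty y = T.ty u) (hbot : s₁.reg rNode = bot) (hnext : s₁.reg rNext = y + 1)
    (hy' : s.reg rNext = y) (hyn : y + 1 < 3 * n + 4)
    (hty : s₁.reg rType = 1 - T.ty u) (hw : 6 * n + 8 ≤ w)
    (hA : Agree [rSplit, rNext, rNode] [aPar, aType, aDeg, aSum] s s₁)
    (hbad : ∀ c ∈ B, ∀ v ∈ T.desc c, (E x v ↔ T.ty u ≠ 1))
    (hgood : ∀ c ∈ T.nodes, T.par c = u → c ∉ B → ∀ v ∈ T.desc c, (E x v ↔ T.ty u = 1)) :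
    pair.wp w (Inserted n x E T s) s₁ := by
  refine Program.wp_mono (pair_spec H₁ hx hbot hnext hxn ?_ S.bot_mem.1 (by omega) hw) ?_
  · rw [S.nodes, not_or]
    exact ⟨by omega, hxT⟩
  · rintro s' ⟨T', A, h1, h2, H', h3, hA'⟩
    obtain ⟨h4, h5⟩ := S.insertion hu h hT hE hsymm A hty₁ hy h1 (h2.trans hty) hbad hgood
    refine ⟨T', H', h4, h5, ?_, by omega, hA.trans (hA'.mono (by simp) (by simp))⟩
    rw [A.desc_root (S.isTree h.toIsTree), S.desc_root h.toIsTree]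

theorem Inserted.of_agree {s₁ s' : State} (h : Inserted n x E T s₁ s')
    (hA : Agree [rSplit, rNext, rNode] [aPar, aType, aDeg, aSum] s s₁)
    (hnext : s₁.reg rNext = s.reg rNext) : Inserted n x E T s s' := by
  obtain ⟨T', h1, h2, h3, h4, h5, h6⟩ := h
  exact ⟨T', h1, h2, h3, h4, hnext ▸ h5, hA.trans h6⟩

/-- The four cases of the surgery at the lowest mixed node: the children of the wrong status are the
full ones for a union node and the other ones for a join node, and there is one or there are several
of them. -/
theorem place_spec (H : Heap n T s) (h : T.Represents (n + 2) E) (hT : T.Alternates (n + 2))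
    (hE : PathFree E) (hsymm : ∀ u v, E u v → E v u) (hu : T.IsLowestMixed (n + 2) (E x) u)
    (D : Located n len u F T s) (hF : ∀ c ∈ T.children u, c ∈ F ↔ T.Full (E x) c)
    (hx : s.reg rVertex = x) (hxn : x < n) (hxT : x ∉ T.nodes)
    (hty : s.reg rType = 1 - T.ty u)
    (hnext : s.reg rNext + 1 < 3 * n + 4) (hlen : len ≤ w) (hw : 6 * n + 8 ≤ w) :
    HaltsWithin w place s (placeCost len) (Inserted n x E T s) := by
  have htu := hT.ty_le_one h.toIsTree hu.mem (hu.root_le h.toIsTree)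
  have hny := H.null_lt_next
  have hlt := fun c (hc : c ∈ T.nodes) => H.lt_next c (Finset.mem_insert_of_mem hc)
  have hfull : F.Nonempty := by
    obtain ⟨c, hc, hcu, hcf⟩ := hu.exists_full h.toIsTree
    exact ⟨c, (hF c (Cotree.mem_children.2 ⟨hc, hcu⟩)).2 hcf⟩
  have hvoid : ∀ c ∈ T.nodes, T.par c = u → c ∉ F → ∀ v ∈ T.desc c, ¬ E x v :=
    fun c hc hcu hcF => (hu.full_or_void h.toIsTree hc hcu).resolve_left
      (mt (hF c (Cotree.mem_children.2 ⟨hc, hcu⟩)).2 hcF)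
  have hfull' : ∀ c ∈ F, c ∈ T.nodes ∧ T.par c = u ∧ ∀ v ∈ T.desc c, E x v := fun c hc => by
    have h1 := Cotree.mem_children.1 (D.subset hc)
    exact ⟨h1.1, h1.2, (hF c (D.subset hc)).1 hc⟩
  have hrest : ∃ c ∈ T.children u, c ∉ F := by
    obtain ⟨c, hc, hcu, hcv⟩ := hu.exists_void h.toIsTree
    exact ⟨c, Cotree.mem_children.2 ⟨hc, hcu⟩,
      fun h1 => h.toIsTree.not_full_and_void hc (hfull' c h1).2.2 hcv⟩
  have hcard := Finset.card_sdiff_add_card_eq_card D.subset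
  have hrest' : 0 < (T.children u \ F).card := by
    obtain ⟨c, hc, hcF⟩ := hrest
    exact Finset.card_pos.2 ⟨c, Finset.mem_sdiff.2 ⟨hc, hcF⟩⟩
  have hdeg := H.deg u hu.mem (hu.root_le h.toIsTree)
  have hch := H.card_children_le (p := u)
  have hsum := H.sum u hu.mem (hu.root_le h.toIsTree)
  have hsub := hsum.sdiff D.sum D.subset
  unfold place placeCost
  refine HaltsWithin.ite (fun h1 => HaltsWithin.ite (fun h2 => ?_) fun h2 => ?_) fun h1 => ?_
  · -- a union node with exactly one full child
    simp only [Test.Holds, hty, H.one, D.card] at h1 h2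
    obtain ⟨q, hq⟩ := Finset.card_eq_one.1 h2
    have hqF : q ∈ F := by simp [hq]
    obtain ⟨h3, h4, h5⟩ := hfull' q hqF
    have h6 : s.reg rSum = q := (hq ▸ D.sum).eq_of_singleton (by
      have := hlt q h3
      omega)
    refine HaltsWithin.of_wp (P := .seq (move rNode rSum) single)
      (Program.wp_seq (Q := fun s' => s' = s.setReg rNode q) (by simp [h6]) ?_)
    rintro s₁ rfl
    refine Program.wp_mono (single_spec (q := q) (u := u) (T := T) (x := x) (E := E)
        (H.congr (Agree.refl.setReg (R := [rNode]) (A := []) (by simp)) (by simp) (by simp)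
          (by simpa using H.count)) h hT hE hsymm hu (by simp [hx]) hxn hxT (by simp) h3 h4
        (by simp [hty]) (by simp; omega) hw
        (fun v hv => iff_of_true (h5 v hv) (by omega))
        (fun c hc hcu hcq v hv => iff_of_false (hvoid c hc hcu (by simpa [hq] using hcq) v hv)
          (by omega))) fun s' hs' => hs'.of_agree (Agree.refl.setReg (by simp)) (by simp)
  · -- a union node with at least two full children
    simp only [Test.Holds, hty, H.one, D.card] at h1 h2
    have hF2 : 2 ≤ F.card := by
      have := Finset.card_pos.2 hfull
      omega
    refine HaltsWithin.seq ((startSplit_spec H D rfl (by omega) hlen hw).mono le_rfl ?_)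
    rintro s₁ ⟨k1, k2, k3, k4⟩
    refine HaltsWithin.of_wp (P := .seq splitDown pair) (Program.wp_seq
      (splitDown_spec H D rfl (by omega) hw hF2 hrest k1 k2 k3 k4) ?_)
    rintro s₂ ⟨T₁, S, m1, m2, H₁, m3, m4, m5⟩
    exact split_insertion H₁ h hT hE hsymm hu ((m5.1 5 (by omega) (by simp)).trans hx) hxn hxT
      (by omega) S m1 m2 m3 m4 rfl hnext ((m5.1 13 (by omega) (by simp)).trans hty) hw m5
      (fun c hc v hv => iff_of_true ((hfull' c hc).2.2 v hv) (by omega))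
      (fun c hc hcu hcF v hv => iff_of_false (hvoid c hc hcu hcF v hv) (by omega))
  · simp only [Test.Holds, hty, H.one] at h1
    have hty1 : T.ty u = 1 := by omega
    have huT : u ∈ T.nodes := (Finset.mem_insert.1 hu.mem).resolve_left (by
      rintro rfl
      rw [hT.ty_root] at hty1
      omega)
    have hbad : ∀ c ∈ T.children u \ F, c ∈ T.nodes ∧ T.par c = u ∧ ∀ v ∈ T.desc c, ¬ E x v := by
      intro c hc
      obtain ⟨h3, h4⟩ := Finset.mem_sdiff.1 hc
      obtain ⟨h5, h6⟩ := Cotree.mem_children.1 h3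
      exact ⟨h5, h6, hvoid c h5 h6 h4⟩
    have hgood : ∀ c ∈ T.nodes, T.par c = u → c ∉ T.children u \ F → c ∈ F := by
      intro c hc hcu hcB
      by_contra h3
      exact hcB (Finset.mem_sdiff.2 ⟨Cotree.mem_children.2 ⟨hc, hcu⟩, h3⟩)
    refine HaltsWithin.seq_wp (Program.wp_mono (Q := fun s' => s' =
      (s.setReg rX (F.card + 1)).setReg rY (T.children u).card) ?_ ?_)
    · simp [D.card, H.one, D.low, hdeg]
      omega
    rintro s₁ rfl
    have hA₁ : Agree [] [] s ((s.setReg rX (F.card + 1)).setReg rY (T.children u).card) :=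
      (Agree.refl.setReg (by simp)).setReg (by simp)
    refine HaltsWithin.ite (fun h2 => ?_) fun h2 => ?_
    · -- a join node with exactly one child that is not full
      simp only [Test.Holds, State.setReg_reg, Nat.reduceEqDiff, if_true, if_false] at h2
      obtain ⟨q, hq⟩ := Finset.card_eq_one.1 (by omega : (T.children u \ F).card = 1)
      obtain ⟨h3, h4, h5⟩ := hbad q (by simp [hq])
      have h6 : subm (3 * n + 4) (s.arr aSum u) (s.reg rSum) = q :=
        (hq ▸ hsub).eq_of_singleton (by
          have := hlt q h3
          omega)
      have hsl := hsum.1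
      refine HaltsWithin.of_wp (P := .seq (.block [load rX aSum rLow, subMod rNode rX rSum]) single)
        (Program.wp_seq (Q := fun s' => s' = (((s.setReg rX (F.card + 1)).setReg rY
          (T.children u).card).setReg rX (s.arr aSum u)).setReg rNode q) ?_ ?_)
      · simp [D.low, H.mod, h6]
        omega
      rintro s₂ rfl
      have hA₂ := (hA₁.mono (R' := [rNode]) (A' := []) (by simp) (by simp)).setReg (r := rX)
        (v := s.arr aSum u) (by simp)
      have hA₃ := hA₂.setReg (r := rNode) (v := q) (by simp)
      refine Program.wp_mono (single_spec (q := q) (u := u) (T := T) (x := x) (E := E)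
        (H.congr hA₃ (by simp) (by simp) (by simpa using H.count)) h hT hE hsymm hu (by simp [hx])
        hxn hxT (by simp) h3 h4 (by simp [hty]) (by simp; omega) hw
        (fun v hv => iff_of_false (h5 v hv) (by omega))
        (fun c hc hcu hcq v hv => iff_of_true
          ((hfull' c (hgood c hc hcu (by simpa [hq] using hcq))).2.2 v hv) hty1)) fun s' hs' =>
          hs'.of_agree (hA₃.mono (by simp) (by simp)) (by simp)
    · -- a join node with at least two children that are not full
      simp only [Test.Holds, State.setReg_reg, Nat.reduceEqDiff, if_true, if_false] at h2
      have H₁ : Heap n T ((s.setReg rX (F.card + 1)).setReg rY (T.children u).card) :=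
        H.congr hA₁ (by simp) (by simp) (by simpa using H.count)
      have D₁ : Located n len u F T ((s.setReg rX (F.card + 1)).setReg rY (T.children u).card) :=
        ⟨by simp [D.len_eq], by simpa using D.inj, by simp [D.low], D.mem, D.root_le,
          by simpa using D.full_iff, D.subset, by simp [D.card], by simpa using D.sum⟩
      refine HaltsWithin.seq ((startSplit_spec H₁ D₁ (y := s.reg rNext) (by simp) (by omega) hlen
        hw).mono le_rfl ?_)
      rintro s₁ ⟨k1, k2, k3, k4⟩
      refine HaltsWithin.of_wp (P := .seq splitUp pair) (Program.wp_seq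
        (splitUp_spec H₁ D₁ (y := s.reg rNext) (by simp) (by omega) hw huT hfull (by omega) k1 k2
          k3 k4) ?_)
      rintro s₂ ⟨T₁, S, m1, m2, H₂, m3, m4, m5⟩
      exact split_insertion H₂ h hT hE hsymm hu ((m5.1 5 (by omega) (by simp)).trans (by simp [hx]))
        hxn hxT (by omega) S m1 m2 m3 m4 rfl hnext
        ((m5.1 13 (by omega) (by simp)).trans (by simp [hty])) hw
        ((hA₁.mono (by simp) (by simp)).trans m5)
        (fun c hc v hv => iff_of_false ((hbad c hc).2.2 v hv) (by omega))
        (fun c hc hcu hcB v hv => iff_of_true ((hfull' c (hgood c hc hcu hcB)).2.2 v hv) hty1)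

end

end WordRAM

namespace Cotree

/-! ### Building the cotree -/

/-- The start of a sweep: the queue holds the leaves that satisfy `P`. -/
theorem Sweep.start {T : Cotree} {r L : ℕ} {P : ℕ → Prop} {Q : ℕ → ℕ} (h : T.IsTree r)
    (inj : ∀ j < L, ∀ k < L, Q j = Q k → j = k)
    (hQ : ∀ v, (∃ j < L, Q j = v) ↔ v ∈ T.desc r ∧ P v) : T.Sweep r P L Q 0 L := by
  refine ⟨inj, by omega, le_rfl, fun j hj => ?_, fun j hj hj' => by omega,
    fun v hv hvr hP => (hQ v).2 ⟨(h.leaf_iff v hvr).1 hv, hP⟩, fun p hp hrp hc => ?_⟩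
  · obtain ⟨h1, h2⟩ := (hQ _).1 ⟨j, hj, rfl⟩
    have h3 := h.lt_root _ h1
    exact ⟨(h.leaf_iff _ h3).2 h1, h3, h2⟩
  · obtain ⟨c, hc'⟩ := Finset.card_pos.1 (by
      have := h.two_le_card_children hp hrp
      omega : 0 < (T.children p).card)
    obtain ⟨k, hk, -⟩ := hc c hc'
    omega

end Cotree

namespace WordRAM

/-- The graph `E` on `0, …, n - 1` is stored as adjacency lists, of lengths `d`. -/
structure Adjacency (n : ℕ) (E : ℕ → ℕ → Prop) (d : ℕ → ℕ) (s : State) : Prop where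
  start : ∀ x ≤ n, s.arr aStart x = ∑ i ∈ Finset.range x, d i
  inj : ∀ x < n, ∀ j < d x, ∀ k < d x, s.arr aList (∑ i ∈ Finset.range x, d i + j) =
    s.arr aList (∑ i ∈ Finset.range x, d i + k) → j = k
  mem : ∀ x < n, ∀ y, (∃ j < d x, s.arr aList (∑ i ∈ Finset.range x, d i + j) = y) ↔ E x y

/-- The invariant of the construction of the cotree: the memory holds a cotree of the graph induced
by the vertices below `x` and two additional isolated vertices `n` and `n + 1`. -/
structure Built (n x : ℕ) (E : ℕ → ℕ → Prop) (T : Cotree) (s₀ s : State) : Prop where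
  heap : Heap n T s
  represents : T.Represents (n + 2) E
  alternates : T.Alternates (n + 2)
  desc : T.desc (n + 2) = Finset.range x ∪ {n, n + 1}
  next : s.reg rNext ≤ n + 4 + 2 * x
  flag : ∀ p, s.arr aFlag p ≤ x
  agree : ∀ a, a ∉ [aPar, aType, aDeg, aSum, aCount, aQueue, aFlag] → s.arr a = s₀.arr a

/-- Insert the vertex `rVertex` into the cotree. -/
def insertVertex : Program := .seq (add rStamp rVertex rOne) (.seq collect
  (.ite (.eq rLen rZero) (.seq (move rNode rRoot) attach) (.seq locate place)))

/-- The number of steps needed to insert a vertex of degree `d`. -/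
def insertCost (d : ℕ) : ℕ :=
  1 + ((4 + (d * (collectBody.cost + 1) + 1)) + (Program.cost (.seq (move rNode rRoot) attach) +
    (locateCost d + placeCost (2 * d)) + 1))

theorem insertVertex_spec {w n x : ℕ} {E : ℕ → ℕ → Prop} {d : ℕ → ℕ} {T : Cotree} {s₀ s : State}
    (B : Built n x E T s₀ s) (hadj : Adjacency n E d s₀) (hx : s.reg rVertex = x) (hxn : x < n)
    (hE : PathFree E) (hsymm : ∀ u v, E u v → E v u) (hEn : ∀ u v, E u v → v < n)
    (hd : ∑ i ∈ Finset.range n, d i ≤ w) (hw : 6 * n + 8 ≤ w) :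
    HaltsWithin w insertVertex s (insertCost (d x)) fun s' =>
      (∃ T', Built n (x + 1) E T' s₀ s') ∧ s'.reg rVertex = x := by
  have H := B.heap
  have h := B.represents
  have e0 : s.arr aStart = s₀.arr aStart := B.agree 0 (by simp)
  have e1 : s.arr aList = s₀.arr aList := B.agree 1 (by simp)
  have hsum : ∑ i ∈ Finset.range x, d i + d x ≤ w := by
    rw [← Finset.sum_range_succ]
    exact (Finset.sum_le_sum_of_subset (Finset.range_mono hxn)).trans hd
  have hnext := B.next
  have hxT : x ∉ T.nodes := by
    rw [h.leaf_iff x (by omega), B.desc]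
    simp
    omega
  refine HaltsWithin.seq_wp (P := add rStamp rVertex rOne) ⟨?_, ?_⟩
  · simp [hx, H.one]
    omega
  have hA₁ : Agree [rStamp] [] s (Instr.apply s (.add rStamp rVertex rOne)) :=
    Agree.refl.setReg (by simp)
  have stamp₁ : (Instr.apply s (.add rStamp rVertex rOne)).reg rStamp = x + 1 := by simp [hx, H.one]
  generalize Instr.apply s (.add rStamp rVertex rOne) = s₁ at hA₁ stamp₁ ⊢
  have hx₁ : s₁.reg rVertex = x := (hA₁.1 5 (by omega) (by simp)).trans hx
  have one₁ : s₁.reg rOne = 1 := (hA₁.1 1 (by omega) (by simp)).trans H.one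
  have start₁ : s₁.arr aStart = s₀.arr aStart := (hA₁.2 0 (by simp)).trans e0
  have list₁ : s₁.arr aList = s₀.arr aList := (hA₁.2 1 (by simp)).trans e1
  refine HaltsWithin.seq ((collect_spec hx₁ one₁ (by rw [start₁, hadj.start x hxn.le])
    (by rw [start₁, hadj.start (x + 1) hxn, Finset.sum_range_succ]) hsum (by omega)
    (by rw [list₁]; exact hadj.inj x hxn)).mono le_rfl ?_)
  rintro s₂ ⟨len, hlen, len₂, inj₂, mem₂, hA₂⟩
  have hA : Agree [rStamp, rLen] [aQueue] s s₂ :=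
    (hA₁.mono (by simp) (by simp)).trans (hA₂.mono (by simp) (by simp))
  have H₂ : Heap n T s₂ := H.congr hA (by simp) (by simp) (by rw [hA.2 7 (by simp)]; exact H.count)
  have mem₂' : ∀ v, (∃ j < len, s₂.arr aQueue j = v) ↔ v ∈ T.desc (n + 2) ∧ E x v := by
    intro v
    rw [mem₂, list₁, hadj.mem x hxn, B.desc, and_comm]
    simp only [Finset.mem_union, Finset.mem_range, Finset.mem_insert, Finset.mem_singleton]
    constructor
    · exact fun h1 => ⟨.inl h1.1, h1.2⟩
    · rintro ⟨h1, h2⟩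
      have := hEn x v h2
      exact ⟨h1.resolve_right (by omega), h2⟩
  have hx₂ : s₂.reg rVertex = x := (hA.1 5 (by omega) (by simp)).trans hx
  have next₂ : s₂.reg rNext = s.reg rNext := hA.1 4 (by omega) (by simp)
  have stamp₂ : s₂.reg rStamp = x + 1 := (hA₂.1 12 (by omega) (by simp)).trans stamp₁
  have flag₂ : s₂.arr aFlag = s.arr aFlag := hA.2 9 (by simp)
  have hlen' : len ≤ n := by
    have h1 : (Finset.range len).image (s₂.arr aQueue) ⊆ Finset.range n := by
      intro v hv
      obtain ⟨j, hj, rfl⟩ := Finset.mem_image.1 hv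
      have := ((mem₂ _).1 ⟨j, Finset.mem_range.1 hj, rfl⟩).2
      exact Finset.mem_range.2 (by omega)
    have h2 := Finset.card_le_card h1
    rw [Finset.card_image_of_injOn fun j hj k hk hjk => inj₂ j (by simpa using hj) k
      (by simpa using hk) hjk] at h2
    simpa using h2
  have hrange : insert x (Finset.range x ∪ {n, n + 1}) = Finset.range (x + 1) ∪ {n, n + 1} := by
    rw [Finset.range_add_one, Finset.insert_union]
  refine HaltsWithin.ite (fun h1 => ?_) fun h1 => ?_ <;>
    simp only [Test.Holds, len₂, H₂.zero] at h1
  · -- no neighbours: the vertex becomes a child of the root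
    refine HaltsWithin.of_wp (P := .seq (move rNode rRoot) attach)
      (Program.wp_seq (Q := fun s' => s' = s₂.setReg rNode (n + 2)) (by simp [H₂.root]) ?_)
    rintro s₃ rfl
    have hA₃ : Agree [rNode] [] s₂ (s₂.setReg rNode (n + 2)) := Agree.refl.setReg (by simp)
    refine Program.wp_mono (attach_spec (q := n + 2) (x := x) (H₂.congr hA₃ (by simp) (by simp)
      (by simpa using H₂.count)) (by simp [hx₂]) (by simp) hxn hxT (Finset.mem_insert_self _ _)
      le_rfl (by simp; omega) hw) ?_
    rintro s₄ ⟨T', A, h2, H', hA₄⟩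
    obtain ⟨h3, h4⟩ := A.insertion_root h2 h B.alternates hsymm fun v hv hxv => by
      obtain ⟨j, hj, -⟩ := (mem₂' v).2 ⟨hv, hxv⟩
      omega
    have hA' : Agree [rStamp, rLen, rNode] [aQueue, aPar, aDeg, aSum] s s₄ :=
      (hA.mono (by simp) (by simp)).trans ((hA₃.mono (by simp) (by simp)).trans
        (hA₄.mono (by simp) (by simp)))
    refine ⟨⟨T', H', h3, h4, by rw [A.desc_root h.toIsTree, B.desc, hrange], ?_, fun p => ?_,
      fun a ha => ?_⟩, (hA'.1 5 (by omega) (by simp)).trans hx⟩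
    · rw [hA'.1 4 (by omega) (by simp)]
      omega
    · rw [hA'.2 9 (by simp)]
      have := B.flag p
      omega
    · rw [hA'.2 a, B.agree a ha]
      simp at ha ⊢
      tauto
  · have hroot : T.Mixed (E x) (n + 2) := by
      refine ⟨fun h2 => ?_, fun h2 => ?_⟩
      · have h3 := h2 n (by rw [B.desc]; simp)
        exact (hEn x n h3).false
      · obtain ⟨h3, h4⟩ := (mem₂' _).1 ⟨0, by omega, rfl⟩
        exact h2 _ h3 h4
    refine (HaltsWithin.seq ((locate_spec H₂ h B.alternates hE hsymm hroot len₂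
      (Cotree.Sweep.start h.toIsTree inj₂ mem₂') (fun p => ?_) (by omega) hlen' hw).mono
        (c' := locateCost (d x)) ?_ ?_)).mono (c := locateCost (d x) + placeCost (2 * d x)) le_rfl
          fun _ => id
    · rw [flag₂, stamp₂]
      have := B.flag p
      omega
    · unfold locateCost
      gcongr
    rintro s₃ ⟨len', u, F, hlen₃, hu, H₃, D, hF, hty, hflag, hA₃⟩
    have next₃ : s₃.reg rNext = s₂.reg rNext := hA₃.1 4 (by omega) (by simp)
    refine (place_spec H₃ h B.alternates hE hsymm hu D hF
      ((hA₃.1 5 (by omega) (by simp)).trans hx₂) hxn hxT hty (by omega) (by omega) hw).mono ?_ ?_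
    · unfold placeCost
      have : len' ≤ 2 * d x := by omega
      gcongr
    rintro s₄ ⟨T', H', h3, h4, h5, h6, hA₄⟩
    have hA' : Agree [rLow, rFull, rSum, rType, rStamp, rLen, rSplit, rNext, rNode]
        [aCount, aQueue, aFlag, aPar, aType, aDeg, aSum] s s₄ :=
      (hA.mono (by simp) (by simp)).trans ((hA₃.mono (by simp) (by simp)).trans
        (hA₄.mono (by simp) (by simp)))
    refine ⟨⟨T', H', h3, h4, by rw [h5, B.desc, hrange], by omega, fun p => ?_,
      fun a ha => ?_⟩, (hA'.1 5 (by omega) (by simp)).trans hx⟩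
    · rw [hA₄.2 9 (by simp)]
      have h7 := B.flag p
      rcases hflag p with h8 | h8
      · rw [h8, flag₂]
        omega
      · rw [h8, stamp₂]
    · rw [hA'.2 a, B.agree a ha]
      simp at ha ⊢
      tauto

/-- Set up the cotree of the two additional vertices. -/
def buildStart : Program := .block [
  const rOne 1, add rY rNum rOne, add rRoot rY rOne, add rZ rRoot rOne, add rNext rZ rOne,
  add rX rNum rNum, add rMod rX rNext, store aPar rNum rRoot, store aPar rY rRoot,
  store aPar rRoot rZ, store aPar rZ rZ, const rC 2, store aDeg rRoot rC, add rX rNum rY,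
  store aSum rRoot rX]

/-- The initial cotree has the additional vertices as its only leaves. -/
theorem exists_initial_cotree (n : ℕ) (E : ℕ → ℕ → Prop) (hE : ∀ u v, E u v → v < n)
    (f : ℕ → ℕ) (h1 : f n = n + 2) (h2 : f (n + 1) = n + 2) :
    ∃ T : Cotree, T.par = f ∧ T.ty = (fun _ => 0) ∧ T.nodes = {n, n + 1} ∧
      T.desc (n + 2) = {n, n + 1} ∧ T.Represents (n + 2) E ∧ T.Alternates (n + 2) := by
  refine ⟨{ nodes := {n, n + 1}, par := f, ty := fun _ => 0,
            desc := fun c => if c = n + 2 then {n, n + 1} else {c} }, rfl, rfl, rfl, by simp,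
    ⟨⟨?_, ?_, ?_, ?_, ?_, ?_, ?_, ?_, ?_, ?_⟩, ?_⟩, ⟨rfl, by simp, ?_⟩⟩
  · simp
  · simp
  · intro v hv hvn
    simp [hvn.ne]
  · simp
  · simp [h1, h2]
  · simp [h1, h2]
  · intro a ha
    simp at ha
    rcases ha with rfl | rfl <;> simp [h1, h2, Finset.ssubset_iff_of_subset]
  · intro a ha
    dsimp only
    split_ifs <;> simp
  · intro a ha b hb hab
    simp at ha hb
    rcases ha with rfl | rfl <;> rcases hb with rfl | rfl <;> simp at hab ⊢
  · intro p hp hrp v hv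
    have : p = n + 2 := by
      simp at hp
      omega
    subst this
    simp at hv
    rcases hv with hv | hv
    · exact ⟨n, by simp, h1, by simp [hv]⟩
    · exact ⟨n + 1, by simp, h2, by simp [hv]⟩
  · intro a ha b hb hab _ u hu v hv
    simp at ha hb
    have : v = n ∨ v = n + 1 := by
      rcases hb with rfl | rfl <;> simp at hv <;> simp [hv]
    simp
    intro h3
    have := hE u v h3
    omega
  · intro a ha hra
    simp at ha
    omega

theorem buildStart_spec {w n : ℕ} {E : ℕ → ℕ → Prop} {s : State} (hE : ∀ u v, E u v → v < n)
    (hnum : s.reg rNum = n) (hreg : ∀ r ≠ 0, s.reg r = 0)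
    (harr : ∀ a, 2 < a → ∀ i, s.arr a i = 0) (hw : 6 * n + 8 ≤ w) :
    buildStart.wp w (fun s' => (∃ T, Built n 0 E T s s') ∧ s'.reg rVertex = 0) s := by
  obtain ⟨T, h1, h2, h3, h4, h5, h6⟩ := exists_initial_cotree n E hE
    (Function.update (Function.update (Function.update (Function.update (s.arr aPar) n (n + 2))
      (n + 1) (n + 2)) (n + 2) (n + 3)) (n + 3) (n + 3)) (by simp) (by simp)
  have hch : T.children (n + 2) = {n, n + 1} := by
    ext c
    rw [Cotree.mem_children, h1, h3]
    simp only [Finset.mem_insert, Finset.mem_singleton]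
    constructor
    · exact fun h => h.1
    · rintro (rfl | rfl) <;> simp
  have hroot : ∀ p ∈ insert (n + 2) T.nodes, n + 2 ≤ p → p = n + 2 := by
    intro p hp hrp
    rw [h3] at hp
    simp at hp
    omega
  have hsum : IsSumMod (3 * n + 4) (n + (n + 1)) {n, n + 1} :=
    ⟨by omega, by simp⟩
  simp [buildStart, hnum]
  refine ⟨by omega, by omega, by omega, by omega, by omega, by omega, by omega, by omega,
    by omega, ?_⟩
  simp only [add_assoc, Nat.reduceAdd]
  refine ⟨⟨T, ⟨h5.toIsTree, by simp [hnum], by simp, ?_, by simp, by simp [hreg], by simp [h1], ?_,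
    by simp [h1], by simp [h1], by simp [h3], ?_, by simp, ?_, ?_, by simp [harr],
    by simp [harr]⟩, h5, h6, by simp [h4], by simp, by simp [harr], ?_⟩, by simp [hreg]⟩
  · simp
    omega
  · rw [h2]
    funext i
    simp [harr]
  · intro c hc
    rw [h3] at hc
    simp at hc ⊢
    omega
  · intro p hp hrp
    rw [hroot p hp hrp, hch]
    simp
  · intro p hp hrp
    rw [hroot p hp hrp, hch]
    simpa using hsum
  · intro a ha
    simp at ha
    simp [ha]

/-- Build a cotree of the input graph with two additional isolated vertices. -/
def build : Program := .seq buildStart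
  (.while (.lt rVertex rNum) (.seq insertVertex (add rVertex rVertex rOne)))

/-- The number of steps of `build` for a graph with the degrees `d`. -/
def buildCost (n : ℕ) (d : ℕ → ℕ) : ℕ :=
  buildStart.cost + (∑ x ∈ Finset.range n, (insertCost (d x) + 1 + 1) + 1)

theorem build_spec {w n : ℕ} {E : ℕ → ℕ → Prop} {d : ℕ → ℕ} {s : State}
    (hadj : Adjacency n E d s) (hE : PathFree E) (hsymm : ∀ u v, E u v → E v u)
    (hEn : ∀ u v, E u v → v < n) (hnum : s.reg rNum = n) (hreg : ∀ r ≠ 0, s.reg r = 0)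
    (harr : ∀ a, 2 < a → ∀ i, s.arr a i = 0) (hd : ∑ i ∈ Finset.range n, d i ≤ w)
    (hw : 6 * n + 8 ≤ w) :
    HaltsWithin w build s (buildCost n d) fun s' => ∃ T, Built n n E T s s' := by
  refine HaltsWithin.seq_wp
    (Program.wp_mono (buildStart_spec hEn hnum hreg harr hw) fun s₁ h₁ => ?_)
  refine HaltsWithin.while (fun x s' => x ≤ n ∧ (∃ T, Built n x E T s s') ∧ s'.reg rVertex = x)
    (fun x => insertCost (d x) + 1) n ?_ ?_ ⟨by omega, h₁⟩
  · rintro x s' ⟨hxn, ⟨T, B⟩, hx⟩ hlt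
    simp only [Test.Holds, hx, B.heap.num] at hlt
    refine ⟨hlt, HaltsWithin.seq ((insertVertex_spec B hadj hx hlt hE hsymm hEn hd hw).mono
      le_rfl ?_)⟩
    rintro s'' ⟨⟨T', B'⟩, hx'⟩
    refine HaltsWithin.of_wp (P := add rVertex rVertex rOne) ?_
    have hA : Agree [rVertex] [] s'' (s''.setReg rVertex (x + 1)) := Agree.refl.setReg (by simp)
    simp only [Program.wp, Instr.Safe, Instr.apply, Instr.value, hx', B'.heap.one]
    exact ⟨by omega, hlt, ⟨T', B'.heap.congr hA (by simp) (by simp) (by simpa using B'.heap.count),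
      B'.represents, B'.alternates, B'.desc, by simpa using B'.next, by simpa using B'.flag,
      by simpa using B'.agree⟩, by simp⟩
  · rintro x s' ⟨hxn, ⟨T, B⟩, hx⟩ hlt
    simp only [Test.Holds, hx, B.heap.num] at hlt
    obtain rfl : x = n := by omega
    exact ⟨T, B⟩

theorem buildCost_le (n : ℕ) (d : ℕ → ℕ) : buildCost n d ≤
    (insertCost 0 + 2 + insertCost 1) *
      (n + ∑ x ∈ Finset.range n, d x) + (buildStart.cost + 1) := by
  have h1 : ∀ d, insertCost d ≤ insertCost 0 + insertCost 1 * d := by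
    intro d
    simp only [insertCost, locateCost, placeCost]
    generalize collectBody.cost = c1
    nlinarith
  have h2 : ∑ x ∈ Finset.range n, (insertCost (d x) + 1 + 1) ≤
      n * (insertCost 0 + 2) + insertCost 1 * ∑ x ∈ Finset.range n, d x := by
    rw [Finset.mul_sum]
    calc _ ≤ ∑ x ∈ Finset.range n, (insertCost 0 + 2 + insertCost 1 * d x) :=
          Finset.sum_le_sum fun x _ => by
            have := h1 (d x)
            omega
      _ = _ := by simp [Finset.sum_add_distrib]
  unfold buildCost
  generalize ∑ x ∈ Finset.range n, d x = m at *
  have h3 := Nat.zero_le (insertCost 1 * n)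
  have h4 := Nat.zero_le ((insertCost 0 + 2) * m)
  nlinarith

end WordRAM

/-! ### Codes of a module: the dynamic program -/

/-- What has to be remembered about a set `S` of vertices of a module `M`: whether some vertex of
`M` is missed by all of `S`, whether some vertex of `M` is covered by all of `S`, and whether `S` is
empty. -/
abbrev Status := Bool × Bool × Bool

namespace Status

/-- Exchange the roles of missed and covered vertices. -/
def swap (σ : Status) : Status := (σ.2.1, σ.1, σ.2.2)

/-- The status of the union of two sets in the disjoint union of two modules, unless a vertex of the
one module is not separated from a vertex of the other one. -/
def union (σ τ : Status) : Option Status :=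
  if σ.1 && τ.1 then none
  else some (σ.1 || τ.1, (σ.2.1 && τ.2.2) || (τ.2.1 && σ.2.2), σ.2.2 && τ.2.2)

/-- The same for the join of two modules, if `t` holds. -/
def merge (t : Bool) (σ τ : Status) : Option Status :=
  if t then (union σ.swap τ.swap).map swap else union σ τ

end Status

section

variable (R : ℕ → ℕ → Prop)

/-- Any two vertices of `M` are separated by `S`. -/
def Separates (S M : Finset ℕ) : Prop :=
  ∀ u ∈ M, ∀ v ∈ M, u ≠ v → ∃ x ∈ S, ¬ (R x u ↔ R x v)

open Classical in
/-- The status of the set `S` in the module `M`. -/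
noncomputable def status (S M : Finset ℕ) : Status :=
  (decide (∃ v ∈ M, ∀ x ∈ S, ¬ R x v), decide (∃ v ∈ M, ∀ x ∈ S, R x v), decide (S = ∅))

/-- `S` is a separating subset of the module `M` and has the status `σ`. -/
structure Feasible (M : Finset ℕ) (σ : Status) (S : Finset ℕ) : Prop where
  subset : S ⊆ M
  separates : Separates R S M
  status_eq : status R S M = σ

/-- `S` is a smallest separating subset of the module `M` with the status `σ`. -/
structure Optimal (M : Finset ℕ) (σ : Status) (S : Finset ℕ) : Prop where
  feasible : Feasible R M σ S
  le : ∀ S', Feasible R M σ S' → S.card ≤ S'.card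

/-- The number `k` stands for the smallest size of a separating subset of `M` with the status `σ`:
it is larger than this size by one, or `0` if there is no such set. -/
def IsValue (M : Finset ℕ) (σ : Status) (k : ℕ) : Prop :=
  (k = 0 ∧ ∀ S, ¬ Feasible R M σ S) ∨ ∃ S, Optimal R M σ S ∧ k = S.card + 1

end

variable {R : ℕ → ℕ → Prop} {M M₁ M₂ S S₁ S₂ : Finset ℕ} {σ : Status}

theorem separates_not : Separates (fun x v => ¬ R x v) S M ↔ Separates R S M := by
  simp only [Separates, not_iff_not]

theorem status_not : status (fun x v => ¬ R x v) S M = (status R S M).swap := by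
  simp [status, Status.swap]

theorem feasible_not : Feasible (fun x v => ¬ R x v) M σ.swap S ↔ Feasible R M σ S := by
  have : σ.swap.swap = σ := rfl
  constructor
  · rintro ⟨h1, h2, h3⟩
    rw [separates_not] at h2
    rw [status_not] at h3
    exact ⟨h1, h2, by rw [← this, ← h3]; rfl⟩
  · rintro ⟨h1, h2, h3⟩
    exact ⟨h1, separates_not.2 h2, by rw [status_not, h3]⟩

/-- The case of a disjoint union: a vertex of `M₁` and a vertex of `M₂` fail to be separated exactly
if both are missed, since nothing in `S₁ ∪ S₂` covers both of them. -/
theorem feasible_union_of_not (hM : Disjoint M₁ M₂) (hS₁ : S₁ ⊆ M₁) (hS₂ : S₂ ⊆ M₂)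
    (hcross : ∀ u ∈ M₁, ∀ v ∈ M₂, ¬ R u v ∧ ¬ R v u) :
    Feasible R (M₁ ∪ M₂) σ (S₁ ∪ S₂) ↔ ∃ σ₁ σ₂, Feasible R M₁ σ₁ S₁ ∧ Feasible R M₂ σ₂ S₂ ∧
      Status.union σ₁ σ₂ = some σ := by
  have h₁ : ∀ v ∈ M₁, ∀ x ∈ S₂, ¬ R x v := fun v hv x hx => (hcross v hv x (hS₂ hx)).2
  have h₂ : ∀ v ∈ M₂, ∀ x ∈ S₁, ¬ R x v := fun v hv x hx => (hcross x (hS₁ hx) v hv).1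
  have hmiss : (∃ v ∈ M₁ ∪ M₂, ∀ x ∈ S₁ ∪ S₂, ¬ R x v) ↔
      (∃ v ∈ M₁, ∀ x ∈ S₁, ¬ R x v) ∨ ∃ v ∈ M₂, ∀ x ∈ S₂, ¬ R x v := by
    simp only [Finset.mem_union]
    constructor
    · rintro ⟨v, hv | hv, h⟩
      · exact .inl ⟨v, hv, fun x hx => h x (.inl hx)⟩
      · exact .inr ⟨v, hv, fun x hx => h x (.inr hx)⟩
    · rintro (⟨v, hv, h⟩ | ⟨v, hv, h⟩)
      · exact ⟨v, .inl hv, fun x hx => hx.elim (h x) (h₁ v hv x)⟩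
      · exact ⟨v, .inr hv, fun x hx => hx.elim (h₂ v hv x) (h x)⟩
  have hcov : (∃ v ∈ M₁ ∪ M₂, ∀ x ∈ S₁ ∪ S₂, R x v) ↔
      ((∃ v ∈ M₁, ∀ x ∈ S₁, R x v) ∧ S₂ = ∅) ∨ ((∃ v ∈ M₂, ∀ x ∈ S₂, R x v) ∧ S₁ = ∅) := by
    simp only [Finset.mem_union]
    constructor
    · rintro ⟨v, hv | hv, h⟩
      · exact .inl ⟨⟨v, hv, fun x hx => h x (.inl hx)⟩,
          Finset.eq_empty_of_forall_notMem fun x hx => h₁ v hv x hx (h x (.inr hx))⟩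
      · exact .inr ⟨⟨v, hv, fun x hx => h x (.inr hx)⟩,
          Finset.eq_empty_of_forall_notMem fun x hx => h₂ v hv x hx (h x (.inl hx))⟩
    · rintro (⟨⟨v, hv, h⟩, rfl⟩ | ⟨⟨v, hv, h⟩, rfl⟩)
      · exact ⟨v, .inl hv, fun x hx => h x (by simpa using hx)⟩
      · exact ⟨v, .inr hv, fun x hx => h x (by simpa using hx)⟩
  have hsep : Separates R (S₁ ∪ S₂) (M₁ ∪ M₂) ↔ Separates R S₁ M₁ ∧ Separates R S₂ M₂ ∧
      ¬ ((∃ v ∈ M₁, ∀ x ∈ S₁, ¬ R x v) ∧ ∃ v ∈ M₂, ∀ x ∈ S₂, ¬ R x v) := by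
    constructor
    · intro h
      refine ⟨fun u hu v hv huv => ?_, fun u hu v hv huv => ?_, ?_⟩
      · obtain ⟨x, hx, hx'⟩ := h u (Finset.mem_union_left _ hu) v (Finset.mem_union_left _ hv) huv
        refine ⟨x, (Finset.mem_union.1 hx).resolve_right fun hx2 => hx' ?_, hx'⟩
        exact iff_of_false (h₁ u hu x hx2) (h₁ v hv x hx2)
      · obtain ⟨x, hx, hx'⟩ :=
          h u (Finset.mem_union_right _ hu) v (Finset.mem_union_right _ hv) huv
        refine ⟨x, (Finset.mem_union.1 hx).resolve_left fun hx2 => hx' ?_, hx'⟩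
        exact iff_of_false (h₂ u hu x hx2) (h₂ v hv x hx2)
      · rintro ⟨⟨u, hu, hu'⟩, v, hv, hv'⟩
        obtain ⟨x, hx, hx'⟩ := h u (Finset.mem_union_left _ hu) v (Finset.mem_union_right _ hv)
          fun huv => Finset.disjoint_left.1 hM hu (huv ▸ hv)
        rcases Finset.mem_union.1 hx with hx | hx
        · exact hx' (iff_of_false (hu' x hx) (h₂ v hv x hx))
        · exact hx' (iff_of_false (h₁ u hu x hx) (hv' x hx))
    · rintro ⟨k1, k2, k3⟩
      have key : ∀ u ∈ M₁, ∀ v ∈ M₂, ∃ x ∈ S₁ ∪ S₂, ¬ (R x u ↔ R x v) := by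
        intro u hu v hv
        by_contra! h
        refine k3 ⟨⟨u, hu, fun x hx hxu => ?_⟩, v, hv, fun x hx hxv => ?_⟩
        · exact h₂ v hv x hx ((h x (Finset.mem_union_left _ hx)).1 hxu)
        · exact h₁ u hu x hx ((h x (Finset.mem_union_right _ hx)).2 hxv)
      intro u hu v hv huv
      rcases Finset.mem_union.1 hu with hu | hu <;> rcases Finset.mem_union.1 hv with hv | hv
      · obtain ⟨x, hx, hx'⟩ := k1 u hu v hv huv
        exact ⟨x, Finset.mem_union_left _ hx, hx'⟩
      · exact key u hu v hv
      · obtain ⟨x, hx, hx'⟩ := key v hv u hu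
        exact ⟨x, hx, fun h => hx' h.symm⟩
      · obtain ⟨x, hx, hx'⟩ := k2 u hu v hv huv
        exact ⟨x, Finset.mem_union_right _ hx, hx'⟩
  have hst : ¬ ((∃ v ∈ M₁, ∀ x ∈ S₁, ¬ R x v) ∧ ∃ v ∈ M₂, ∀ x ∈ S₂, ¬ R x v) →
      Status.union (status R S₁ M₁) (status R S₂ M₂) = some (status R (S₁ ∪ S₂) (M₁ ∪ M₂)) := by
    intro h
    rw [Status.union, if_neg (by simpa [status] using h)]
    refine congrArg some (Prod.ext ?_ (Prod.ext ?_ ?_)) <;>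
      rw [Bool.eq_iff_iff] <;>
        simp only [status, Bool.or_eq_true, Bool.and_eq_true, decide_eq_true_eq]
    · exact hmiss.symm
    · exact hcov.symm
    · exact Finset.union_eq_empty.symm
  constructor
  · rintro ⟨k1, k2, rfl⟩
    obtain ⟨k3, k4, k5⟩ := hsep.1 k2
    exact ⟨_, _, ⟨hS₁, k3, rfl⟩, ⟨hS₂, k4, rfl⟩, hst k5⟩
  · rintro ⟨_, _, ⟨-, k1, rfl⟩, ⟨-, k2, rfl⟩, k3⟩
    have k4 : ¬ ((∃ v ∈ M₁, ∀ x ∈ S₁, ¬ R x v) ∧ ∃ v ∈ M₂, ∀ x ∈ S₂, ¬ R x v) := by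
      intro h
      rw [Status.union, if_pos (by simpa [status] using h)] at k3
      exact absurd k3 (by simp)
    rw [hst k4, Option.some_inj] at k3
    exact ⟨Finset.union_subset_union hS₁ hS₂, hsep.2 ⟨k1, k2, k4⟩, k3⟩

/-- Separating sets of a disjoint union (or, if `t` holds, of a join) of two modules are made up of
separating sets of the modules. -/
theorem feasible_union_iff {t : Bool} (hM : Disjoint M₁ M₂) (hS₁ : S₁ ⊆ M₁) (hS₂ : S₂ ⊆ M₂)
    (hcross : ∀ u ∈ M₁, ∀ v ∈ M₂, (R u v ↔ t) ∧ (R v u ↔ t)) :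
    Feasible R (M₁ ∪ M₂) σ (S₁ ∪ S₂) ↔ ∃ σ₁ σ₂, Feasible R M₁ σ₁ S₁ ∧ Feasible R M₂ σ₂ S₂ ∧
      Status.merge t σ₁ σ₂ = some σ := by
  cases t with
  | false => exact feasible_union_of_not hM hS₁ hS₂ (by simpa using hcross)
  | true =>
    have hswap : ∀ τ : Status, τ.swap.swap = τ := fun _ => rfl
    rw [← feasible_not, feasible_union_of_not hM hS₁ hS₂ (by simpa using hcross)]
    constructor
    · rintro ⟨σ₁, σ₂, h1, h2, h3⟩
      refine ⟨σ₁.swap, σ₂.swap, feasible_not.1 h1, feasible_not.1 h2, ?_⟩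
      simp [Status.merge, hswap, h3]
    · rintro ⟨σ₁, σ₂, h1, h2, h3⟩
      refine ⟨σ₁.swap, σ₂.swap, feasible_not.2 h1, feasible_not.2 h2, ?_⟩
      simp only [Status.merge, if_true, Option.map_eq_some_iff] at h3
      obtain ⟨τ, h3, rfl⟩ := h3
      rw [h3, hswap]

theorem IsValue.eq_zero_iff {k : ℕ} (h : IsValue R M σ k) : k = 0 ↔ ∀ S, ¬ Feasible R M σ S := by
  rcases h with ⟨h1, h2⟩ | ⟨S, h1, h2⟩
  · exact iff_of_true h1 h2
  · exact iff_of_false (by omega) fun h3 => h3 S h1.feasible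

theorem IsValue.exists_optimal {k : ℕ} (h : IsValue R M σ k) (hk : k ≠ 0) :
    ∃ S, Optimal R M σ S :=
  (h.resolve_left fun h1 => hk h1.1).imp fun _ h => h.1

theorem IsValue.card_eq {k : ℕ} (h : IsValue R M σ k) (hS : Optimal R M σ S) : k = S.card + 1 := by
  rcases h with ⟨-, h2⟩ | ⟨S', h1, h2⟩
  · exact absurd hS.feasible (h2 S)
  · rw [h2, le_antisymm (h1.le S hS.feasible) (hS.le S' h1.feasible)]

theorem IsValue.le {n k : ℕ}
    (h : IsValue R M σ k) (hM : M ⊆ Finset.range n) : k ≤ n + 1 := by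
  rcases h with ⟨h, -⟩ | ⟨S, h, rfl⟩
  · omega
  · have := Finset.card_le_card (h.feasible.subset.trans hM)
    rw [Finset.card_range] at this
    omega

/-- `k` is the best value for the status `σ` that can be obtained from values `v₁` and `v₂` for the
parts, among the pairs of statuses that satisfy `p`; it is attained at `β`. -/
def IsBest (t : Bool) (p : Status → Status → Prop) (v₁ v₂ : Status → ℕ) (σ : Status) (k : ℕ)
    (β : Status × Status) : Prop :=
  (∀ σ₁ σ₂, p σ₁ σ₂ → Status.merge t σ₁ σ₂ = some σ → v₁ σ₁ ≠ 0 → v₂ σ₂ ≠ 0 →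
    k ≠ 0 ∧ k + 1 ≤ v₁ σ₁ + v₂ σ₂) ∧
  (k ≠ 0 → Status.merge t β.1 β.2 = some σ ∧ v₁ β.1 ≠ 0 ∧ v₂ β.2 ≠ 0 ∧ k + 1 = v₁ β.1 + v₂ β.2)

theorem IsBest.isValue {t : Bool} {v₁ v₂ : Status → ℕ} {k : ℕ} {β : Status × Status}
    (h : IsBest t (fun _ _ => True) v₁ v₂ σ k β) (hM : Disjoint M₁ M₂)
    (hcross : ∀ u ∈ M₁, ∀ v ∈ M₂, (R u v ↔ t) ∧ (R v u ↔ t))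
    (h₁ : ∀ σ, IsValue R M₁ σ (v₁ σ)) (h₂ : ∀ σ, IsValue R M₂ σ (v₂ σ)) :
    IsValue R (M₁ ∪ M₂) σ k ∧ (k ≠ 0 → (∃ S, Optimal R M₁ β.1 S) ∧ (∃ S, Optimal R M₂ β.2 S) ∧
      ∀ S₁ S₂, Optimal R M₁ β.1 S₁ → Optimal R M₂ β.2 S₂ →
        Optimal R (M₁ ∪ M₂) σ (S₁ ∪ S₂)) := by
  -- every feasible set costs at least `k`
  have hlow : ∀ S, Feasible R (M₁ ∪ M₂) σ S → k ≠ 0 ∧ k ≤ S.card + 1 := by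
    intro S hS
    have hSM : (S ∩ M₁) ∪ (S ∩ M₂) = S := by
      rw [← Finset.inter_union_distrib_left, Finset.inter_eq_left.2 hS.subset]
    rw [← hSM, feasible_union_iff hM Finset.inter_subset_right Finset.inter_subset_right
      hcross] at hS
    obtain ⟨σ₁, σ₂, k1, k2, k3⟩ := hS
    have n1 : v₁ σ₁ ≠ 0 := fun h0 => (h₁ σ₁).eq_zero_iff.1 h0 _ k1
    have n2 : v₂ σ₂ ≠ 0 := fun h0 => (h₂ σ₂).eq_zero_iff.1 h0 _ k2
    obtain ⟨k4, k5⟩ := h.1 σ₁ σ₂ trivial k3 n1 n2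
    obtain ⟨O₁, hO₁⟩ := (h₁ σ₁).exists_optimal n1
    obtain ⟨O₂, hO₂⟩ := (h₂ σ₂).exists_optimal n2
    have c1 := (h₁ σ₁).card_eq hO₁
    have c2 := (h₂ σ₂).card_eq hO₂
    have c3 := hO₁.le _ k1
    have c4 := hO₂.le _ k2
    have c5 : S.card = (S ∩ M₁).card + (S ∩ M₂).card := by
      rw [← Finset.card_union_of_disjoint (hM.mono Finset.inter_subset_right
        Finset.inter_subset_right), hSM]
    omega
  by_cases hk : k = 0
  · exact ⟨.inl ⟨hk, fun S hS => (hlow S hS).1 hk⟩, fun h0 => absurd hk h0⟩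
  · obtain ⟨k1, n1, n2, k2⟩ := h.2 hk
    have hopt : ∀ S₁ S₂, Optimal R M₁ β.1 S₁ → Optimal R M₂ β.2 S₂ →
        Optimal R (M₁ ∪ M₂) σ (S₁ ∪ S₂) ∧ k = (S₁ ∪ S₂).card + 1 := by
      intro S₁ S₂ hS₁ hS₂
      have c1 := (h₁ β.1).card_eq hS₁
      have c2 := (h₂ β.2).card_eq hS₂
      have c3 : (S₁ ∪ S₂).card = S₁.card + S₂.card := Finset.card_union_of_disjoint
        (hM.mono hS₁.feasible.subset hS₂.feasible.subset)
      refine ⟨⟨(feasible_union_iff hM hS₁.feasible.subset hS₂.feasible.subset hcross).2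
        ⟨_, _, hS₁.feasible, hS₂.feasible, k1⟩, fun S hS => ?_⟩, by omega⟩
      have := (hlow S hS).2
      omega
    obtain ⟨O₁, hO₁⟩ := (h₁ β.1).exists_optimal n1
    obtain ⟨O₂, hO₂⟩ := (h₂ β.2).exists_optimal n2
    exact ⟨.inr ⟨_, hopt O₁ O₂ hO₁ hO₂⟩,
      fun _ => ⟨⟨O₁, hO₁⟩, ⟨O₂, hO₂⟩, fun S₁ S₂ hS₁ hS₂ => (hopt S₁ S₂ hS₁ hS₂).1⟩⟩

/-- The values for the empty module. -/
theorem isValue_empty : IsValue R ∅ σ (if σ = (false, false, true) then 1 else 0) := by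
  have h : ∀ S, Feasible R ∅ σ S ↔ S = ∅ ∧ σ = (false, false, true) := by
    intro S
    constructor
    · rintro ⟨h1, h2, h3⟩
      obtain rfl := Finset.subset_empty.1 h1
      exact ⟨rfl, by rw [← h3]; simp [status]⟩
    · rintro ⟨rfl, rfl⟩
      exact ⟨by simp, by simp [Separates], by simp [status]⟩
  split_ifs with hσ
  · exact .inr ⟨∅, ⟨(h _).2 ⟨rfl, hσ⟩, by simp⟩, rfl⟩
  · exact .inl ⟨rfl, fun S hS => hσ ((h S).1 hS).2⟩

theorem feasible_singleton_iff {v : ℕ} {c : Bool} (hv : R v v ↔ c) :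
    Feasible R {v} σ S ↔ (S = ∅ ∧ σ = (true, true, true)) ∨ (S = {v} ∧ σ = (!c, c, false)) := by
  constructor
  · rintro ⟨h1, h2, h3⟩
    rcases Finset.subset_singleton_iff.1 h1 with rfl | rfl
    · exact .inl ⟨rfl, by rw [← h3]; simp [status]⟩
    · exact .inr ⟨rfl, by rw [← h3]; simp [status, hv]⟩
  · rintro (⟨rfl, rfl⟩ | ⟨rfl, rfl⟩)
    · exact ⟨by simp, by simp [Separates], by simp [status]⟩
    · exact ⟨by simp, by simp [Separates], by simp [status, hv]⟩

/-- The values for a single vertex, which covers itself if `c` holds. -/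
theorem isValue_singleton {v : ℕ} {c : Bool} (hv : R v v ↔ c) :
    IsValue R {v} σ
      (if σ = (true, true, true) then 1 else if σ = (!c, c, false) then 2 else 0) := by
  split_ifs with h1 h2
  · refine .inr ⟨∅, ⟨(feasible_singleton_iff hv).2 (.inl ⟨rfl, h1⟩), by simp⟩, rfl⟩
  · refine .inr ⟨{v}, ⟨(feasible_singleton_iff hv).2 (.inr ⟨rfl, h2⟩), fun S hS => ?_⟩, rfl⟩
    rcases (feasible_singleton_iff hv).1 hS with ⟨-, h3⟩ | ⟨rfl, -⟩
    · exact absurd h3 h1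
    · exact le_rfl
  · refine .inl ⟨rfl, fun S hS => ?_⟩
    rcases (feasible_singleton_iff hv).1 hS with ⟨-, h3⟩ | ⟨-, h3⟩
    · exact h1 h3
    · exact h2 h3

/-- The status of a set of at most one vertex tells whether the vertex belongs to it. -/
theorem Feasible.eq_of_singleton {v : ℕ} (h : Feasible R {v} σ S) :
    S = if σ.2.2 then ∅ else {v} := by
  classical
  rcases Finset.subset_singleton_iff.1 h.subset with rfl | rfl <;>
    rw [← h.status_eq] <;> simp [status]

/-! ### The dynamic program along a cotree -/

namespace Cotree

variable {T : Cotree} {r n len i : ℕ} {E R : ℕ → ℕ → Prop} {Q : ℕ → ℕ} {a c p : ℕ}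

/-- The first `len` entries of `Q` are the nodes of the tree, in an order in which every node comes
before its parent. -/
structure IsOrder (T : Cotree) (r : ℕ) (Q : ℕ → ℕ) (len : ℕ) : Prop where
  inj : ∀ j < len, ∀ k < len, Q j = Q k → j = k
  mem : ∀ j < len, Q j ∈ insert r T.nodes
  exists_eq : ∀ a ∈ insert r T.nodes, ∃ j < len, Q j = a
  lt : ∀ j < len, ∀ k < len, Q j ∈ T.nodes → T.par (Q j) = Q k → j < k

/-- A sweep that starts with all leaves sorts the nodes of the tree topologically. -/
theorem Sweep.isOrder {L : ℕ} {P : ℕ → Prop} (S : T.Sweep r P L Q len len) (h : T.IsTree r)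
    (hP : ∀ v, P v) : T.IsOrder r Q len := by
  refine ⟨S.inj, fun j => S.mem, fun a ha => (S.mem_iff h).2 ⟨ha, fun v _ => hP v⟩,
    fun j hj k hk hjT hjk => ?_⟩
  by_cases hkL : k < L
  · have h1 := (S.leaf k hkL).2.1
    have h2 := h.le_par _ hjT
    omega
  · obtain ⟨m, -, hmk, hm⟩ := (S.internal k (by omega) hk).2.2 (Q j) (mem_children.2 ⟨hjT, hjk⟩)
    have := S.inj m (by omega) j hj hm
    omega

/-- The vertices below the node `c`. (The leaves `n` and `n + 1` are not vertices of the graph.) -/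
def module (T : Cotree) (n c : ℕ) : Finset ℕ := {v ∈ T.desc c | v < n}

/-- The part of the module of `a` that consists of `a` itself and the modules of those children that
are among the first `i` entries of `Q`. -/
def part (T : Cotree) (n : ℕ) (Q : ℕ → ℕ) (i a : ℕ) : Finset ℕ :=
  (if a < n then {a} else ∅) ∪
    {k ∈ Finset.range i | T.par (Q k) = a}.biUnion fun k => T.module n (Q k)

theorem part_zero : T.part n Q 0 a = if a < n then {a} else ∅ := by simp [part]

theorem part_succ_par : T.part n Q (i + 1) (T.par (Q i)) =
    T.part n Q i (T.par (Q i)) ∪ T.module n (Q i) := by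
  rw [part, Finset.range_add_one, Finset.filter_insert, if_pos rfl, Finset.biUnion_insert, part,
    Finset.union_assoc, Finset.union_comm (T.module n (Q i))]

theorem part_succ_of_ne (ha : T.par (Q i) ≠ a) : T.part n Q (i + 1) a = T.part n Q i a := by
  rw [part, Finset.range_add_one, Finset.filter_insert, if_neg ha, part]

theorem part_subset_range : T.part n Q i a ⊆ Finset.range n := by
  intro v hv
  rw [part, Finset.mem_union, Finset.mem_biUnion] at hv
  rcases hv with hv | ⟨k, -, hv⟩
  · split_ifs at hv with h
    · rwa [Finset.mem_singleton.1 hv, Finset.mem_range]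
    · exact absurd hv (Finset.notMem_empty v)
  · exact Finset.mem_range.2 (Finset.mem_filter.1 hv).2

namespace IsOrder

theorem par_mem_image (O : T.IsOrder r Q len) (h : T.IsTree r) (hi : i < len) (hc : Q i ∈ T.nodes) :
    T.par (Q i) ∈ insert r ((Finset.Ico (i + 1) len).image Q) := by
  rw [Finset.mem_insert]
  refine (Finset.mem_insert.1 (h.par_mem _ hc)).imp id fun h4 => ?_
  obtain ⟨k, hk, hkp⟩ := O.exists_eq _ (Finset.mem_insert_of_mem h4)
  have := O.lt i hi k hk hc hkp.symm
  exact Finset.mem_image.2 ⟨k, Finset.mem_Ico.2 ⟨this, hk⟩, hkp⟩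

variable (O : T.IsOrder r Q len) (h : T.Represents r E) (hr : T.par r ∉ insert r T.nodes)
include O hr

theorem mem_nodes {k : ℕ} (hk : k < len) (ha : T.par (Q k) ∈ insert r T.nodes) : Q k ∈ T.nodes := by
  refine (Finset.mem_insert.1 (O.mem k hk)).resolve_left fun h1 => ?_
  rw [h1] at ha
  exact hr ha

include h

/-- All children of a node come before it, so the node is complete when its turn comes. -/
theorem part_self (hn : n + 2 = r) (hi : i < len) : T.part n Q i (Q i) = T.module n (Q i) := by
  ext v
  simp only [part, module, Finset.mem_union, Finset.mem_biUnion, Finset.mem_filter,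
    Finset.mem_range]
  by_cases hri : r ≤ Q i
  · rw [if_neg (by omega)]
    constructor
    · rintro (h1 | ⟨k, ⟨hk, hki⟩, hv, hvn⟩)
      · exact absurd h1 (Finset.notMem_empty v)
      · refine ⟨hki ▸ (h.desc_ssubset _ (O.mem_nodes hr (by omega) ?_)).subset hv, hvn⟩
        rw [hki]
        exact O.mem i hi
    · rintro ⟨hv, hvn⟩
      obtain ⟨c, hc, hci, hvc⟩ := h.cover _ (O.mem i hi) hri v hv
      obtain ⟨k, hk, rfl⟩ := O.exists_eq c (Finset.mem_insert_of_mem hc)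
      exact .inr ⟨k, ⟨O.lt k hk i hi hc hci, hci⟩, hvc, hvn⟩
  · have hm := (Finset.mem_insert.1 (O.mem i hi)).resolve_left (by omega)
    rw [h.desc_leaf _ hm (by omega), Finset.mem_singleton]
    constructor
    · rintro (h1 | ⟨k, ⟨hk, hki⟩, -⟩)
      · split_ifs at h1 with h2
        · rw [Finset.mem_singleton] at h1
          exact ⟨h1, by omega⟩
        · exact absurd h1 (Finset.notMem_empty v)
      · have h2 := h.le_par _ (O.mem_nodes hr (by omega : k < len) (by rw [hki]; exact O.mem i hi))
        omega
    · rintro ⟨rfl, hvn⟩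
      exact .inl (by simp [hvn])

/-- The vertices in the part of a node that has been treated before its child `Q i` are below
another child. -/
theorem exists_sibling_of_mem_part (hn : n + 2 = r) (hi : i < len) (hc : Q i ∈ T.nodes) {u : ℕ}
    (hu : u ∈ T.part n Q i (T.par (Q i))) :
    ∃ d ∈ T.nodes, d ≠ Q i ∧ T.par d = T.par (Q i) ∧ u ∈ T.desc d := by
  have h1 := h.le_par _ hc
  rw [part, if_neg (by omega), Finset.empty_union, Finset.mem_biUnion] at hu
  obtain ⟨k, hk, hu⟩ := hu
  rw [Finset.mem_filter, Finset.mem_range] at hk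
  refine ⟨Q k, O.mem_nodes hr (by omega) (hk.2 ▸ h.par_mem _ hc), fun h2 => ?_, hk.2,
    (Finset.mem_filter.1 hu).1⟩
  have := O.inj k (by omega) i hi h2
  omega

theorem disjoint_part (hn : n + 2 = r) (hi : i < len) (hc : Q i ∈ T.nodes) :
    Disjoint (T.part n Q i (T.par (Q i))) (T.module n (Q i)) := by
  rw [Finset.disjoint_left]
  intro u hu hu'
  obtain ⟨d, hd, hdc, hdp, hud⟩ := O.exists_sibling_of_mem_part h hr hn hi hc hu
  exact h.disj d hd _ hc hdc hdp u hud (Finset.mem_filter.1 hu').1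

/-- The part of a node treated so far and the module of its next child are joined completely or not
at all, according to the type of the node. -/
theorem cross_part (hn : n + 2 = r) (hi : i < len) (hc : Q i ∈ T.nodes)
    (hsymm : ∀ u v, E u v → E v u) (hR : ∀ u v, u ≠ v → (R u v ↔ E u v)) :
    ∀ u ∈ T.part n Q i (T.par (Q i)), ∀ v ∈ T.module n (Q i),
      (R u v ↔ decide (T.ty (T.par (Q i)) = 1) = true) ∧
        (R v u ↔ decide (T.ty (T.par (Q i)) = 1) = true) := by
  intro u hu v hv
  have huv : u ≠ v := by
    rintro rfl
    exact Finset.disjoint_left.1 (O.disjoint_part h hr hn hi hc) hu hv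
  obtain ⟨d, hd, hdc, hdp, hud⟩ := O.exists_sibling_of_mem_part h hr hn hi hc hu
  have h1 := h.adj d hd _ hc hdc hdp u hud v (Finset.mem_filter.1 hv).1
  rw [hdp] at h1
  rw [hR u v huv, hR v u huv.symm, decide_eq_true_eq, ← h1]
  exact ⟨Iff.rfl, hsymm v u, hsymm u v⟩

end IsOrder

/-- The invariant of the construction of an optimal set for the whole graph, from the root down to
the leaves, against the order `Q`: the nodes from position `i` on have been separated from their
parents and have got a status `cur`; any choice of optimal sets for their parts makes up an optimal
set. -/
structure Traceback (T : Cotree) (R : ℕ → ℕ → Prop) (r n : ℕ) (Q : ℕ → ℕ) (len : ℕ) (σ : Status)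
    (i : ℕ) (cur : ℕ → Status) : Prop where
  exists_optimal : ∀ a ∈ insert r ((Finset.Ico i len).image Q),
    ∃ S, Optimal R (T.part n Q i a) (cur a) S
  optimal : ∀ f : ℕ → Finset ℕ,
    (∀ a ∈ insert r ((Finset.Ico i len).image Q), Optimal R (T.part n Q i a) (cur a) (f a)) →
      Optimal R (Finset.range n) σ ((insert r ((Finset.Ico i len).image Q)).biUnion f)

theorem image_Ico_eq (hi : i < len) : (Finset.Ico i len).image Q =
    insert (Q i) ((Finset.Ico (i + 1) len).image Q) := by
  rw [← Finset.insert_Ico_add_one_left_eq_Ico hi, Finset.image_insert]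

theorem Traceback.start {σ : Status} {cur : ℕ → Status} (hcur : cur r = σ)
    (hroot : T.part n Q len r = Finset.range n) (hex : ∃ S, Optimal R (Finset.range n) σ S) :
    T.Traceback R r n Q len σ len cur := by
  refine ⟨?_, ?_⟩
  · simpa [hroot, hcur] using hex
  · intro f hf
    simpa [hroot, hcur] using hf

/-- The root has no parent in the tree, so nothing changes when it is met in the queue. -/
theorem Traceback.step_root {σ : Status} {cur : ℕ → Status}
    (B : T.Traceback R r n Q len σ (i + 1) cur) (hi : i < len) (hQ : Q i = r)
    (hpart : ∀ a ∈ insert r ((Finset.Ico (i + 1) len).image Q), T.par r ≠ a) :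
    T.Traceback R r n Q len σ i cur := by
  have h1 : insert r ((Finset.Ico i len).image Q) =
      insert r ((Finset.Ico (i + 1) len).image Q) := by
    rw [image_Ico_eq hi, hQ, Finset.insert_idem]
  have h2 : ∀ a ∈ insert r ((Finset.Ico (i + 1) len).image Q),
      T.part n Q (i + 1) a = T.part n Q i a := fun a ha =>
    part_succ_of_ne (by rw [hQ]; exact hpart a ha)
  refine ⟨?_, ?_⟩ <;> rw [h1]
  · exact fun a ha => h2 a ha ▸ B.exists_optimal a ha
  · exact fun f hf => B.optimal f fun a ha => (h2 a ha).symm ▸ hf a ha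

/-- When the node `Q i` is separated from its parent, the status of the parent is split into a pair
`β` from which it was obtained. -/
theorem Traceback.step {σ : Status} {cur : ℕ → Status} {β : Status × Status}
    (B : T.Traceback R r n Q len σ (i + 1) cur) (O : T.IsOrder r Q len) (h : T.Represents r E)
    (hr : T.par r ∉ insert r T.nodes) (hn : n + 2 = r) (hi : i < len) (hc : Q i ∈ T.nodes)
    (h1 : ∃ S, Optimal R (T.part n Q i (T.par (Q i))) β.1 S)
    (h2 : ∃ S, Optimal R (T.module n (Q i)) β.2 S)
    (h3 : ∀ S₁ S₂, Optimal R (T.part n Q i (T.par (Q i))) β.1 S₁ →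
      Optimal R (T.module n (Q i)) β.2 S₂ →
        Optimal R (T.part n Q (i + 1) (T.par (Q i))) (cur (T.par (Q i))) (S₁ ∪ S₂)) :
    T.Traceback R r n Q len σ i
      (Function.update (Function.update cur (T.par (Q i)) β.1) (Q i) β.2) := by
  obtain ⟨hex, hopt⟩ := B
  set p := T.par (Q i) with hp
  set A := insert r ((Finset.Ico (i + 1) len).image Q) with hA
  have hcr : Q i ≠ r := h.ne_root hc
  have hpc : p ≠ Q i := h.par_ne_self hc
  have hiA : insert r ((Finset.Ico i len).image Q) = insert (Q i) A := by
    rw [image_Ico_eq hi, Finset.insert_comm]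
  have hcA : Q i ∉ A := by
    rw [hA, Finset.mem_insert, Finset.mem_image]
    rintro (h4 | ⟨k, hk, hki⟩)
    · exact hcr h4
    · rw [Finset.mem_Ico] at hk
      have := O.inj k hk.2 i hi hki
      omega
  have hpA : p ∈ A := O.par_mem_image h.toIsTree hi hc
  have hne : ∀ a ∈ A, a ≠ Q i := fun a ha h4 => hcA (h4 ▸ ha)
  have hold : ∀ a ∈ A, a ≠ p → T.part n Q i a = T.part n Q (i + 1) a := fun a _ hap =>
    (part_succ_of_ne (by rw [← hp]; exact hap.symm)).symm
  have hself := O.part_self h hr hn hi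
  clear_value A
  refine ⟨?_, ?_⟩ <;> rw [hiA]
  · intro a ha
    rcases Finset.mem_insert.1 ha with rfl | ha
    · rw [hself, Function.update_self]
      exact h2
    · rw [Function.update_of_ne (hne a ha)]
      by_cases hap : a = p
      · rw [hap, Function.update_self]
        exact h1
      · rw [Function.update_of_ne hap, hold a ha hap]
        exact hex a ha
  · intro f hf
    have hfc := hf (Q i) (Finset.mem_insert_self _ _)
    rw [hself, Function.update_self] at hfc
    have hfp := hf p (Finset.mem_insert_of_mem hpA)
    rw [Function.update_of_ne hpc, Function.update_self] at hfp
    have key := hopt (Function.update f p (f p ∪ f (Q i))) fun a ha => by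
      by_cases hap : a = p
      · rw [hap, Function.update_self]
        exact h3 _ _ hfp hfc
      · have := hf a (Finset.mem_insert_of_mem ha)
        rw [Function.update_of_ne (hne a ha), Function.update_of_ne hap, hold a ha hap] at this
        rwa [Function.update_of_ne hap]
    convert key using 1
    ext v
    simp only [Finset.mem_biUnion, Finset.mem_insert, exists_eq_or_imp]
    constructor
    · rintro (hv | ⟨a, ha, hv⟩)
      · exact ⟨p, hpA, by simp [hv]⟩
      · refine ⟨a, ha, ?_⟩
        by_cases hap : a = p
        · subst hap
          simp [hv]
        · rwa [Function.update_of_ne hap]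
    · rintro ⟨a, ha, hv⟩
      by_cases hap : a = p
      · subst hap
        rw [Function.update_self, Finset.mem_union] at hv
        exact hv.elim (fun hv => .inr ⟨_, ha, hv⟩) .inl
      · rw [Function.update_of_ne hap] at hv
        exact .inr ⟨a, ha, hv⟩

/-- In the end, the statuses of the leaves tell the optimal set. -/
theorem Traceback.finish {σ : Status} {cur : ℕ → Status}
    (B : T.Traceback R r n Q len σ 0 cur) (hleaf : ∀ v < n, ∃ j < len, Q j = v) :
    Optimal R (Finset.range n) σ {v ∈ Finset.range n | (cur v).2.2 = false} := by
  choose! f hf using B.exists_optimal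
  convert B.optimal f hf using 1
  ext v
  have hmem : ∀ a ∈ insert r ((Finset.Ico 0 len).image Q),
      v ∈ f a ↔ a = v ∧ v < n ∧ (cur v).2.2 = false := by
    intro a ha
    have h1 := (hf a ha).feasible
    rw [part_zero] at h1
    split_ifs at h1 with h2
    · rw [h1.eq_of_singleton]
      by_cases hav : a = v
      · subst hav
        cases h3 : (cur a).2.2 <;> simp [h2]
      · split_ifs <;> simp [hav, Ne.symm hav]
    · rw [Finset.subset_empty.1 h1.subset]
      constructor
      · intro h3
        exact absurd h3 (Finset.notMem_empty v)
      · rintro ⟨rfl, h3, -⟩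
        exact absurd h3 h2
  rw [Finset.mem_filter, Finset.mem_range, Finset.mem_biUnion]
  constructor
  · rintro ⟨h1, h2⟩
    obtain ⟨j, hj, hjv⟩ := hleaf v h1
    have ha : v ∈ insert r ((Finset.Ico 0 len).image Q) := Finset.mem_insert_of_mem
      (Finset.mem_image.2 ⟨j, Finset.mem_Ico.2 ⟨by omega, hj⟩, hjv⟩)
    exact ⟨v, ha, (hmem v ha).2 ⟨rfl, h1, h2⟩⟩
  · rintro ⟨a, ha, hva⟩
    exact ((hmem a ha).1 hva).2

end Cotree

namespace Status

/-! ### Tables of statuses -/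

/-- The number that encodes a status. -/
def code (σ : Status) : ℕ := σ.1.toNat + 2 * σ.2.1.toNat + 4 * σ.2.2.toNat

theorem code_lt (σ : Status) : σ.code < 8 := by
  revert σ
  decide

@[simp] theorem code_inj {σ τ : Status} : σ.code = τ.code ↔ σ = τ := by
  revert σ τ
  decide

/-- All statuses. -/
def all : List Status :=
  [false, true] ×ˢ [false, true] ×ˢ [false, true]

@[simp] theorem mem_all (σ : Status) : σ ∈ all := by
  revert σ
  decide

/-- All pairs of statuses that can be merged, together with the results. -/
def merges (t : Bool) : List (Status × Status × Status) :=
  (all ×ˢ all).filterMap fun β => (merge t β.1 β.2).map fun σ => (β.1, β.2, σ)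

theorem mem_merges {t : Bool} {σ₁ σ₂ σ : Status} :
    (σ₁, σ₂, σ) ∈ merges t ↔ merge t σ₁ σ₂ = some σ := by
  simp only [merges, List.mem_filterMap, Option.map_eq_some_iff]
  constructor
  · rintro ⟨β, -, τ, h, h1⟩
    have h2 : β.1 = σ₁ := congrArg (fun z => z.1) h1
    have h3 : β.2 = σ₂ := congrArg (fun z => z.2.1) h1
    have h4 : τ = σ := congrArg (fun z => z.2.2) h1
    rw [← h2, ← h3, ← h4, h]
  · exact fun h => ⟨(σ₁, σ₂), List.mem_product.2 ⟨mem_all _, mem_all _⟩, σ, h, rfl⟩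

end Status

namespace IsBest

variable {t : Bool} {p p' : Status → Status → Prop} {v₁ v₂ : Status → ℕ} {k : ℕ}
  {σ σ₁ σ₂ : Status} {β : Status × Status}

theorem keep (h : IsBest t p v₁ v₂ σ k β)
    (hp : ∀ τ₁ τ₂, p' τ₁ τ₂ → p τ₁ τ₂ ∨ τ₁ = σ₁ ∧ τ₂ = σ₂)
    (hk : Status.merge t σ₁ σ₂ = some σ → v₁ σ₁ ≠ 0 → v₂ σ₂ ≠ 0 →
      k ≠ 0 ∧ k + 1 ≤ v₁ σ₁ + v₂ σ₂) : IsBest t p' v₁ v₂ σ k β := by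
  refine ⟨fun τ₁ τ₂ h1 => ?_, h.2⟩
  rcases hp τ₁ τ₂ h1 with h2 | ⟨rfl, rfl⟩
  · exact h.1 τ₁ τ₂ h2
  · exact hk

theorem improve (h : IsBest t p v₁ v₂ σ k β)
    (hp : ∀ τ₁ τ₂, p' τ₁ τ₂ → p τ₁ τ₂ ∨ τ₁ = σ₁ ∧ τ₂ = σ₂)
    (hm : Status.merge t σ₁ σ₂ = some σ) (h₁ : v₁ σ₁ ≠ 0) (h₂ : v₂ σ₂ ≠ 0)
    (hk : k = 0 ∨ v₁ σ₁ + v₂ σ₂ - 1 < k) :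
    IsBest t p' v₁ v₂ σ (v₁ σ₁ + v₂ σ₂ - 1) (σ₁, σ₂) := by
  refine ⟨fun τ₁ τ₂ h1 h2 h3 h4 => ?_, fun _ => ⟨hm, h₁, h₂, by
    dsimp only
    omega⟩⟩
  rcases hp τ₁ τ₂ h1 with h5 | ⟨rfl, rfl⟩
  · have := h.1 τ₁ τ₂ h5 h2 h3 h4
    omega
  · omega

end IsBest

namespace WordRAM

/-! ### The dynamic program on a word RAM -/

/-- Fill the queue with the nodes of the cotree, in topological order. -/
def order : Program := .seq (move rLen rRoot) (.seq (forQueue (store aQueue rI rI)) sweep)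

/-- The number of steps of `order` for `n` vertices. -/
def orderCost (n : ℕ) : ℕ := 1 + (((n + 2) * (1 + 2) + 2) +
  (1 + (2 * (n + 2) * (sweepBody.cost + 1) + 1)))

theorem order_spec {w n : ℕ} {T : Cotree} {s : State} (H : Heap n T s)
    (hdesc : T.desc (n + 2) = Finset.range n ∪ {n, n + 1}) (hw : 6 * n + 8 ≤ w) :
    HaltsWithin w order s (orderCost n) fun s' => ∃ len ≤ 2 * (n + 2), s'.reg rLen = len ∧
      T.IsOrder (n + 2) (s'.arr aQueue) len ∧ Agree [rLen] [aCount, aQueue] s s' := by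
  refine HaltsWithin.seq_wp (P := move rLen rRoot) ?_
  have hA₁ : Agree [rLen] [] s (s.setReg rLen (n + 2)) := Agree.refl.setReg (by simp)
  have len₁ : (s.setReg rLen (n + 2)).reg rLen = n + 2 := by simp
  have one₁ : (s.setReg rLen (n + 2)).reg rOne = 1 := by simp [H.one]
  simp only [Program.wp, Instr.Safe, Instr.apply, Instr.value, H.root, true_and]
  generalize s.setReg rLen (n + 2) = s₁ at hA₁ len₁ one₁ ⊢
  refine HaltsWithin.seq ((forQueue_spec (fun i s' => (∀ j < i, s'.arr aQueue j = j) ∧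
    s'.reg rLen = n + 2 ∧ Agree [rLen] [aQueue] s s') len₁ one₁ (by omega)
    ⟨by simp, by simp [len₁], ?_⟩ ?_).mono le_rfl ?_)
  · exact (hA₁.mono (by simp) (by simp)).setReg (by simp)
  · rintro i hi s' ⟨h1, -, hA⟩ hI hlen hone
    simp only [Program.wp, Instr.Safe, Instr.apply, Instr.value, hI, State.setArr_reg, hlen, hone,
      true_and]
    refine ⟨fun j hj => ?_, by simp [hlen], (hA.setArr (by simp)).setReg (by simp)⟩
    simp only [State.setReg_arr, State.setArr_arr, if_true, Function.update_apply]
    split_ifs with h2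
    · exact h2.symm
    · exact h1 j (by omega)
  rintro s₂ ⟨h1, len₂, hA₂⟩
  have H₂ : Heap n T s₂ := H.congr hA₂ (by simp) (by simp) (by
    rw [hA₂.2 7 (by simp)]
    exact H.count)
  have hS : T.Sweep (n + 2) (fun _ => True) (n + 2) (s₂.arr aQueue) 0 (n + 2) := by
    refine Cotree.Sweep.start H.isTree (fun j hj k hk hjk => ?_) fun v => ?_
    · rwa [h1 j hj, h1 k hk] at hjk
    · rw [hdesc]
      simp only [Finset.mem_union, Finset.mem_range, Finset.mem_insert, Finset.mem_singleton,
        and_true]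
      constructor
      · rintro ⟨j, hj, rfl⟩
        rw [h1 j hj]
        omega
      · exact fun hv => ⟨v, by omega, h1 v (by omega)⟩
  have hr := H.par_root_notMem
  refine (sweep_spec H.isTree hr H₂.par H₂.deg (by rw [H.par_root, H₂.deg_null]) H₂.count H₂.one
    len₂ hS (by omega)).mono le_rfl ?_
  rintro s₃ ⟨len, h2, h3, -, hA₃⟩
  exact ⟨len, h3.len_le H.isTree hr, h2, h3.isOrder H.isTree fun _ => trivial,
    (hA₂.mono (by simp) (by simp)).trans (hA₃.mono (by simp) (by simp))⟩

/-- The array of the values for the status `σ`, indexed by the nodes. -/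
def aVal (σ : Status) : ℕ := 10 + σ.code

/-- For every node, the status of its parent (before the node was treated) from which the status `σ`
of the parent (after this) was obtained. -/
def aFst (σ : Status) : ℕ := 20 + σ.code

/-- For every node, its status from which the status `σ` of its parent was obtained. -/
def aSnd (σ : Status) : ℕ := 30 + σ.code

/-- The new value for the status `σ`. -/
def rBest (σ : Status) : ℕ := 60 + σ.code

/-- The code of the status of the parent from which `rBest` is obtained. -/
def rFst (σ : Status) : ℕ := 70 + σ.code

/-- The code of the status of the child from which `rBest` is obtained. -/
def rSnd (σ : Status) : ℕ := 80 + σ.code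

section

variable {σ τ : Status} {m : ℕ}

@[simp] theorem aVal_inj : aVal σ = aVal τ ↔ σ = τ := by simp [aVal]
@[simp] theorem aFst_inj : aFst σ = aFst τ ↔ σ = τ := by simp [aFst]
@[simp] theorem aSnd_inj : aSnd σ = aSnd τ ↔ σ = τ := by simp [aSnd]
@[simp] theorem rBest_inj : rBest σ = rBest τ ↔ σ = τ := by simp [rBest]
@[simp] theorem rFst_inj : rFst σ = rFst τ ↔ σ = τ := by simp [rFst]
@[simp] theorem rSnd_inj : rSnd σ = rSnd τ ↔ σ = τ := by simp [rSnd]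

@[simp] theorem aVal_ne_aFst : aVal σ ≠ aFst τ := by
  have := σ.code_lt
  unfold aVal aFst
  omega

@[simp] theorem aVal_ne_aSnd : aVal σ ≠ aSnd τ := by
  have := σ.code_lt
  unfold aVal aSnd
  omega

@[simp] theorem aFst_ne_aVal : aFst σ ≠ aVal τ := aVal_ne_aFst.symm
@[simp] theorem aSnd_ne_aVal : aSnd σ ≠ aVal τ := aVal_ne_aSnd.symm

@[simp] theorem aFst_ne_aSnd : aFst σ ≠ aSnd τ := by
  have := σ.code_lt
  unfold aFst aSnd
  omega

@[simp] theorem aSnd_ne_aFst : aSnd σ ≠ aFst τ := aFst_ne_aSnd.symm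

@[simp] theorem rBest_ne_rFst : rBest σ ≠ rFst τ := by
  have := σ.code_lt
  unfold rBest rFst
  omega

@[simp] theorem rBest_ne_rSnd : rBest σ ≠ rSnd τ := by
  have := σ.code_lt
  unfold rBest rSnd
  omega

@[simp] theorem rFst_ne_rBest : rFst σ ≠ rBest τ := rBest_ne_rFst.symm
@[simp] theorem rSnd_ne_rBest : rSnd σ ≠ rBest τ := rBest_ne_rSnd.symm

@[simp] theorem rFst_ne_rSnd : rFst σ ≠ rSnd τ := by
  have := σ.code_lt
  unfold rFst rSnd
  omega

@[simp] theorem rSnd_ne_rFst : rSnd σ ≠ rFst τ := rFst_ne_rSnd.symm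

@[simp] theorem ne_aVal (h : m < 10) : m ≠ aVal σ := by
  unfold aVal
  omega

@[simp] theorem ne_aFst (h : m < 10) : m ≠ aFst σ := by
  unfold aFst
  omega

@[simp] theorem ne_aSnd (h : m < 10) : m ≠ aSnd σ := by
  unfold aSnd
  omega

@[simp] theorem ne_rBest (h : m < 60) : m ≠ rBest σ := by
  unfold rBest
  omega

@[simp] theorem rBest_ne (h : m < 60) : rBest σ ≠ m := (ne_rBest h).symm

@[simp] theorem ne_rFst (h : m < 60) : m ≠ rFst σ := by
  unfold rFst
  omega

@[simp] theorem rFst_ne (h : m < 60) : rFst σ ≠ m := (ne_rFst h).symm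

@[simp] theorem ne_rSnd (h : m < 60) : m ≠ rSnd σ := by
  unfold rSnd
  omega

@[simp] theorem rSnd_ne (h : m < 60) : rSnd σ ≠ m := (ne_rSnd h).symm

end

/-- The rule for a block of similar programs: `I l` holds after the programs for the items in `l`.
-/
theorem wp_block_map {α : Type} {w : ℕ} {f : α → Program} (I : List α → State → Prop) (l : List α)
    (h : ∀ l' x s, x ∈ l → I l' s → (f x).wp w (I (l' ++ [x])) s) {s : State} (h0 : I [] s) :
    (Program.block (l.map f)).wp w (I l) s := by
  have key : ∀ l₂ l₁ s, (∀ x ∈ l₂, x ∈ l) → I l₁ s →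
      (Program.block (l₂.map f)).wp w (I (l₁ ++ l₂)) s := by
    intro l₂
    induction l₂ with
    | nil => simp
    | cons x l₂ ih =>
      intro l₁ s hl hI
      refine Program.wp_seq (h l₁ x s (hl x (by simp)) hI) fun s' hs' => ?_
      have := ih (l₁ ++ [x]) s' (fun y hy => hl y (by simp [hy])) hs'
      rwa [List.append_assoc] at this
  simpa using key l [] s (fun _ => id) h0

/-- Record the pair `(σ₁, σ₂)` of statuses with the result `σ`, if it is better than the pairs seen
so far. -/
def mergeStep (β : Status × Status × Status) : Program := .block [
  load rX (aVal β.1) rP, load rY (aVal β.2.1) rC,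
  .ite (.eq rX rZero) .skip (.ite (.eq rY rZero) .skip (.block [
    add rX rX rY, sub rX rX rOne,
    .ite (.eq (rBest β.2.2) rZero)
      (.block [move (rBest β.2.2) rX, const (rFst β.2.2) β.1.code, const (rSnd β.2.2) β.2.1.code])
      (.ite (.lt rX (rBest β.2.2))
        (.block [move (rBest β.2.2) rX, const (rFst β.2.2) β.1.code,
          const (rSnd β.2.2) β.2.1.code])
        .skip)]))]

/-- Merge the module of the node `rC` with the part of its parent `rP` treated so far, where `t`
tells whether the parent is a join node. -/
def mergeChild (t : Bool) : Program := .block [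
  .block (Status.all.map fun σ => const (rBest σ) 0),
  .block ((Status.merges t).map mergeStep),
  .block (Status.all.map fun σ => .block [
    store (aVal σ) rP (rBest σ), store (aFst σ) rC (rFst σ), store (aSnd σ) rC (rSnd σ)])]

/-- After `mergeStep` for the pairs in `l`: the registers hold the best values found so far. -/
def Merged (t : Bool) (c p : ℕ) (s : State) (l : List (Status × Status × Status)) (s' : State) :
    Prop :=
  s'.arr = s.arr ∧ (∀ r < 60, r ∉ [rX, rY] → s'.reg r = s.reg r) ∧
    ∃ β : Status → Status × Status, ∀ σ,
      IsBest t (fun σ₁ σ₂ => ∃ σ₃, (σ₁, σ₂, σ₃) ∈ l) (fun σ => s.arr (aVal σ) p)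
        (fun σ => s.arr (aVal σ) c) σ (s'.reg (rBest σ)) (β σ) ∧
      (s'.reg (rBest σ) ≠ 0 → s'.reg (rFst σ) = (β σ).1.code ∧ s'.reg (rSnd σ) = (β σ).2.code)

/-- The invariant `Merged` is kept; values are sizes plus one, which explains the subtraction of one
in the sum of two values. -/
theorem mergeStep_spec {w c p : ℕ} {t : Bool} {s s' : State} {l : List (Status × Status × Status)}
    {β : Status × Status × Status} (hβ : β ∈ Status.merges t) (hc : s.reg rC = c)
    (hp : s.reg rP = p) (hzero : s.reg rZero = 0) (hone : s.reg rOne = 1)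
    (hw : ∀ σ τ, s.arr (aVal σ) p + s.arr (aVal τ) c ≤ w) (hw8 : 8 ≤ w)
    (h : Merged t c p s l s') :
    (mergeStep β).wp w (Merged t c p s (l ++ [β])) s' := by
  obtain ⟨σ₁, σ₂, σ₃⟩ := β
  rw [Status.mem_merges] at hβ
  obtain ⟨h1, h2, γ, h3⟩ := h
  have e1 : s'.reg rC = c := (h2 21 (by omega) (by simp)).trans hc
  have e2 : s'.reg rP = p := (h2 22 (by omega) (by simp)).trans hp
  have e3 : s'.reg rZero = 0 := (h2 14 (by omega) (by simp)).trans hzero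
  have e4 : s'.reg rOne = 1 := (h2 1 (by omega) (by simp)).trans hone
  have c1 := σ₁.code_lt
  have c2 := σ₂.code_lt
  have hs := hw σ₁ σ₂
  have hp' : ∀ τ₁ τ₂, (∃ σ, (τ₁, τ₂, σ) ∈ l ++ [(σ₁, σ₂, σ₃)]) →
      (∃ σ, (τ₁, τ₂, σ) ∈ l) ∨ τ₁ = σ₁ ∧ τ₂ = σ₂ := by
    rintro τ₁ τ₂ ⟨σ, hσ⟩
    rcases List.mem_append.1 hσ with h4 | h4
    · exact .inl ⟨σ, h4⟩
    · rw [List.mem_singleton] at h4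
      exact .inr ⟨congrArg (fun z => z.1) h4, congrArg (fun z => z.2.1) h4⟩
  have other : ∀ σ ≠ σ₃, Status.merge t σ₁ σ₂ ≠ some σ := fun σ hσ h4 =>
    hσ (Option.some_inj.1 (h4.symm.trans hβ))
  have keep : ∀ s'' : State, s''.arr = s'.arr → (∀ r, r ∉ [rX, rY] → s''.reg r = s'.reg r) →
      (s.arr (aVal σ₁) p ≠ 0 → s.arr (aVal σ₂) c ≠ 0 → s'.reg (rBest σ₃) ≠ 0 ∧
        s'.reg (rBest σ₃) + 1 ≤ s.arr (aVal σ₁) p + s.arr (aVal σ₂) c) →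
      Merged t c p s (l ++ [(σ₁, σ₂, σ₃)]) s'' := by
    intro s'' k1 k2 k3
    refine ⟨k1.trans h1, fun r hr hr' => (k2 r hr').trans (h2 r hr hr'), γ, fun σ => ?_⟩
    rw [k2 (rBest σ) (by simp), k2 (rFst σ) (by simp), k2 (rSnd σ) (by simp)]
    refine ⟨(h3 σ).1.keep hp' fun h4 => ?_, (h3 σ).2⟩
    by_cases hσ : σ = σ₃
    · subst hσ
      exact k3
    · exact absurd h4 (other σ hσ)
  have improve : ∀ s'' : State, s''.arr = s'.arr →
      (∀ r, r ∉ [rX, rY, rBest σ₃, rFst σ₃, rSnd σ₃] → s''.reg r = s'.reg r) →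
      s''.reg (rBest σ₃) = s.arr (aVal σ₁) p + s.arr (aVal σ₂) c - 1 →
      s''.reg (rFst σ₃) = σ₁.code → s''.reg (rSnd σ₃) = σ₂.code →
      s.arr (aVal σ₁) p ≠ 0 → s.arr (aVal σ₂) c ≠ 0 →
      (s'.reg (rBest σ₃) = 0 ∨
        s.arr (aVal σ₁) p + s.arr (aVal σ₂) c - 1 < s'.reg (rBest σ₃)) →
      Merged t c p s (l ++ [(σ₁, σ₂, σ₃)]) s'' := by
    intro s'' k1 k2 k3 k4 k5 k6 k7 k8
    refine ⟨k1.trans h1, fun r hr hr' => ?_, Function.update γ σ₃ (σ₁, σ₂), fun σ => ?_⟩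
    · refine (k2 r ?_).trans (h2 r hr hr')
      simp at hr' ⊢
      simp [hr, hr']
    · by_cases hσ : σ = σ₃
      · subst hσ
        rw [Function.update_self, k3, k4, k5]
        exact ⟨(h3 σ).1.improve hp' hβ k6 k7 k8, fun _ => ⟨rfl, rfl⟩⟩
      · rw [Function.update_of_ne hσ, k2 (rBest σ) (by simp [hσ]), k2 (rFst σ) (by simp [hσ]),
          k2 (rSnd σ) (by simp [hσ])]
        exact ⟨(h3 σ).1.keep hp' fun h4 => absurd h4 (other σ hσ), (h3 σ).2⟩
  simp [mergeStep, e1, e2, e3, e4, h1]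
  refine ⟨fun k1 => keep _ rfl ?_ fun k2 => absurd k1 k2, fun k1 =>
    ⟨fun k2 => keep _ rfl ?_ fun _ k3 => absurd k2 k3, fun k2 => ⟨hs, fun k3 => ⟨by omega, by omega,
      improve _ rfl ?_ (by simp) (by simp) (by simp) k1 k2 (.inl k3)⟩, fun k3 =>
        ⟨fun k4 => ⟨by omega, by omega, improve _ rfl ?_ (by simp) (by simp) (by simp) k1 k2
          (.inr k4)⟩, fun k4 => keep _ rfl ?_ fun _ _ => ⟨k3, by omega⟩⟩⟩⟩⟩
  all_goals
    intro r hr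
    simp at hr
    simp [hr]

theorem mergeChild_spec {w c p : ℕ} {t : Bool} {s : State} (hc : s.reg rC = c)
    (hp : s.reg rP = p) (hzero : s.reg rZero = 0) (hone : s.reg rOne = 1)
    (hw : ∀ σ τ, s.arr (aVal σ) p + s.arr (aVal τ) c ≤ w) (hw8 : 8 ≤ w) :
    (mergeChild t).wp w (fun s' => (∀ r < 60, r ∉ [rX, rY] → s'.reg r = s.reg r) ∧
      (∀ a < 10, s'.arr a = s.arr a) ∧ (∀ σ, ∀ i ≠ p, s'.arr (aVal σ) i = s.arr (aVal σ) i) ∧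
      (∀ σ, ∀ i ≠ c, s'.arr (aFst σ) i = s.arr (aFst σ) i) ∧
      (∀ σ, ∀ i ≠ c, s'.arr (aSnd σ) i = s.arr (aSnd σ) i) ∧
      ∀ σ, ∃ β : Status × Status, IsBest t (fun _ _ => True) (fun σ => s.arr (aVal σ) p)
        (fun σ => s.arr (aVal σ) c) σ (s'.arr (aVal σ) p) β ∧
        (s'.arr (aVal σ) p ≠ 0 →
          s'.arr (aFst σ) c = β.1.code ∧ s'.arr (aSnd σ) c = β.2.code)) s := by
  unfold mergeChild
  refine Program.wp_seq (wp_block_map (fun l s' => s'.arr = s.arr ∧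
    (∀ r < 60, s'.reg r = s.reg r) ∧ ∀ σ ∈ l, s'.reg (rBest σ) = 0) Status.all ?_ (by simp)) ?_
  · rintro l σ s' - ⟨h1, h2, h3⟩
    simp only [Program.wp, Instr.Safe, Instr.apply, Instr.value]
    refine ⟨by omega, h1, fun r hr => ?_, fun τ hτ => ?_⟩
    · simp [hr, h2]
    · by_cases hτσ : τ = σ
      · simp [hτσ]
      · simp only [List.mem_append, List.mem_singleton, hτσ, or_false] at hτ
        simp [hτσ, h3 τ hτ]
  rintro s₁ ⟨h1, h2, h3⟩
  refine Program.wp_seq (wp_block_map (Merged t c p s) (Status.merges t)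
    (fun l β s' hβ => mergeStep_spec hβ hc hp hzero hone hw hw8)
    ⟨h1, fun r hr _ => h2 r hr, fun _ => ((false, false, false), (false, false, false)),
      fun σ => ⟨⟨by simp, by simp [h3]⟩, by simp [h3]⟩⟩) ?_
  rintro s₂ ⟨k1, k2, β, k3⟩
  refine Program.wp_seq (wp_block_map (fun l s' => s'.reg = s₂.reg ∧
    (∀ a < 10, s'.arr a = s.arr a) ∧
    ∀ σ, s'.arr (aVal σ) = (if σ ∈ l then Function.update (s.arr (aVal σ)) p (s₂.reg (rBest σ))
        else s.arr (aVal σ)) ∧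
      s'.arr (aFst σ) = (if σ ∈ l then Function.update (s.arr (aFst σ)) c (s₂.reg (rFst σ))
        else s.arr (aFst σ)) ∧
      s'.arr (aSnd σ) = (if σ ∈ l then Function.update (s.arr (aSnd σ)) c (s₂.reg (rSnd σ))
        else s.arr (aSnd σ))) Status.all ?_ (by simp [k1])) ?_
  · rintro l σ s' - ⟨m1, m2, m3⟩
    have e1 : s₂.reg rC = c := (k2 21 (by omega) (by simp)).trans hc
    have e2 : s₂.reg rP = p := (k2 22 (by omega) (by simp)).trans hp
    simp [m1, e1, e2, -Prod.forall, -Bool.forall_bool]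
    refine ⟨fun a ha => by simp [ha, m2], fun τ => ?_⟩
    obtain ⟨n1, n2, n3⟩ := m3 τ
    by_cases hτ : τ = σ
    · subst hτ
      simp [n1, n2, n3]
      split_ifs <;> simp
    · simp [hτ, n1, n2, n3]
  · rintro s₃ ⟨m1, m2, m3⟩
    simp only [Status.mem_all, if_true] at m3
    refine ⟨fun r hr hr' => m1 ▸ k2 r hr hr', m2, fun σ i hi => ?_, fun σ i hi => ?_,
      fun σ i hi => ?_, fun σ => ⟨β σ, ?_, ?_⟩⟩
    · rw [(m3 σ).1, Function.update_of_ne hi]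
    · rw [(m3 σ).2.1, Function.update_of_ne hi]
    · rw [(m3 σ).2.2, Function.update_of_ne hi]
    · rw [(m3 σ).1, Function.update_self]
      refine ⟨fun τ₁ τ₂ _ h4 => (k3 σ).1.1 τ₁ τ₂ ⟨σ, Status.mem_merges.2 h4⟩ h4, (k3 σ).1.2⟩
    · rw [(m3 σ).1, (m3 σ).2.1, (m3 σ).2.2]
      simpa using (k3 σ).2

/-- The cotree `T` and the order `Q` of its nodes are in the memory. -/
structure Loaded (n : ℕ) (T : Cotree) (Q : ℕ → ℕ) (len : ℕ) (s : State) : Prop where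
  num : s.reg rNum = n
  one : s.reg rOne = 1
  root : s.reg rRoot = n + 2
  zero : s.reg rZero = 0
  len : s.reg rLen = len
  par : s.arr aPar = T.par
  ty : s.arr aType = T.ty
  queue : s.arr aQueue = Q

theorem Loaded.congr {n len : ℕ} {T : Cotree} {Q : ℕ → ℕ} {s s' : State} (L : Loaded n T Q len s)
    (h : ∀ r < 20, s'.reg r = s.reg r) (h' : ∀ a < 10, a ≠ aOut → s'.arr a = s.arr a) :
    Loaded n T Q len s' :=
  ⟨(h 0 (by omega)).trans L.num, (h 1 (by omega)).trans L.one, (h 3 (by omega)).trans L.root,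
    (h 14 (by omega)).trans L.zero, (h 6 (by omega)).trans L.len,
    (h' 3 (by omega) (by omega)).trans L.par, (h' 4 (by omega) (by omega)).trans L.ty,
    (h' 8 (by omega) (by omega)).trans L.queue⟩

theorem Loaded.setReg {n len r v : ℕ} {T : Cotree} {Q : ℕ → ℕ} {s : State}
    (L : Loaded n T Q len s) (hr : 20 ≤ r) : Loaded n T Q len (s.setReg r v) :=
  L.congr (fun q hq => by
    rw [State.setReg_reg, if_neg]
    omega) fun _ _ _ => rfl

theorem Loaded.setArr {n len a i v : ℕ} {T : Cotree} {Q : ℕ → ℕ} {s : State}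
    (L : Loaded n T Q len s) (ha : 10 ≤ a ∨ a = aOut) : Loaded n T Q len (s.setArr a i v) :=
  L.congr (fun _ _ => rfl) fun b hb hb' => by
    rw [State.setArr_arr, if_neg]
    omega

/-- The values for a node without its children, where `b` tells whether the node is a vertex, and
`c` whether it is related to itself then. -/
def leafValue (b c : Bool) (σ : Status) : ℕ :=
  if b then if σ = (true, true, true) then 1 else if σ = (!c, c, false) then 2 else 0
  else if σ = (false, false, true) then 1 else 0

theorem leafValue_le {b c : Bool} {σ : Status} : leafValue b c σ ≤ 2 := by
  unfold leafValue
  split_ifs <;> omega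

theorem isValue_leafValue {n a : ℕ} {c : Bool} {R : ℕ → ℕ → Prop} {T : Cotree} {Q : ℕ → ℕ}
    {σ : Status} (hself : ∀ v < n, (R v v ↔ c)) :
    IsValue R (T.part n Q 0 a) σ (leafValue (decide (a < n)) c σ) := by
  rw [Cotree.part_zero, leafValue]
  by_cases h : a < n
  · simpa only [if_pos h, decide_eq_true h, if_true] using isValue_singleton (hself a h)
  · simpa only [if_neg h, decide_eq_false h, Bool.false_eq_true, if_false] using isValue_empty

/-- Store the values for the node `rC`, without its children. -/
def leafStore (b c : Bool) : Program :=
  .block (Status.all.map fun σ => .seq (const rY (leafValue b c σ)) (store (aVal σ) rC rY))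

theorem leafStore_spec {w a : ℕ} {b c : Bool} {s : State} (ha : s.reg rC = a) (hw : 2 ≤ w) :
    (leafStore b c).wp w (fun s' => (∀ r, r ≠ rY → s'.reg r = s.reg r) ∧
      (∀ m < 10, s'.arr m = s.arr m) ∧
      ∀ σ, s'.arr (aVal σ) = Function.update (s.arr (aVal σ)) a (leafValue b c σ)) s := by
  refine Program.wp_mono (wp_block_map (fun l s' => (∀ r, r ≠ rY → s'.reg r = s.reg r) ∧
    (∀ m < 10, s'.arr m = s.arr m) ∧
    ∀ σ, s'.arr (aVal σ) = if σ ∈ l then Function.update (s.arr (aVal σ)) a (leafValue b c σ)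
      else s.arr (aVal σ)) Status.all ?_ (by simp)) ?_
  · rintro l σ s' - ⟨h1, h2, h3⟩
    simp only [Program.wp, Instr.Safe, Instr.apply, Instr.value, true_and]
    refine ⟨leafValue_le.trans hw, fun r hr => by simp [hr, h1], fun m hm => by simp [hm, h2],
      fun τ => ?_⟩
    have h4 := h1 rC (by omega)
    by_cases hτ : τ = σ
    · subst hτ
      simp [h4, ha, h3]
      split_ifs <;> simp
    · simp [hτ, h3]
  · rintro s' ⟨h1, h2, h3⟩
    exact ⟨h1, h2, by simpa only [Status.mem_all, if_true] using h3⟩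

/-- Store the values for the node `rI` of the queue, without its children. -/
def leafBody (c : Bool) : Program :=
  .seq (load rC aQueue rI) (.ite (.lt rC rNum) (leafStore true c) (leafStore false c))

theorem leafBody_spec {w n i len : ℕ} {c : Bool} {T : Cotree} {Q : ℕ → ℕ} {s₀ s : State}
    (L : Loaded n T Q len s) (hI : s.reg rI = i) (hw : 2 ≤ w)
    (h : ∀ j < i, ∀ σ, s.arr (aVal σ) (Q j) = leafValue (decide (Q j < n)) c σ)
    (hA : ∀ a < 10, s.arr a = s₀.arr a) :
    (leafBody c).wp w (fun s' => Loaded n T Q len s' ∧ s'.reg rI = i ∧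
      (∀ j < i + 1, ∀ σ, s'.arr (aVal σ) (Q j) = leafValue (decide (Q j < n)) c σ) ∧
      ∀ a < 10, s'.arr a = s₀.arr a) s := by
  have key : (leafStore (decide (Q i < n)) c).wp w (fun s' => Loaded n T Q len s' ∧ s'.reg rI = i ∧
      (∀ j < i + 1, ∀ σ, s'.arr (aVal σ) (Q j) = leafValue (decide (Q j < n)) c σ) ∧
      ∀ a < 10, s'.arr a = s₀.arr a) (s.setReg rC (Q i)) := by
    refine Program.wp_mono (leafStore_spec (a := Q i) (by simp) hw) ?_
    rintro s' ⟨h1, h2, h3⟩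
    refine ⟨(L.setReg (r := rC) (v := Q i) (by omega)).congr (fun r hr => h1 r (by omega))
      fun a ha _ => h2 a ha, by simp [h1, hI], fun j hj σ => ?_,
      fun a ha => (h2 a ha).trans (hA a ha)⟩
    rw [h3]
    by_cases hji : Q j = Q i
    · rw [hji, Function.update_self]
    · rw [Function.update_of_ne hji]
      refine h j (lt_of_le_of_ne (by omega) ?_) σ
      rintro rfl
      exact hji rfl
  simp only [leafBody, Program.wp, Instr.Safe, Instr.apply, Instr.value, Test.Holds, hI, L.queue,
    true_and]
  have hnum : (s.setReg rC (Q i)).reg rNum = n := by simp [L.num]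
  have hC : (s.setReg rC (Q i)).reg rC = Q i := by simp
  rw [hnum, hC]
  refine ⟨fun h1 => ?_, fun h1 => ?_⟩
  · rwa [decide_eq_true h1] at key
  · rwa [decide_eq_false h1] at key

/-- Fold the module of the node `rI` of the queue into its parent. -/
def forwardBody : Program := .seq (load rC aQueue rI) (.ite (.eq rC rRoot) .skip
  (.seq (load rP aPar rC) (.seq (load rX aType rP)
    (.ite (.eq rX rZero) (mergeChild false) (mergeChild true)))))

/-- The memory tells how optimal sets with the status `σ` are composed when the node `Q k` is folded
into its parent. -/
def Recorded (R : ℕ → ℕ → Prop) (T : Cotree) (n : ℕ) (Q : ℕ → ℕ) (k : ℕ) (s : State) (σ : Status)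
    (β : Status × Status) : Prop :=
  s.arr (aFst σ) (Q k) = β.1.code ∧ s.arr (aSnd σ) (Q k) = β.2.code ∧
    (∃ S, Optimal R (T.part n Q k (T.par (Q k))) β.1 S) ∧
    (∃ S, Optimal R (T.module n (Q k)) β.2 S) ∧
    ∀ S₁ S₂, Optimal R (T.part n Q k (T.par (Q k))) β.1 S₁ →
      Optimal R (T.module n (Q k)) β.2 S₂ →
        Optimal R (T.part n Q (k + 1) (T.par (Q k))) σ (S₁ ∪ S₂)

/-- The invariant of the dynamic program after the first `i` nodes. -/
structure Folded (R : ℕ → ℕ → Prop) (T : Cotree) (n : ℕ) (Q : ℕ → ℕ) (i : ℕ) (s : State) :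
    Prop where
  isValue : ∀ a ∈ insert (n + 2) T.nodes, ∀ σ, IsValue R (T.part n Q i a) σ (s.arr (aVal σ) a)
  recorded : ∀ k < i, Q k ∈ T.nodes → ∀ σ,
    (∃ S, Optimal R (T.part n Q (k + 1) (T.par (Q k))) σ S) → ∃ β, Recorded R T n Q k s σ β

theorem Folded.congr {R : ℕ → ℕ → Prop} {T : Cotree} {n i : ℕ} {Q : ℕ → ℕ} {s s' : State}
    (F : Folded R T n Q i s) (h : ∀ a < 40, s'.arr a = s.arr a) : Folded R T n Q i s' := by
  have h1 : ∀ σ, s'.arr (aVal σ) = s.arr (aVal σ) := fun σ => h _ <| by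
    have := σ.code_lt
    unfold aVal
    omega
  have h2 : ∀ σ, s'.arr (aFst σ) = s.arr (aFst σ) := fun σ => h _ <| by
    have := σ.code_lt
    unfold aFst
    omega
  have h3 : ∀ σ, s'.arr (aSnd σ) = s.arr (aSnd σ) := fun σ => h _ <| by
    have := σ.code_lt
    unfold aSnd
    omega
  obtain ⟨h4, h5⟩ := F
  refine ⟨by simpa only [h1] using h4, by simpa only [Recorded, h2, h3] using h5⟩

theorem forwardBody_spec {w n i len : ℕ} {E R : ℕ → ℕ → Prop} {T : Cotree} {Q : ℕ → ℕ}
    {s₀ s : State} (L : Loaded n T Q len s) (hI : s.reg rI = i) (hi : i < len)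
    (O : T.IsOrder (n + 2) Q len) (h : T.Represents (n + 2) E) (hT : T.Alternates (n + 2))
    (hr : T.par (n + 2) ∉ insert (n + 2) T.nodes)
    (hsymm : ∀ u v, E u v → E v u) (hR : ∀ u v, u ≠ v → (R u v ↔ E u v)) (hw : 6 * n + 8 ≤ w)
    (F : Folded R T n Q i s) (hA : ∀ a < 10, s.arr a = s₀.arr a) :
    forwardBody.wp w (fun s' => Loaded n T Q len s' ∧ s'.reg rI = i ∧ Folded R T n Q (i + 1) s' ∧
      ∀ a < 10, s'.arr a = s₀.arr a) s := by
  simp only [forwardBody, Program.wp, Instr.Safe, Instr.apply, Instr.value, Test.Holds, hI, L.queue,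
    true_and]
  simp only [State.setReg_reg, State.setReg_arr, if_true, L.root, L.par, L.zero, L.ty,
    Nat.reduceEqDiff, if_false]
  refine ⟨fun hroot => ⟨L.setReg (by omega), by simp [hI], ?_, hA⟩, fun hne => ?_⟩
  · refine ⟨fun a ha σ => ?_, fun k hk hkT σ hσ => ?_⟩
    · rw [Cotree.part_succ_of_ne]
      · exact F.isValue a ha σ
      · rw [hroot]
        rintro rfl
        exact hr ha
    · refine F.recorded k (lt_of_le_of_ne (by omega) ?_) hkT σ hσ
      rintro rfl
      rw [hroot] at hkT
      exact h.root_notMem hkT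
  have hc : Q i ∈ T.nodes := (Finset.mem_insert.1 (O.mem i hi)).resolve_left hne
  set c := Q i with hcQ
  set p := T.par c with hp
  have hpm : p ∈ insert (n + 2) T.nodes := h.par_mem c hc
  have hpr := h.le_par c hc
  have hpc : p ≠ c := h.par_ne_self hc
  have hval := F.isValue p hpm
  have hvalc := F.isValue c (Finset.mem_insert_of_mem hc)
  have hself := O.part_self h hr rfl hi
  rw [hself] at hvalc
  have hty : T.ty p = 0 ∨ T.ty p = 1 := by
    rcases Finset.mem_insert.1 hpm with h1 | h1
    · exact .inl (h1 ▸ hT.ty_root)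
    · have := hT.ty_le p h1 (lt_of_le_of_ne hpr fun h2 => h.root_notMem (h2 ▸ h1))
      omega
  have key : ∀ s' : State, s'.arr = s.arr → (∀ r < 20, s'.reg r = s.reg r) → s'.reg rC = c →
      s'.reg rP = p → s'.reg rI = i →
      (mergeChild (decide (T.ty p = 1))).wp w (fun s' => Loaded n T Q len s' ∧ s'.reg rI = i ∧
        Folded R T n Q (i + 1) s' ∧ ∀ a < 10, s'.arr a = s₀.arr a) s' := by
    intro s' h1 h2 h3 h4 h5
    refine Program.wp_mono (mergeChild_spec h3 h4 ((h2 14 (by omega)).trans L.zero)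
      ((h2 1 (by omega)).trans L.one) (fun σ τ => ?_) (by omega)) ?_
    · have k1 := (hval σ).le Cotree.part_subset_range
      have k2 := (hvalc τ).le (n := n) (hself ▸ Cotree.part_subset_range)
      rw [h1]
      omega
    rintro s'' ⟨k1, k2, k3, k4, k5, k6⟩
    rw [h1] at k2 k3 k4 k5
    have hbest : ∀ σ, IsValue R (T.part n Q (i + 1) p) σ (s''.arr (aVal σ) p) ∧
        (s''.arr (aVal σ) p ≠ 0 → ∃ β, Recorded R T n Q i s'' σ β) := by
      intro σ
      obtain ⟨β, m1, m2⟩ := k6 σ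
      rw [h1] at m1
      obtain ⟨m3, m4⟩ := m1.isValue (O.disjoint_part h hr rfl hi hc)
        (O.cross_part h hr rfl hi hc hsymm hR) hval hvalc
      rw [← Cotree.part_succ_par] at m3 m4
      refine ⟨m3, fun m5 => ⟨β, (m2 m5).1, (m2 m5).2, (m4 m5).1, (m4 m5).2.1, (m4 m5).2.2⟩⟩
    refine ⟨L.congr (fun r hr => (k1 r (by omega) ?_).trans (h2 r hr)) fun a ha _ => k2 a ha,
      (k1 20 (by omega) (by simp)).trans h5, ⟨fun a ha σ => ?_, fun k hk hkT σ hσ => ?_⟩,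
      fun a ha => (k2 a ha).trans (hA a ha)⟩
    · simp
      omega
    · by_cases hap : a = p
      · rw [hap]
        exact (hbest σ).1
      · rw [k3 σ a hap, Cotree.part_succ_of_ne (Ne.symm hap)]
        exact F.isValue a ha σ
    · by_cases hki : k = i
      · subst hki
        refine (hbest σ).2 fun h0 => ?_
        obtain ⟨S, hS⟩ := hσ
        exact (hbest σ).1.eq_zero_iff.1 h0 S hS.feasible
      · obtain ⟨β, m1, m2, m3⟩ := F.recorded k (by omega) hkT σ hσ
        have hne : Q k ≠ c := fun hkc => hki (O.inj k (by omega) i hi hkc)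
        exact ⟨β, (k4 σ _ hne).trans m1, (k5 σ _ hne).trans m2, m3⟩
  have hs : ∀ r < 20, (((s.setReg rC c).setReg rP p).setReg rX (T.ty p)).reg r = s.reg r := by
    intro r hr
    simp only [State.setReg_reg]
    rw [if_neg (by omega), if_neg (by omega), if_neg (by omega)]
  refine ⟨fun h0 => ?_, fun h0 => ?_⟩
  · have := key (((s.setReg rC c).setReg rP p).setReg rX (T.ty p)) rfl hs (by simp) (by simp)
      (by simp [hI])
    rwa [show decide (T.ty p = 1) = false by simp [h0]] at this
  · have := key (((s.setReg rC c).setReg rP p).setReg rX (T.ty p)) rfl hs (by simp) (by simp)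
      (by simp [hI])
    rwa [show decide (T.ty p = 1) = true by simp; omega] at this

/-- Fill the tables of the dynamic program. -/
def fold (c : Bool) : Program := .seq (forQueue (leafBody c)) (forQueue forwardBody)

/-- The number of steps of `fold` for a cotree with `len` nodes. -/
def foldCost (c : Bool) (len : ℕ) : ℕ :=
  (len * ((leafBody c).cost + 2) + 2) + (len * (forwardBody.cost + 2) + 2)

theorem fold_spec {w n len : ℕ} {c : Bool} {E R : ℕ → ℕ → Prop} {T : Cotree} {Q : ℕ → ℕ}
    {s : State} (L : Loaded n T Q len s)
    (O : T.IsOrder (n + 2) Q len) (h : T.Represents (n + 2) E) (hT : T.Alternates (n + 2))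
    (hr : T.par (n + 2) ∉ insert (n + 2) T.nodes)
    (hsymm : ∀ u v, E u v → E v u) (hR : ∀ u v, u ≠ v → (R u v ↔ E u v))
    (hself : ∀ v < n, (R v v ↔ c)) (hlen : len ≤ 2 * (n + 2)) (hw : 6 * n + 8 ≤ w) :
    HaltsWithin w (fold c) s (foldCost c len) fun s' => Loaded n T Q len s' ∧
      Folded R T n Q len s' ∧ (∀ a < 10, s'.arr a = s.arr a) := by
  refine HaltsWithin.seq ((forQueue_spec (fun i s' => Loaded n T Q len s' ∧
    (∀ j < i, ∀ σ, s'.arr (aVal σ) (Q j) = leafValue (decide (Q j < n)) c σ) ∧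
    ∀ a < 10, s'.arr a = s.arr a) L.len L.one (by omega)
    ⟨L.setReg (by omega), by simp, fun _ _ => rfl⟩ ?_).mono le_rfl ?_)
  · rintro i hi s' ⟨L', h1, hA⟩ hI - -
    refine Program.wp_mono (leafBody_spec L' hI (by omega) h1 hA) ?_
    rintro s'' ⟨L'', k1, k2, k3⟩
    exact ⟨k1, L''.len, L''.one, L''.setReg (by omega), k2, k3⟩
  rintro s₁ ⟨L₁, h1, hA₁⟩
  refine (forQueue_spec (fun i s' => Loaded n T Q len s' ∧ Folded R T n Q i s' ∧
    ∀ a < 10, s'.arr a = s.arr a) L₁.len L₁.one (by omega) ⟨L₁.setReg (by omega),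
      ⟨fun a ha σ => ?_, by simp⟩, hA₁⟩ ?_)
  · obtain ⟨j, hj, rfl⟩ := O.exists_eq a ha
    rw [State.setReg_arr, h1 j hj]
    exact isValue_leafValue hself
  · rintro i hi s' ⟨L', F, hA⟩ hI - -
    refine Program.wp_mono (forwardBody_spec L' hI hi O h hT hr hsymm hR hw F hA) ?_
    rintro s'' ⟨L'', k1, k2, k3⟩
    exact ⟨k1, L''.len, L''.one, L''.setReg (by omega), k2.congr fun _ _ => rfl, k3⟩

/-! ### Choosing and tracing back an optimal set -/

/-- Replace the best choice so far by the status `σ`, if the root has a smaller value there. -/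
def chooseStep (σ : Status) : Program := .block [
  load rX (aVal σ) rRoot,
  .ite (.eq rX rZero) .skip (.ite (.eq rY rZero) (.block [move rY rX, const rZ σ.code])
    (.ite (.lt rX rY) (.block [move rY rX, const rZ σ.code]) .skip))]

/-- The smallest value `rY` of the root for the statuses of dominating sets, and the code `rZ` of
such a status. -/
def choose : Program :=
  .seq (const rY 0) (.block ((Status.all.filter fun σ => !σ.1).map chooseStep))

theorem choose_spec {w n len : ℕ} {T : Cotree} {Q : ℕ → ℕ} {s : State} (L : Loaded n T Q len s)
    (hw : 8 ≤ w) :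
    choose.wp w (fun s' => Loaded n T Q len s' ∧ s'.arr = s.arr ∧
      (∀ σ : Status, σ.1 = false → s.arr (aVal σ) (n + 2) ≠ 0 →
        s'.reg rY ≠ 0 ∧ s'.reg rY ≤ s.arr (aVal σ) (n + 2)) ∧
      (s'.reg rY ≠ 0 → ∃ τ : Status, τ.1 = false ∧ s'.reg rZ = τ.code ∧
        s'.reg rY = s.arr (aVal τ) (n + 2))) s := by
  have key := wp_block_map (w := w) (f := chooseStep) (s := s.setReg rY 0)
    (fun l s' => Loaded n T Q len s' ∧ s'.arr = s.arr ∧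
      (∀ σ ∈ l, s.arr (aVal σ) (n + 2) ≠ 0 →
        s'.reg rY ≠ 0 ∧ s'.reg rY ≤ s.arr (aVal σ) (n + 2)) ∧
      (s'.reg rY ≠ 0 → ∃ τ ∈ l, s'.reg rZ = τ.code ∧ s'.reg rY = s.arr (aVal τ) (n + 2)))
    (Status.all.filter fun σ => !σ.1) ?_ ⟨L.setReg (by omega), rfl, by simp, by simp⟩
  · simp only [choose, Program.wp, Instr.Safe, Instr.apply, Instr.value]
    refine ⟨by omega, Program.wp_mono key ?_⟩
    rintro s' ⟨h1, h2, h3, h4⟩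
    refine ⟨h1, h2, fun σ hσ => h3 σ (by simp [hσ]), fun h5 => ?_⟩
    obtain ⟨τ, hτ, h6⟩ := h4 h5
    refine ⟨τ, ?_, h6⟩
    simpa using (List.mem_filter.1 hτ).2
  rintro l σ s' - ⟨h1, h2, h3, h4⟩
  have hc := σ.code_lt
  have hX : (s'.setReg rX (s.arr (aVal σ) (n + 2))).reg rX = s.arr (aVal σ) (n + 2) := by simp
  have hY : (s'.setReg rX (s.arr (aVal σ) (n + 2))).reg rY = s'.reg rY := by simp
  have hZ : (s'.setReg rX (s.arr (aVal σ) (n + 2))).reg rZ = s'.reg rZ := by simp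
  have hA : (s'.setReg rX (s.arr (aVal σ) (n + 2))).arr = s.arr := h2
  have L' : Loaded n T Q len (s'.setReg rX (s.arr (aVal σ) (n + 2))) := h1.setReg (by omega)
  have keep : (s.arr (aVal σ) (n + 2) ≠ 0 → s'.reg rY ≠ 0 ∧ s'.reg rY ≤ s.arr (aVal σ) (n + 2)) →
      ((∀ τ ∈ l ++ [σ], s.arr (aVal τ) (n + 2) ≠ 0 →
        s'.reg rY ≠ 0 ∧ s'.reg rY ≤ s.arr (aVal τ) (n + 2)) ∧
      (s'.reg rY ≠ 0 → ∃ τ ∈ l ++ [σ], s'.reg rZ = τ.code ∧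
        s'.reg rY = s.arr (aVal τ) (n + 2))) := by
    refine fun h5 => ⟨fun τ hτ => ?_, fun h6 => ?_⟩
    · rcases List.mem_append.1 hτ with hτ | hτ
      · exact h3 τ hτ
      · rwa [List.mem_singleton.1 hτ]
    · obtain ⟨τ, hτ, h7⟩ := h4 h6
      exact ⟨τ, List.mem_append_left _ hτ, h7⟩
  have new : s.arr (aVal σ) (n + 2) ≠ 0 →
      (s'.reg rY ≠ 0 → s.arr (aVal σ) (n + 2) < s'.reg rY) →
      ∀ τ ∈ l ++ [σ], s.arr (aVal τ) (n + 2) ≠ 0 →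
        s.arr (aVal σ) (n + 2) ≠ 0 ∧ s.arr (aVal σ) (n + 2) ≤ s.arr (aVal τ) (n + 2) := by
    intro h5 h6 τ hτ h7
    refine ⟨h5, ?_⟩
    rcases List.mem_append.1 hτ with hτ | hτ
    · have h8 := h3 τ hτ h7
      have h9 := h6 h8.1
      omega
    · rw [List.mem_singleton.1 hτ]
  simp only [chooseStep, Program.block, Program.wp, Instr.Safe, Instr.apply, Instr.value,
    Test.Holds, h1.root, h2, true_and]
  generalize s'.setReg rX (s.arr (aVal σ) (n + 2)) = s₁ at *
  simp only [hX, hY, hZ, L'.zero]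
  have L'' : Loaded n T Q len ((s₁.setReg rY (s.arr (aVal σ) (n + 2))).setReg rZ σ.code) :=
    (L'.setReg (by omega)).setReg (by omega)
  exact ⟨fun h5 => ⟨L', hA, keep fun h8 => absurd h5 h8⟩, fun h5 => ⟨fun h6 => ⟨by omega, L'', hA,
    by simpa using new h5 fun h8 => absurd h6 h8, fun _ => ⟨σ, by simp, by simp, by simp⟩⟩,
    fun h6 => ⟨fun h7 => ⟨by omega, L'', hA, by simpa using new h5 fun _ => h7,
      fun _ => ⟨σ, by simp, by simp, by simp⟩⟩, fun h7 => ⟨L', hA, keep fun _ => ⟨h6, by omega⟩⟩⟩⟩⟩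

/-- Pass the recorded statuses on to the nodes `rP` and `rC`, if the code `rX` is the one of `σ`. -/
def selectStep (σ : Status) : Program := .block [
  const rY σ.code,
  .ite (.eq rX rY)
    (.block [load rZ (aFst σ) rC, store aCur rP rZ, load rZ (aSnd σ) rC, store aCur rC rZ]) .skip]

/-- Split the status of the node `rP`, whose code is `rX`, into statuses of `rP` without `rC` and of
`rC`, as they were recorded. -/
def select : Program := .block (Status.all.map selectStep)

theorem select_spec {w n len c p : ℕ} {σ : Status} {T : Cotree} {Q : ℕ → ℕ} {s : State}
    (L : Loaded n T Q len s) (hc : s.reg rC = c) (hp : s.reg rP = p) (hX : s.reg rX = σ.code)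
    (hw : 8 ≤ w) :
    select.wp w (fun s' => Loaded n T Q len s' ∧ s'.reg rI = s.reg rI ∧
      (∀ a ≠ aCur, s'.arr a = s.arr a) ∧ s'.arr aCur =
        Function.update (Function.update (s.arr aCur) p (s.arr (aFst σ) c)) c (s.arr (aSnd σ) c))
      s := by
  refine Program.wp_mono (wp_block_map (fun l s' => Loaded n T Q len s' ∧
    (∀ r, r ≠ rY → r ≠ rZ → s'.reg r = s.reg r) ∧ (∀ a ≠ aCur, s'.arr a = s.arr a) ∧
    s'.arr aCur = if σ ∈ l then Function.update (Function.update (s.arr aCur) p (s.arr (aFst σ) c))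
      c (s.arr (aSnd σ) c) else s.arr aCur) Status.all ?_ (by simp [L])) ?_
  · rintro l τ s' - ⟨h1, h2, h3, h4⟩
    have hcl := τ.code_lt
    have e1 : s'.reg rC = c := (h2 21 (by omega) (by omega)).trans hc
    have e2 : s'.reg rP = p := (h2 22 (by omega) (by omega)).trans hp
    have e3 : s'.reg rX = σ.code := (h2 23 (by omega) (by omega)).trans hX
    have e4 := h3 (aFst τ) (by have := τ.code_lt; unfold aFst; omega)
    have e5 := h3 (aSnd τ) (by have := τ.code_lt; unfold aSnd; omega)
    have e6 : aSnd τ ≠ aCur := by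
      unfold aSnd
      omega
    simp only [selectStep, Program.block, Program.wp, Instr.Safe, Instr.apply, Instr.value,
      Test.Holds, true_and]
    simp only [State.setReg_reg, State.setReg_arr, State.setArr_reg, State.setArr_arr, if_true,
      Nat.reduceEqDiff, if_false, e1, e2, e3, e4, e5, e6, Status.code_inj]
    refine ⟨by omega, fun h5 => ⟨?_, fun r hr hr' => ?_, fun a ha => ?_, ?_⟩,
      fun h5 => ⟨h1.setReg (by omega), fun r hr hr' => ?_, h3, ?_⟩⟩
    · exact ((((h1.setReg (by omega)).setReg (by omega)).setArr (by omega)).setReg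
        (by omega)).setArr (by omega)
    · simp [hr, hr', h2]
    · simp [ha, h3]
    · subst h5
      simp [h4]
      split_ifs
      · funext i
        simp only [Function.update_apply]
        split_ifs <;> rfl
      · rfl
    · simp [hr]
      exact h2 r hr hr'
    · simp [h4, h5]
  · rintro s' ⟨h1, h2, h3, h4⟩
    exact ⟨h1, h2 20 (by omega) (by omega), h3, by simpa using h4⟩

/-- Determine the statuses of the node `rI - 1` of the queue and of its parent without it. -/
def traceBody : Program := .seq (sub rI rI rOne) (.seq (load rC aQueue rI)
  (.ite (.eq rC rRoot) .skip (.seq (load rP aPar rC) (.seq (load rX aCur rP) select))))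

/-- Determine statuses of the nodes, from the root down to the leaves. -/
def traceback : Program := .seq (move rI rLen) (.while (.lt rZero rI) traceBody)

/-- The number of steps of `traceback` for a cotree with `len` nodes. -/
def tracebackCost (len : ℕ) : ℕ := 1 + (len * (traceBody.cost + 1) + 1)

theorem traceBody_spec {w n len i : ℕ} {E R : ℕ → ℕ → Prop} {T : Cotree} {Q : ℕ → ℕ}
    {σ : Status} {cur : ℕ → Status} {s₀ s : State} (L : Loaded n T Q len s) (hI : s.reg rI = i + 1)
    (hi : i < len)
    (O : T.IsOrder (n + 2) Q len) (h : T.Represents (n + 2) E)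
    (hr : T.par (n + 2) ∉ insert (n + 2) T.nodes) (hw : 6 * n + 8 ≤ w)
    (F : Folded R T n Q len s₀) (hA : ∀ a ≠ aCur, s.arr a = s₀.arr a)
    (B : T.Traceback R (n + 2) n Q len σ (i + 1) cur)
    (hcur : ∀ a ∈ insert (n + 2) ((Finset.Ico (i + 1) len).image Q), s.arr aCur a = (cur a).code) :
    traceBody.wp w (fun s' => Loaded n T Q len s' ∧ s'.reg rI = i ∧
      (∀ a ≠ aCur, s'.arr a = s₀.arr a) ∧ ∃ cur, T.Traceback R (n + 2) n Q len σ i cur ∧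
        ∀ a ∈ insert (n + 2) ((Finset.Ico i len).image Q), s'.arr aCur a = (cur a).code) s := by
  have hmemO : ∀ a ∈ insert (n + 2) ((Finset.Ico (i + 1) len).image Q),
      a ∈ insert (n + 2) T.nodes := by
    intro a ha
    rcases Finset.mem_insert.1 ha with rfl | ha
    · exact Finset.mem_insert_self _ _
    · obtain ⟨k, hk, rfl⟩ := Finset.mem_image.1 ha
      exact O.mem k (Finset.mem_Ico.1 hk).2
  simp only [traceBody, Program.wp, Instr.Safe, Instr.apply, Instr.value, Test.Holds, hI, L.one,
    Nat.add_sub_cancel, true_and]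
  simp only [State.setReg_reg, State.setReg_arr, if_true, L.root, L.par, L.queue,
    Nat.reduceEqDiff, if_false]
  refine ⟨fun hroot => ⟨(L.setReg (by omega)).setReg (by omega), by simp, hA, cur,
    B.step_root hi hroot fun a ha => ?_, ?_⟩, fun hne => ?_⟩
  · rintro rfl
    exact hr (hmemO _ ha)
  · rwa [Cotree.image_Ico_eq hi, hroot, Finset.insert_idem]
  have hc : Q i ∈ T.nodes := (Finset.mem_insert.1 (O.mem i hi)).resolve_left hne
  have hpm := O.par_mem_image h.toIsTree hi hc
  obtain ⟨β, k1, k2, k3, k4, k5⟩ := F.recorded i hi hc _ (B.exists_optimal _ hpm)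
  refine Program.wp_mono (select_spec (σ := cur (T.par (Q i))) (c := Q i) (p := T.par (Q i))
    (n := n) (len := len) (T := T) (Q := Q) ?_ (by simp) (by simp) ?_ (by omega)) ?_
  · exact (((L.setReg (by omega)).setReg (by omega)).setReg (by omega)).setReg (by omega)
  · simp [hcur _ hpm]
  · rintro s' ⟨h1, h2, h3, h4⟩
    refine ⟨h1, h2.trans (by simp), fun a ha => (h3 a ha).trans (hA a ha), _,
      B.step O h hr rfl hi hc k3 k4 k5, fun a ha => ?_⟩
    simp only [State.setReg_arr] at h4
    have hF : ∀ τ : Status, aFst τ ≠ aCur := fun τ => by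
      have := τ.code_lt
      unfold aFst
      omega
    have hS : ∀ τ : Status, aSnd τ ≠ aCur := fun τ => by
      have := τ.code_lt
      unfold aSnd
      omega
    rw [h4, hA _ (hF _), hA _ (hS _), k1, k2]
    by_cases ha1 : a = Q i
    · subst ha1
      simp
    · rw [Function.update_of_ne ha1, Function.update_of_ne ha1]
      by_cases ha2 : a = T.par (Q i)
      · subst ha2
        simp
      · rw [Function.update_of_ne ha2, Function.update_of_ne ha2]
        refine hcur a ?_
        rw [Cotree.image_Ico_eq hi, Finset.insert_comm] at ha
        exact (Finset.mem_insert.1 ha).resolve_left ha1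

theorem traceback_spec {w n len : ℕ} {E R : ℕ → ℕ → Prop} {T : Cotree} {Q : ℕ → ℕ}
    {σ : Status} {s : State} (L : Loaded n T Q len s)
    (O : T.IsOrder (n + 2) Q len) (h : T.Represents (n + 2) E)
    (hr : T.par (n + 2) ∉ insert (n + 2) T.nodes) (hw : 6 * n + 8 ≤ w)
    (F : Folded R T n Q len s) (hroot : T.part n Q len (n + 2) = Finset.range n)
    (hcur : s.arr aCur (n + 2) = σ.code) (hex : ∃ S, Optimal R (Finset.range n) σ S) :
    HaltsWithin w traceback s (tracebackCost len) fun s' => Loaded n T Q len s' ∧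
      (∀ a ≠ aCur, s'.arr a = s.arr a) ∧ ∃ cur, T.Traceback R (n + 2) n Q len σ 0 cur ∧
        ∀ a ∈ insert (n + 2) T.nodes, s'.arr aCur a = (cur a).code := by
  refine HaltsWithin.seq_wp (P := move rI rLen) ?_
  simp only [Program.wp, Instr.Safe, Instr.apply, Instr.value, L.len, true_and]
  refine HaltsWithin.while_const (fun j s' => j ≤ len ∧ Loaded n T Q len s' ∧
    s'.reg rI = len - j ∧ (∀ a ≠ aCur, s'.arr a = s.arr a) ∧
    ∃ cur, T.Traceback R (n + 2) n Q len σ (len - j) cur ∧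
      ∀ a ∈ insert (n + 2) ((Finset.Ico (len - j) len).image Q), s'.arr aCur a = (cur a).code)
    traceBody.cost len ?_ ?_ ⟨by omega, L.setReg (by omega), by simp, fun _ _ => rfl,
      fun _ => σ, .start rfl hroot hex, by simp [hcur]⟩
  · rintro j s' ⟨h0, h1, h2, h3, cur, h4, h5⟩ hlt
    simp only [Test.Holds, h1.zero, h2] at hlt
    obtain ⟨i, rfl⟩ : ∃ i, len = j + i + 1 := ⟨len - j - 1, by omega⟩
    have e1 : j + i + 1 - j = i + 1 := by omega
    have e2 : j + i + 1 - (j + 1) = i := by omega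
    rw [e1] at h2 h4 h5
    rw [e2]
    refine ⟨by omega, HaltsWithin.of_wp (Program.wp_mono
      (traceBody_spec h1 h2 (by omega) O h hr hw F h3 h4 h5) ?_)⟩
    exact fun s'' hs'' => ⟨by omega, hs''⟩
  · rintro j s' ⟨h0, h1, h2, h3, cur, h4, h5⟩ hlt
    simp only [Test.Holds, h1.zero, h2] at hlt
    have e1 : len - j = 0 := by omega
    rw [e1] at h4 h5
    refine ⟨h1, h3, cur, h4, fun a ha => h5 a ?_⟩
    obtain ⟨k, hk, rfl⟩ := O.exists_eq a ha
    exact Finset.mem_insert_of_mem (Finset.mem_image.2 ⟨k, Finset.mem_Ico.2 ⟨by omega, hk⟩, rfl⟩)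

/-- Put the vertex `rI` into the output, if the set of its status is not empty. -/
def outputBody : Program := .block [load rX aCur rI, const rY 4,
  .ite (.lt rX rY) (store aOut rI rOne) .skip]

/-- Output the characteristic vector of the set described by the statuses of the leaves. -/
def output : Program := .seq (move rLen rNum) (forQueue outputBody)

/-- The number of steps of `output` for `n` vertices. -/
def outputCost (n : ℕ) : ℕ := 1 + (n * (outputBody.cost + 2) + 2)

theorem output_spec {w n len : ℕ} {T : Cotree} {Q : ℕ → ℕ} {cur : ℕ → Status} {s : State}
    (L : Loaded n T Q len s) (hw : 6 * n + 8 ≤ w) (hcur : ∀ v < n, s.arr aCur v = (cur v).code)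
    (hout : ∀ v, s.arr aOut v = 0) :
    HaltsWithin w output s (outputCost n) fun s' => ∀ v < n,
      s'.arr aOut v = if (cur v).2.2 = false then 1 else 0 := by
  have hcode : ∀ σ : Status, σ.code < 4 ↔ σ.2.2 = false := by decide
  refine HaltsWithin.seq_wp (P := move rLen rNum) ?_
  simp only [Program.wp, Instr.Safe, Instr.apply, Instr.value, L.num, true_and]
  refine (forQueue_spec (w := w) (len := n) (s := s.setReg rLen n)
    (fun i s' => s'.arr aCur = s.arr aCur ∧
    ∀ v, s'.arr aOut v = if v < i ∧ (cur v).2.2 = false then 1 else 0) (by simp)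
    (by simp [L.one]) (by omega) ⟨rfl, by simpa using hout⟩ ?_).mono le_rfl ?_
  · rintro i hi s' ⟨h1, h2⟩ hI hlen hone
    have h3 := hcode (cur i)
    simp [outputBody, hI, h1, hcur i hi, hone, hlen]
    refine ⟨by omega, fun h4 v => ?_, fun h4 v => ?_⟩
    · rw [h3] at h4
      by_cases hv : v = i
      · simp [hv, h4]
      · rw [Function.update_of_ne hv, h2]
        have : v ≤ i ↔ v < i := by omega
        simp only [this]
    · have h5 : ¬ (cur i).2.2 = false := fun h6 => by
        have := h3.2 h6
        omega
      rw [h2]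
      by_cases hv : v = i
      · simp [hv, h5]
      · have : v ≤ i ↔ v < i := by omega
        simp only [this]
  · rintro s' ⟨-, h2⟩ v hv
    simp [h2, hv]

/-! ### The whole algorithm -/

/-- Find a smallest separating and dominating set of a cograph, for the relation which is given by
adjacency, and by `c` on the diagonal. -/
def solve (c : Bool) : Program :=
  .seq build (.seq order (.seq (fold c) (.seq choose (.ite (.eq rY rZero) (const rNum 0)
    (.seq (store aCur rRoot rZ) (.seq traceback (.seq output (const rNum 1))))))))

/-- The number of steps of `solve` for a graph with the degrees `d`. -/
def solveCost (c : Bool) (n : ℕ) (d : ℕ → ℕ) : ℕ :=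
  buildCost n d + (orderCost n + (foldCost c (2 * (n + 2)) + (choose.cost + (1 +
    (1 + (tracebackCost (2 * (n + 2)) + (outputCost n + 1))) + 1))))

theorem part_root {n len : ℕ} {T : Cotree} {Q : ℕ → ℕ}
    (O : T.IsOrder (n + 2) Q len) (h : T.IsTree (n + 2))
    (hdesc : T.desc (n + 2) = Finset.range n ∪ {n, n + 1}) :
    T.part n Q len (n + 2) = Finset.range n := by
  refine Cotree.part_subset_range.antisymm fun v hv => ?_
  obtain ⟨a, ha, hap, hva⟩ := h.cover (n + 2) (Finset.mem_insert_self _ _) le_rfl v (by simp_all)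
  obtain ⟨k, hk, rfl⟩ := O.exists_eq a (Finset.mem_insert_of_mem ha)
  refine Finset.mem_union_right _ (Finset.mem_biUnion.2 ⟨k, ?_, ?_⟩)
  · simp [hk, hap]
  · exact Finset.mem_filter.2 ⟨hva, Finset.mem_range.1 hv⟩

theorem solve_spec {w n : ℕ} {c : Bool} {E R : ℕ → ℕ → Prop} {d : ℕ → ℕ} {s : State}
    (hadj : Adjacency n E d s) (hE : PathFree E) (hsymm : ∀ u v, E u v → E v u)
    (hEn : ∀ u v, E u v → v < n) (hR : ∀ u v, u ≠ v → (R u v ↔ E u v))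
    (hself : ∀ v < n, (R v v ↔ c)) (hnum : s.reg rNum = n) (hreg : ∀ r ≠ 0, s.reg r = 0)
    (harr : ∀ a, 1 < a → ∀ i, s.arr a i = 0) (hd : ∑ i ∈ Finset.range n, d i ≤ w)
    (hw : 6 * n + 8 ≤ w) :
    HaltsWithin w (solve c) s (solveCost c n d) fun s' =>
      (s'.reg rNum = 1 ∧ ∃ (S : Finset ℕ) (σ : Status), σ.1 = false ∧
        Feasible R (Finset.range n) σ S ∧
        (∀ τ S', τ.1 = false → Feasible R (Finset.range n) τ S' → S.card ≤ S'.card) ∧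
        ∀ v < n, s'.arr aOut v = if v ∈ S then 1 else 0) ∨
      (s'.reg rNum = 0 ∧ ∀ σ S, σ.1 = false → ¬ Feasible R (Finset.range n) σ S) := by
  refine HaltsWithin.seq ((build_spec hadj hE hsymm hEn hnum hreg (fun a ha => harr a (by omega))
    hd hw).mono le_rfl ?_)
  rintro s₁ ⟨T, B⟩
  have H := B.heap
  have h := B.represents
  have hr := H.par_root_notMem
  refine HaltsWithin.seq ((order_spec H B.desc hw).mono le_rfl ?_)
  rintro s₂ ⟨len, hlen, hlen₂, O, hA₂⟩
  have L₂ : Loaded n T (s₂.arr aQueue) len s₂ :=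
    ⟨(hA₂.1 0 (by omega) (by simp)).trans H.num, (hA₂.1 1 (by omega) (by simp)).trans H.one,
      (hA₂.1 3 (by omega) (by simp)).trans H.root, (hA₂.1 14 (by omega) (by simp)).trans H.zero,
      hlen₂, (hA₂.2 3 (by simp)).trans H.par, (hA₂.2 4 (by simp)).trans H.ty, rfl⟩
  generalize s₂.arr aQueue = Q at O L₂
  refine HaltsWithin.seq ((fold_spec L₂ O h B.alternates hr hsymm hR hself hlen hw).mono ?_ ?_)
  · unfold foldCost
    gcongr
  rintro s₃ ⟨L₃, F, hA₃⟩
  have hroot := part_root O h.toIsTree B.desc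
  have hval := F.isValue (n + 2) (Finset.mem_insert_self _ _)
  rw [hroot] at hval
  refine HaltsWithin.seq_wp (Program.wp_mono (choose_spec L₃ (by omega)) ?_)
  rintro s₄ ⟨L₄, h1, h2, h3⟩
  have F₄ := F.congr fun a _ => congrFun h1 a
  have hout : s₄.arr aOut = s.arr aOut := by
    rw [h1, hA₃ 2 (by omega), hA₂.2 2 (by simp), B.agree 2 (by simp)]
  refine HaltsWithin.ite (fun h4 => HaltsWithin.of_wp (P := const rNum 0) ?_) fun h4 => ?_
  · simp only [Test.Holds, L₄.zero] at h4
    simp only [Program.wp, Instr.Safe, Instr.apply, Instr.value]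
    refine ⟨by omega, .inr ⟨by simp, fun σ S hσ hS => ?_⟩⟩
    by_cases h5 : s₃.arr (aVal σ) (n + 2) = 0
    · exact (hval σ).eq_zero_iff.1 h5 S hS
    · exact (h2 σ hσ h5).1 h4
  simp only [Test.Holds, L₄.zero] at h4
  obtain ⟨τ, hτ, hZ, hY⟩ := h3 h4
  rw [hY] at h2 h4
  obtain ⟨S₀, hS₀⟩ := (hval τ).exists_optimal h4
  refine HaltsWithin.seq_wp (P := store aCur rRoot rZ) ?_
  simp only [Program.wp, Instr.Safe, Instr.apply, Instr.value, L₄.root, hZ, true_and]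
  have F₅ : Folded R T n Q len (s₄.setArr aCur (n + 2) τ.code) := by
    refine F₄.congr fun a ha => ?_
    rw [State.setArr_arr, if_neg (by omega)]
  refine HaltsWithin.seq ((traceback_spec (L₄.setArr (by omega)) O h hr hw F₅ hroot (by simp)
    ⟨S₀, hS₀⟩).mono ?_ ?_)
  · unfold tracebackCost
    gcongr
  rintro s₆ ⟨L₆, hA₆, cur, hB, hcur⟩
  have hleaf : ∀ v < n, v ∈ insert (n + 2) T.nodes := fun v hv => Finset.mem_insert_of_mem
    ((h.leaf_iff v (by omega)).2 (by simp [B.desc, hv]))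
  have hS := hB.finish fun v hv => O.exists_eq v (hleaf v hv)
  refine HaltsWithin.seq ((output_spec L₆ hw (fun v hv => hcur v (hleaf v hv)) fun v => ?_).mono
    le_rfl ?_)
  · rw [hA₆ 2 (by omega)]
    simp [hout, harr]
  intro s₇ h7
  refine HaltsWithin.of_wp (P := const rNum 1) ?_
  simp only [Program.wp, Instr.Safe, Instr.apply, Instr.value]
  refine ⟨by omega, .inl ⟨by simp, _, τ, hτ, hS.feasible, fun σ S' hσ hS' => ?_, fun v hv => ?_⟩⟩
  · have h8 : s₃.arr (aVal σ) (n + 2) ≠ 0 := fun h9 => (hval σ).eq_zero_iff.1 h9 S' hS'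
    obtain ⟨S₁, hS₁⟩ := (hval σ).exists_optimal h8
    have h9 := (hval σ).card_eq hS₁
    have h10 := (hval τ).card_eq hS
    have h11 := (h2 σ hσ h8).2
    have h12 := hS₁.le S' hS'
    omega
  · rw [State.setReg_arr, h7 v hv]
    simp [hv]

/-- The costs of all parts are linear in `n` and in the sum of the degrees; as `n` is positive, the
constant terms are absorbed. -/
theorem exists_solveCost_le (c : Bool) : ∃ K, ∀ (n : ℕ) (d : ℕ → ℕ), 0 < n →
    solveCost c n d ≤ K * (n + ∑ x ∈ Finset.range n, d x) := by
  let g := 3 + 2 * (sweepBody.cost + 1) + 2 * ((leafBody c).cost + 2) +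
    2 * (forwardBody.cost + 2) + 2 * (traceBody.cost + 1)
  let e := (buildStart.cost + 1) + choose.cost + 30
  refine ⟨(insertCost 0 + 2 + insertCost 1) + g * 3 + (outputBody.cost + 2) + e, fun n d hn => ?_⟩
  have h1 := buildCost_le n d
  generalize ∑ x ∈ Finset.range n, d x = m at *
  have h2 : g * (n + 2) ≤ g * (3 * (n + m)) := Nat.mul_le_mul_left _ (by omega)
  have h3 : e * 1 ≤ e * (n + m) := Nat.mul_le_mul_left _ (by omega)
  have h4 : (outputBody.cost + 2) * n ≤ (outputBody.cost + 2) * (n + m) :=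
    Nat.mul_le_mul_left _ (by omega)
  simp only [solveCost, orderCost, foldCost, tracebackCost, outputCost, g, e] at *
  generalize sweepBody.cost = k1 at *
  generalize (leafBody c).cost = k2 at *
  generalize forwardBody.cost = k3 at *
  generalize traceBody.cost = k4 at *
  generalize outputBody.cost = k5 at *
  generalize choose.cost = k6 at *
  generalize buildStart.cost = k7 at *
  generalize insertCost 0 + 2 + insertCost 1 = k8 at *
  generalize buildCost n d = k9 at *
  linarith

end WordRAM

/-! ### Correctness for adjacency lists -/

/-- The `x`-th list starts in the concatenation behind the first `x` lists. -/
theorem List.getElem?_flatten_add {α : Type*} {l : List (List α)} {x j : ℕ} (hx : x < l.length)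
    (hj : j < l[x].length) : l.flatten[(l.take x).flatten.length + j]? = l[x][j]? := by
  have h : l.flatten = (l.take x).flatten ++ (l[x] ++ (l.drop (x + 1)).flatten) := by
    rw [← List.flatten_cons, ← List.drop_eq_getElem_cons hx, ← List.flatten_append,
      List.take_append_drop]
  rw [h, List.getElem?_append_right (by omega), Nat.add_sub_cancel_left,
    List.getElem?_append_left hj]

/-- The feasible sets without missed vertices are the dominating and separating sets. -/
theorem exists_status_iff {R : ℕ → ℕ → Prop} {M S : Finset ℕ} :
    (∃ σ : Status, σ.1 = false ∧ Feasible R M σ S) ↔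
      S ⊆ M ∧ (∀ v ∈ M, ∃ x ∈ S, R x v) ∧ Separates R S M := by
  constructor
  · rintro ⟨σ, hσ, h1, h2, h3⟩
    refine ⟨h1, ?_, h2⟩
    rw [← h3] at hσ
    simpa [status] using hσ
  · rintro ⟨h1, h2, h3⟩
    exact ⟨_, by simpa [status] using h2, h1, h3, rfl⟩

/-- A relation on `0, …, n - 1`, as a relation on natural numbers. -/
def natRel {n : ℕ} (r : Fin n → Fin n → Prop) (u v : ℕ) : Prop :=
  ∃ (hu : u < n) (hv : v < n), r ⟨u, hu⟩ ⟨v, hv⟩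

section

variable {n : ℕ} {r : Fin n → Fin n → Prop}

@[simp] theorem natRel_val {u v : Fin n} : natRel r u v ↔ r u v := by simp [natRel]

theorem exists_feasible_map_iff {S : Finset (Fin n)} :
    (∃ σ : Status, σ.1 = false ∧
      Feasible (natRel r) (Finset.range n) σ (S.map Fin.valEmbedding)) ↔
    (∀ v, ∃ x ∈ S, r x v) ∧ ∀ u v, u ≠ v → ∃ x ∈ S, ¬ (r x u ↔ r x v) := by
  rw [exists_status_iff]
  constructor
  · rintro ⟨-, h1, h2⟩
    refine ⟨fun v => ?_, fun u v huv => ?_⟩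
    · obtain ⟨x, hx, hxv⟩ := h1 v (by simp)
      obtain ⟨y, hy, rfl⟩ := Finset.mem_map.1 hx
      exact ⟨y, hy, natRel_val.1 hxv⟩
    · obtain ⟨x, hx, hxv⟩ := h2 u (by simp) v (by simp) (Fin.val_ne_of_ne huv)
      obtain ⟨y, hy, rfl⟩ := Finset.mem_map.1 hx
      refine ⟨y, hy, ?_⟩
      simpa using hxv
  · rintro ⟨h1, h2⟩
    refine ⟨fun v hv => ?_, fun v hv => ?_, fun u hu v hv huv => ?_⟩
    · obtain ⟨x, hx, rfl⟩ := Finset.mem_map.1 hv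
      simp
    · obtain ⟨x, hx, hxv⟩ := h1 ⟨v, Finset.mem_range.1 hv⟩
      exact ⟨x, Finset.mem_map_of_mem _ hx, x.2, Finset.mem_range.1 hv, hxv⟩
    · rw [Finset.mem_range] at hu hv
      obtain ⟨x, hx, hxv⟩ := h2 ⟨u, hu⟩ ⟨v, hv⟩ (by simpa using huv)
      exact ⟨x, Finset.mem_map_of_mem _ hx, fun h => hxv
        ((natRel_val (r := r) (v := ⟨u, hu⟩)).symm.trans
          (h.trans (natRel_val (v := ⟨v, hv⟩))))⟩

theorem exists_map_eq {S : Finset ℕ} (h : S ⊆ Finset.range n) :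
    ∃ S' : Finset (Fin n), S'.map Fin.valEmbedding = S := by
  refine ⟨Finset.univ.filter fun v => (v : ℕ) ∈ S, ?_⟩
  ext v
  simp only [Finset.mem_map, Finset.mem_filter, Finset.mem_univ, true_and, Fin.valEmbedding_apply]
  constructor
  · rintro ⟨v, hv, rfl⟩
    exact hv
  · exact fun hv => ⟨⟨v, Finset.mem_range.1 (h hv)⟩, hv, rfl⟩

/-- The length of the list of `x`. -/
def listLength (L : Fin n → List (Fin n)) (x : ℕ) : ℕ := if h : x < n then (L ⟨x, h⟩).length else 0

variable {G : SimpleGraph (Fin n)} {L : Fin n → List (Fin n)}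

theorem length_flatten_take (L : Fin n → List (Fin n)) {x : ℕ} (hx : x ≤ n) :
    ((List.ofFn L).take x).flatten.length = ∑ i ∈ Finset.range x, listLength L i := by
  induction x with
  | zero => simp
  | succ x ih =>
    rw [List.take_succ_eq_append_getElem (by simpa using hx), List.flatten_append,
      List.length_append, ih (by omega), Finset.sum_range_succ, listLength,
      dif_pos (show x < n from hx)]
    simp

theorem sum_listLength (hL : IsAdjacencyList G L) :
    ∑ i ∈ Finset.range n, listLength L i = 2 * G.edgeSet.ncard := by
  classical
  have h1 : G.edgeSet.ncard = G.edgeFinset.card := by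
    rw [← SimpleGraph.coe_edgeFinset, Set.ncard_coe_finset]
  rw [h1, ← G.sum_degrees_eq_twice_card_edges, Finset.sum_range]
  refine Finset.sum_congr rfl fun v _ => ?_
  rw [listLength, dif_pos v.2, ← List.toFinset_card_of_nodup (hL v).1]
  congr 1
  ext u
  simp [(hL v).2]

theorem inputState_arr_add {x j : ℕ} (hx : x < n) (hj : j < (L ⟨x, hx⟩).length) :
    (inputState L).arr 1 (∑ i ∈ Finset.range x, listLength L i + j) =
      ((L ⟨x, hx⟩)[j] : ℕ) := by
  have h := List.getElem?_flatten_add (l := List.ofFn L) (x := x) (j := j) (by simpa using hx)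
    (by simpa using hj)
  rw [length_flatten_take L hx.le] at h
  simp only [inputState, one_ne_zero, if_false, if_true, List.getD_eq_getElem?_getD,
    List.getElem?_map, h]
  simp [hj]

theorem inputState_bdd {w : ℕ} (hn : n ≤ w) (hw : ∑ i ∈ Finset.range n, listLength L i ≤ w) :
    (inputState L).Bdd w := by
  refine ⟨fun r => ?_, fun a i => ?_⟩
  · simp only [inputState]
    split_ifs <;> omega
  · simp only [inputState]
    split_ifs with h1 h2 h3
    · rw [length_flatten_take L h2]
      refine (Finset.sum_le_sum_of_subset ?_).trans hw
      simpa using h2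
    · omega
    · rw [List.getD_eq_getElem?_getD, List.getElem?_map]
      cases (List.ofFn L).flatten[i]? with
      | none => simp
      | some v =>
        simp
        omega
    · omega

theorem adjacency_inputState (hL : IsAdjacencyList G L) :
    WordRAM.Adjacency n (natRel G.Adj) (listLength L) (inputState L) := by
  have hlen : ∀ x (hx : x < n), listLength L x = (L ⟨x, hx⟩).length := fun x hx => dif_pos hx
  refine ⟨fun x hx => ?_, fun x hx j hj k hk hjk => ?_, fun x hx y => ?_⟩
  · simp only [inputState, if_true, if_pos hx]
    exact length_flatten_take L hx
  · rw [hlen x hx] at hj hk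
    rw [inputState_arr_add hx hj, inputState_arr_add hx hk] at hjk
    exact (hL ⟨x, hx⟩).1.getElem_inj_iff.1 (Fin.ext hjk)
  · rw [hlen x hx]
    constructor
    · rintro ⟨j, hj, rfl⟩
      rw [inputState_arr_add hx hj]
      exact ⟨hx, Fin.isLt _, ((hL ⟨x, hx⟩).2 _).1 (List.getElem_mem hj)⟩
    · rintro ⟨_, hy, h⟩
      obtain ⟨j, hj, hjy⟩ := List.getElem_of_mem (((hL ⟨x, hx⟩).2 _).2 h : (⟨y, hy⟩ : Fin n) ∈ _)
      exact ⟨j, hj, by rw [inputState_arr_add hx hj, hjy]⟩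

end

/-- Properties that require `R G` to be dominating and separating are handled by `solve`, if `R G`
is adjacency off the diagonal, and `c` on the diagonal. -/
theorem solve_constructs {P : ∀ {n : ℕ}, SimpleGraph (Fin n) → Finset (Fin n) → Prop} (c : Bool)
    (R : ∀ {n : ℕ}, SimpleGraph (Fin n) → Fin n → Fin n → Prop)
    (hR : ∀ (n : ℕ) (G : SimpleGraph (Fin n)) (u v : Fin n), u ≠ v → (R G u v ↔ G.Adj u v))
    (hself : ∀ (n : ℕ) (G : SimpleGraph (Fin n)) (v : Fin n), R G v v ↔ c)
    (hP : ∀ (n : ℕ) (G : SimpleGraph (Fin n)) (S : Finset (Fin n)), P G S ↔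
      (∀ v, ∃ x ∈ S, R G x v) ∧ ∀ u v, u ≠ v → ∃ x ∈ S, ¬ (R G x u ↔ R G x v)) :
    ConstructsMinimumOnCographs P (WordRAM.solve c) := by
  obtain ⟨K, hK⟩ := WordRAM.exists_solveCost_le c
  refine ⟨2 * K + 14, fun n G L hG hL => ?_⟩
  have hn : 0 < n := Fin.pos_iff_nonempty.2 hG.nonempty
  have hsum := sum_listLength hL
  set m := G.edgeSet.ncard
  have hw : 14 * (n + m) ≤ (2 * K + 14) * (n + m) := Nat.mul_le_mul_right _ (by omega)
  have hcost : WordRAM.solveCost c n (listLength L) ≤ (2 * K + 14) * (n + m) := by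
    refine (hK n _ hn).trans ?_
    rw [hsum]
    nlinarith
  obtain ⟨t, s, h1, h2, -, h3⟩ := WordRAM.solve_spec (w := (2 * K + 14) * (n + m)) (c := c)
    (E := natRel G.Adj) (R := natRel (R G)) (d := listLength L) (adjacency_inputState hL)
    (fun a b c d ⟨ha, hb, k1⟩ ⟨_, hc, k2⟩ ⟨_, hd, k3⟩ k4 k5 k6 =>
      hG.pathFree ⟨a, ha⟩ ⟨b, hb⟩ ⟨c, hc⟩ ⟨d, hd⟩ k1 k2 k3 (fun h => k4 ⟨ha, hc, h⟩)
        (fun h => k5 ⟨hb, hd, h⟩) fun h => k6 ⟨ha, hd, h⟩)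
    (fun u v ⟨hu, hv, h⟩ => ⟨hv, hu, h.symm⟩) (fun u v ⟨_, hv, _⟩ => hv)
    (fun u v huv => exists_congr fun hu => exists_congr fun hv =>
      hR n G ⟨u, hu⟩ ⟨v, hv⟩ (by simpa using huv))
    (fun v hv => (natRel_val (u := ⟨v, hv⟩) (v := ⟨v, hv⟩)).trans (hself n G ⟨v, hv⟩))
    (by simp [inputState]) (fun r hr => by simp [inputState, hr])
    (fun a ha i => by simp [inputState, show a ≠ 0 by omega, show a ≠ 1 by omega])
    (by omega) (by omega) (inputState_bdd (by omega) (by omega))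
  refine ⟨t, s, h1, h2.trans hcost, ?_⟩
  have hP' : ∀ S, P G S ↔ _ := fun S => (hP n G S).trans exists_feasible_map_iff.symm
  rcases h3 with ⟨h4, S, σ, hσ, hS, hmin, hout⟩ | ⟨h4, hnone⟩
  · obtain ⟨S, rfl⟩ := exists_map_eq hS.subset
    refine .inl ⟨h4, S, fun v => ?_, (hP' S).2 ⟨σ, hσ, hS⟩, fun S' hS' => ?_⟩
    · rw [hout v v.2]
      simp [Fin.val_inj]
    · obtain ⟨τ, hτ, hS''⟩ := (hP' S').1 hS'
      simpa using hmin τ _ hτ hS''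
  · refine .inr ⟨h4, ?_⟩
    rintro ⟨S, hS⟩
    obtain ⟨τ, hτ, hS'⟩ := (hP' S).1 hS
    exact hnone τ _ hτ hS'

theorem mainTheorem11 :
    (∃ A : WordRAM.Program,
      ConstructsMinimumOnCographs (fun G S => IsIdentifyingCode G S) A) ∧
    (∃ A : WordRAM.Program,
      ConstructsMinimumOnCographs (fun G S => IsOpenLocatingDominatingSet G S) A) := by
  refine ⟨⟨_, solve_constructs true (fun G => Dominates G) ?_ ?_ fun _ _ _ => Iff.rfl⟩,
    ⟨_, solve_constructs false (fun G => G.Adj) ?_ ?_ fun _ _ _ => Iff.rfl⟩⟩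
  · intro n G u v huv
    simp [Dominates, huv]
  · simp [Dominates]
  · simp
  · simp
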